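/- Let $n\ge 1$, $0<\alpha<1$, $T>0$, $p>2$, $H=L^2(\mathbb R^n)$ with norm $\|\cdot\|$ and inner product $(\cdot,\cdot)$, and let $V=H^\alpha(\mathbb R^n)$ be the space of all $u\in H$ with $\iint \frac{|u(x)-u(y)|^2}{|x-y|^{n+2\alpha}}\,dx\,dy<\infty$, with norm $\|u\|_V^2=\|u\|^2+\mathcal E(u,u)$, where $$\mathcal E(u,w)=\big((-\Delta)^{\alpha/2}u,(-\Delta)^{\alpha/2}w\big)=\frac{C(n,\alpha)}2\iint\frac{(u(x)-u(y))(w(x)-w(y))}{|x-y|^{n+2\alpha}}\,dx\,dy,\qquad C(n,\alpha)=\frac{\alpha 4^\alpha\Gamma(\frac{n+2\alpha}2)}{\pi^{n/2}\Gamma(1-\alpha)}.$$ Assumptions. (i) $F:\mathbb R\times\mathbb R^n\times\mathbb R\to\mathbb R$ is continuous and differentiable in $u$, and for all $t,u,u_1,u_2\in\mathbb R$ and $x\in\mathbb R^n$, $$F(t,x,0)=0,\qquad F(t,x,u)u\ge\lambda_1|u|^p-\psi_1(t,x),\qquad \frac{\partial F}{\partial u}(t,x,u)\ge-\psi_3(t,x),$$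 $$|F(t,x,u_1)-F(t,x,u_2)|\le\lambda_2\big(\psi_2(t,x)+|u_1|^{p-2}+|u_2|^{p-2}\big)|u_1-u_2|,$$ where $\lambda_1,\lambda_2>0$, $\psi_1\in L^1_{loc}(\mathbb R,L^1(\mathbb R^n))$ and $\psi_2,\psi_3\in L^\infty_{loc}(\mathbb R,L^\infty(\mathbb R^n))\cap L^1_{loc}(\mathbb R,L^1(\mathbb R^n))$. (ii) $\sigma(t,x,s)=\sigma_1(t,x)+\kappa(x)\sigma_2(t,x,s)\in l^2$, where $\kappa\in L^2(\mathbb R^n)\cap L^\infty(\mathbb R^n)$, $\sigma_1:\mathbb R\to L^2(\mathbb R^n,l^2)$ is continuous, and $\sigma_2=\{\sigma_{2,k}\}_{k=1}^\infty$ is measurable in $(t,x)$ and satisfies, for some positive numbers $\alpha_k,\beta_k,\gamma_k$ with $\sum_k(\alpha_k^2+\beta_k^2+\gamma_k^2)<\infty$ and all $t,x,s,s_1,s_2$, $$|\sigma_{2,k}(t,x,s_1)-\sigma_{2,k}(t,x,s_2)|\le\alpha_k|s_1-s_2|,\qquad|\sigma_{2,k}(t,x,s)|\le\beta_k+\gamma_k|s|.$$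 For $u\in H$ and $v=\{v_k\}_{k=1}^\infty\in l^2$ let $(\sigma(t,u)v)(x)=\sum_k\big(\sigma_{1,k}(t,x)+\kappa(x)\sigma_{2,k}(t,x,u(x))\big)v_k$. (iii) $g\in L^2_{loc}(\mathbb R,L^2(\mathbb R^n))$ and $u_0\in H$. For a control $v\in L^2(0,T;l^2)$, a solution $u_v$ of the controlled equation $$\frac{du_v}{dt}+(-\Delta)^\alpha u_v+F(t,\cdot,u_v)=g(t)+\sigma(t,u_v)v(t),\qquad u_v(0)=u_0,$$ is a function $u_v\in C([0,T],H)\cap L^2(0,T;V)\cap L^p(0,T;L^p(\mathbb R^n))$ such that for all $t\in[0,T]$ and $\xi\in V\cap L^p(\mathbb R^n)$ $$(u_v(t),\xi)+\int_0^t\mathcal E(u_v(s),\xi)\,ds+\int_0^t\!\int_{\mathbb R^n}F(s,x,u_v(s))\,\xi(x)\,dx\,ds=(u_0,\xi)+\int_0^t(g(s),\xi)\,ds+\int_0^t(\sigma(s,u_v(s))v(s),\xi)\,ds.$$ Then the following hold. 1. Let $v,v_k\in L^2(0,T;l^2)$ $(k\in\mathbb N)$ and let $u_v,u_{v_k}$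 be solutions of the controlled equation with the same initial value $u_0$, corresponding to $v$ and $v_k$. If $v_k\to v$ weakly in $L^2(0,T;l^2)$, then $u_{v_k}\to u_v$ strongly in $C([0,T],H)\cap L^2(0,T;V)$. 2. For every $N>0$ the set $K_N$ of all solutions $u_v$ of the controlled equation with $v\in L^2(0,T;l^2)$, $\int_0^T\|v(t)\|_{l^2}^2\,dt\le N$, is a compact subset of $C([0,T],H)\cap L^2(0,T;V)$. -/

import Mathlib

open MeasureTheory Filter Topology
open scoped ENNReal

namespace FracControl

/-- The space `ℝⁿ`. -/
abbrev E (n : ℕ) : Type := EuclideanSpace ℝ (Fin n)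

/-- `H = L²(ℝⁿ)`. -/
abbrev H (n : ℕ) : Type := Lp ℝ 2 (volume : Measure (E n))

/-- The space `l²` of square summable real sequences. -/
abbrev Ell2 : Type := lp (fun _ : ℕ => ℝ) 2

/-! ### The fractional Sobolev space -/

/-- `C(n,α) = α 4^α Γ((n+2α)/2) / (π^{n/2} Γ(1-α))`. -/
noncomputable def fracConst (n : ℕ) (α : ℝ) : ℝ :=
  α * 4 ^ α * Real.Gamma ((n + 2 * α) / 2) / (Real.pi ^ ((n : ℝ) / 2) * Real.Gamma (1 - α))

theorem fracConst_nonneg (n : ℕ) (α : Set.Ioo (0 : ℝ) 1) : 0 ≤ fracConst n α := by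
  have h0 : (0 : ℝ) < α := α.2.1
  have h1 : (0 : ℝ) < 1 - α := sub_pos.2 α.2.2
  have h2 : (0 : ℝ) < (n + 2 * (α : ℝ)) / 2 := by positivity
  have h3 := Real.Gamma_pos_of_pos h1
  have h4 := Real.Gamma_pos_of_pos h2
  unfold fracConst
  positivity

/-- `(u(x)-u(y)) (w(x)-w(y)) / |x-y|^{n+2α}`, as a function of `(x,y)`. -/
noncomputable def fracKernel (n : ℕ) (α : ℝ) (u w : E n → ℝ) (z : E n × E n) : ℝ :=
  (u z.1 - u z.2) * (w z.1 - w z.2) / ‖z.1 - z.2‖ ^ ((n : ℝ) + 2 * α)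

/-- The bilinear form of the fractional Laplacian,
`((-Δ)^{α/2} u, (-Δ)^{α/2} w)_{L²} = (C(n,α)/2) ∬ (u(x)-u(y)) (w(x)-w(y)) / |x-y|^{n+2α} dx dy`. -/
noncomputable def fracForm (n : ℕ) (α : ℝ) (u w : E n → ℝ) : ℝ :=
  1 / 2 * fracConst n α * ∫ z : E n × E n, fracKernel n α u w z

theorem fracKernel_self (n : ℕ) (α : ℝ) (u : E n → ℝ) (z : E n × E n) :
    fracKernel n α u u z = (u z.1 - u z.2) ^ 2 / ‖z.1 - z.2‖ ^ ((n : ℝ) + 2 * α) := by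
  simp only [fracKernel, sq]

theorem fracKernel_self_nonneg (n : ℕ) (α : ℝ) (u : E n → ℝ) (z : E n × E n) :
    0 ≤ fracKernel n α u u z := by
  rw [fracKernel_self]
  positivity

/-- An almost everywhere equality in `x` gives one in the pair `(x,y)`, in both variables. -/
theorem ae_prod_of_ae (n : ℕ) {P : E n → Prop} (h : ∀ᵐ x, P x) :
    ∀ᵐ z : E n × E n, P z.1 ∧ P z.2 := by
  have h1 : ∀ᵐ z : E n × E n, P z.1 :=
    (Measure.quasiMeasurePreserving_fst (μ := (volume : Measure (E n)))
      (ν := (volume : Measure (E n)))).ae h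
  have h2 : ∀ᵐ z : E n × E n, P z.2 :=
    (Measure.quasiMeasurePreserving_snd (μ := (volume : Measure (E n)))
      (ν := (volume : Measure (E n)))).ae h
  exact h1.and h2

theorem fracKernel_add_left (n : ℕ) (α : ℝ) (u v w : H n) :
    fracKernel n α (u + v : H n) w =ᵐ[volume]
      fun z => fracKernel n α u w z + fracKernel n α v w z := by
  filter_upwards [ae_prod_of_ae n (Lp.coeFn_add u v)] with z hz
  simp only [fracKernel, hz.1, hz.2, Pi.add_apply]
  ring

theorem fracKernel_smul_left (n : ℕ) (α : ℝ) (c : ℝ) (u w : H n) :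
    fracKernel n α (c • u : H n) w =ᵐ[volume] fun z => c * fracKernel n α u w z := by
  filter_upwards [ae_prod_of_ae n (Lp.coeFn_smul c u)] with z hz
  simp only [fracKernel, hz.1, hz.2, Pi.smul_apply, smul_eq_mul]
  ring

theorem fracKernel_aesm (n : ℕ) (α : ℝ) (u w : H n) :
    AEStronglyMeasurable (fracKernel n α u w) volume := by
  have hq1 := Measure.quasiMeasurePreserving_fst (μ := (volume : Measure (E n)))
    (ν := (volume : Measure (E n)))
  have hq2 := Measure.quasiMeasurePreserving_snd (μ := (volume : Measure (E n)))
    (ν := (volume : Measure (E n)))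
  have d : ∀ f : H n, AEMeasurable (fun z : E n × E n => f z.1 - f z.2) volume := fun f =>
    (((Lp.aestronglyMeasurable f).comp_quasiMeasurePreserving hq1).sub
      ((Lp.aestronglyMeasurable f).comp_quasiMeasurePreserving hq2)).aemeasurable
  have hk : Measurable fun z : E n × E n => ‖z.1 - z.2‖ ^ ((n : ℝ) + 2 * α) :=
    ((measurable_fst.sub measurable_snd).norm).pow_const _
  exact (((d u).mul (d w)).div hk.aemeasurable).aestronglyMeasurable

theorem fracKernel_integrable (n : ℕ) (α : ℝ) (u w : H n)
    (hu : Integrable (fracKernel n α u u) volume)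
    (hw : Integrable (fracKernel n α w w) volume) :
    Integrable (fracKernel n α u w) volume := by
  refine (hu.add hw).mono' (fracKernel_aesm n α u w) (ae_of_all _ fun z => ?_)
  have hpos : 0 ≤ ‖z.1 - z.2‖ ^ ((n : ℝ) + 2 * α) := by positivity
  simp only [Pi.add_apply, fracKernel, Real.norm_eq_abs, abs_div, abs_of_nonneg hpos, ← add_div]
  refine div_le_div_of_nonneg_right ?_ hpos
  rw [abs_le]
  constructor <;>
    nlinarith [sq_nonneg ((u z.1 - u z.2) - (w z.1 - w z.2)),
      sq_nonneg ((u z.1 - u z.2) + (w z.1 - w z.2)), sq_nonneg (u z.1 - u z.2),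
      sq_nonneg (w z.1 - w z.2)]

theorem fracKernel_comm (n : ℕ) (α : ℝ) (u w : E n → ℝ) :
    fracKernel n α u w = fracKernel n α w u := by
  funext z
  simp only [fracKernel, mul_comm]

/-- `H^α(ℝⁿ)` as a linear subspace of `L²(ℝⁿ)`:
the `u` with `∬ |u(x)-u(y)|² / |x-y|^{n+2α} dx dy < ∞`. -/
noncomputable def fracSubmodule (n : ℕ) (α : ℝ) : Submodule ℝ (H n) where
  carrier := {u | Integrable (fracKernel n α u u) volume}
  zero_mem' := by
    refine (integrable_zero _ _ _).congr ?_
    filter_upwards [ae_prod_of_ae n (Lp.coeFn_zero ℝ 2 (volume : Measure (E n)))] with z hz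
    simp [fracKernel, hz.1, hz.2]
  add_mem' := by
    intro u v hu hv
    have huv := fracKernel_integrable n α u v hu hv
    have h1 : Integrable (fracKernel n α (u + v : H n) u) volume :=
      (hu.add (fracKernel_comm n α u v ▸ huv)).congr (fracKernel_add_left n α u v u).symm
    have h2 : Integrable (fracKernel n α (u + v : H n) v) volume :=
      (huv.add hv).congr (fracKernel_add_left n α u v v).symm
    rw [fracKernel_comm] at h1 h2
    exact (h1.add h2).congr (fracKernel_add_left n α u v (u + v)).symm
  smul_mem' := by
    intro c u hu
    have h1 : Integrable (fracKernel n α (c • u : H n) u) volume :=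
      (hu.const_mul c).congr (fracKernel_smul_left n α c u u).symm
    rw [fracKernel_comm] at h1
    exact (h1.const_mul c).congr (fracKernel_smul_left n α c u (c • u)).symm

/-- `V = H^α(ℝⁿ)`, `0 < α < 1`. A separate type, as it does not carry the norm of `L²(ℝⁿ)`. -/
def V (n : ℕ) (α : Set.Ioo (0 : ℝ) 1) : Type := ↥(fracSubmodule n α)

noncomputable instance instAddCommGroupV (n : ℕ) (α : Set.Ioo (0 : ℝ) 1) : AddCommGroup (V n α) :=
  inferInstanceAs (AddCommGroup ↥(fracSubmodule n α))

noncomputable instance instModuleV (n : ℕ) (α : Set.Ioo (0 : ℝ) 1) : Module ℝ (V n α) :=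
  inferInstanceAs (Module ℝ ↥(fracSubmodule n α))

/-- The inclusion of `V` in `H`. -/
noncomputable def V.toH {n : ℕ} {α : Set.Ioo (0 : ℝ) 1} : V n α →ₗ[ℝ] H n :=
  (fracSubmodule n α).subtype

theorem V.toH_injective {n : ℕ} {α : Set.Ioo (0 : ℝ) 1} :
    Function.Injective (V.toH : V n α → H n) :=
  Subtype.val_injective

theorem V.integrable_kernel {n : ℕ} {α : Set.Ioo (0 : ℝ) 1} (u w : V n α) :
    Integrable (fracKernel n α u.toH w.toH) volume :=
  fracKernel_integrable n α u.toH w.toH u.2 w.2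

/-- The inner product of `V`:
`(u,w)_V = ∫ u w dx + (C(n,α)/2) ∬ (u(x)-u(y)) (w(x)-w(y)) / |x-y|^{n+2α} dx dy`. -/
@[reducible] noncomputable def innerCoreV (n : ℕ) (α : Set.Ioo (0 : ℝ) 1) :
    InnerProductSpace.Core ℝ (V n α) where
  inner u w := (∫ x, u.toH x * w.toH x) + fracForm n α u.toH w.toH
  conj_inner_symm u w := by
    simp only [conj_trivial, fracForm, fracKernel_comm n α w.toH u.toH, mul_comm]
  re_inner_nonneg u := by
    have h1 : 0 ≤ ∫ x, u.toH x * u.toH x := integral_nonneg fun x => mul_self_nonneg _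
    have h2 : 0 ≤ ∫ z, fracKernel n α u.toH u.toH z :=
      integral_nonneg fun z => fracKernel_self_nonneg n α _ z
    have h3 := fracConst_nonneg n α
    simp only [fracForm, RCLike.re_to_real]
    positivity
  add_left u v w := by
    have e1 : ∫ x, (u + v).toH x * w.toH x
        = (∫ x, u.toH x * w.toH x) + ∫ x, v.toH x * w.toH x := by
      have := inner_add_left (𝕜 := ℝ) u.toH v.toH w.toH
      simp only [L2.inner_def, RCLike.inner_apply, conj_trivial] at this
      simp only [map_add, mul_comm _ (w.toH _)]
      exact this
    have e2 : fracForm n α (u + v).toH w.toH = fracForm n α u.toH w.toH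
        + fracForm n α v.toH w.toH := by
      simp only [fracForm, map_add]
      rw [integral_congr_ae (fracKernel_add_left n α u.toH v.toH w.toH),
        integral_add (V.integrable_kernel u w) (V.integrable_kernel v w), mul_add]
    rw [e1, e2]
    ring
  smul_left u w c := by
    have e1 : ∫ x, (c • u).toH x * w.toH x = c * ∫ x, u.toH x * w.toH x := by
      have := real_inner_smul_left u.toH w.toH c
      simp only [L2.inner_def, RCLike.inner_apply, conj_trivial] at this
      simp only [map_smul, mul_comm _ (w.toH _)]
      exact this
    have e2 : fracForm n α (c • u).toH w.toH = c * fracForm n α u.toH w.toH := by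
      simp only [fracForm, map_smul]
      rw [integral_congr_ae (fracKernel_smul_left n α c u.toH w.toH), integral_const_mul]
      ring
    simp only [conj_trivial]
    rw [e1, e2]
    ring
  definite u hu := by
    have h1 : 0 ≤ ∫ x, u.toH x * u.toH x := integral_nonneg fun x => mul_self_nonneg _
    have h2 : 0 ≤ fracForm n α u.toH u.toH := by
      have h2 : 0 ≤ ∫ z, fracKernel n α u.toH u.toH z :=
        integral_nonneg fun z => fracKernel_self_nonneg n α _ z
      have h3 := fracConst_nonneg n α
      unfold fracForm
      positivity
    have h3 : ∫ x, u.toH x * u.toH x = 0 := by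
      change (∫ x, u.toH x * u.toH x) + fracForm n α u.toH u.toH = 0 at hu
      linarith
    have h4 : inner ℝ u.toH u.toH = 0 := by
      simpa only [L2.inner_def, RCLike.inner_apply, conj_trivial] using h3
    exact V.toH_injective (by rw [inner_self_eq_zero.1 h4, map_zero])

noncomputable instance instNormedAddCommGroupV (n : ℕ) (α : Set.Ioo (0 : ℝ) 1) :
    NormedAddCommGroup (V n α) :=
  (innerCoreV n α).toNormedAddCommGroup

noncomputable instance instInnerProductSpaceV (n : ℕ) (α : Set.Ioo (0 : ℝ) 1) :
    InnerProductSpace ℝ (V n α) :=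
  InnerProductSpace.ofCore (innerCoreV n α).toCore

/-- `‖u‖_V² = ‖u‖² + (C(n,α)/2) ∬ |u(x)-u(y)|² / |x-y|^{n+2α} dx dy`. -/
theorem V.norm_sq_eq {n : ℕ} {α : Set.Ioo (0 : ℝ) 1} (u : V n α) :
    ‖u‖ ^ 2 = ‖u.toH‖ ^ 2 + fracForm n α u.toH u.toH := by
  rw [← real_inner_self_eq_norm_sq u, ← real_inner_self_eq_norm_sq u.toH]
  change (∫ x, u.toH x * u.toH x) + fracForm n α u.toH u.toH = _
  simp only [L2.inner_def, RCLike.inner_apply, conj_trivial]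

/-! ### Function spaces in time -/

/-- Lebesgue measure on the time interval `[0,T]`. -/
noncomputable abbrev timeMeasure (T : ℝ) : Measure (Set.Icc (0 : ℝ) T) :=
  Measure.comap Subtype.val volume

/-- The space of controls, `L²(0,T;l²)`. -/
abbrev Controls (T : ℝ) : Type := Lp Ell2 2 (timeMeasure T)

/-- The space `C([0,T],H) ∩ L²(0,T;V)`: the pairs of a continuous `H`-valued function and an
element of `L²(0,T;V)` that agree at almost every time. As a subspace of the product, its norm is
the larger of the two norms. -/
noncomputable def pathSpace (n : ℕ) (α : Set.Ioo (0 : ℝ) 1) (T : ℝ) :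
    Submodule ℝ (C(Set.Icc (0 : ℝ) T, H n) × Lp (V n α) 2 (timeMeasure T))
    where
  carrier := {u | ∀ᵐ t ∂timeMeasure T, u.1 t = V.toH (u.2 t)}
  zero_mem' := by
    filter_upwards [Lp.coeFn_zero (V n α) 2 (timeMeasure T)] with t ht
    change (0 : H n) = V.toH ((0 : Lp (V n α) 2 (timeMeasure T)) t)
    rw [ht]
    simp
  add_mem' := by
    intro u w hu hw
    filter_upwards [hu, hw, Lp.coeFn_add u.2 w.2] with t h1 h2 h3
    change u.1 t + w.1 t = V.toH ((u.2 + w.2 : Lp (V n α) 2 (timeMeasure T)) t)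
    rw [h3, h1, h2, Pi.add_apply, map_add]
  smul_mem' := by
    intro c u hu
    filter_upwards [hu, Lp.coeFn_smul c u.2] with t h1 h2
    change c • u.1 t = V.toH ((c • u.2 : Lp (V n α) 2 (timeMeasure T)) t)
    rw [h2, h1, Pi.smul_apply, map_smul]

/-! ### The coefficients -/

/-- `ψ ∈ L^r_loc(ℝ, L^r(ℝⁿ))`, for `r = 1` and `r = ∞`. -/
def MemLocLp (n : ℕ) (r : ℝ≥0∞) (ψ : ℝ → E n → ℝ) : Prop :=
  ∀ a b : ℝ, MemLp (fun z : ℝ × E n => ψ z.1 z.2) r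
    ((volume.restrict (Set.Icc a b)).prod volume)

/-- The assumptions on the drift `F`. -/
structure DriftAssumptions (n : ℕ) (p : ℝ) (F : ℝ → E n → ℝ → ℝ) (lam₁ lam₂ : ℝ)
    (ψ₁ ψ₂ ψ₃ : ℝ → E n → ℝ) : Prop where
  lam₁_pos : 0 < lam₁
  lam₂_pos : 0 < lam₂
  memLp_ψ₁ : MemLocLp n 1 ψ₁
  memLp_ψ₂ : MemLocLp n ∞ ψ₂ ∧ MemLocLp n 1 ψ₂
  memLp_ψ₃ : MemLocLp n ∞ ψ₃ ∧ MemLocLp n 1 ψ₃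
  continuous : Continuous fun z : ℝ × E n × ℝ => F z.1 z.2.1 z.2.2
  at_zero : ∀ t x, F t x 0 = 0
  coercive : ∀ t x u, lam₁ * |u| ^ p - ψ₁ t x ≤ F t x u * u
  locLipschitz : ∀ t x u₁ u₂, |F t x u₁ - F t x u₂| ≤
    lam₂ * (ψ₂ t x + |u₁| ^ (p - 2) + |u₂| ^ (p - 2)) * |u₁ - u₂|
  differentiable : ∀ t x, Differentiable ℝ (F t x)
  deriv_ge : ∀ t x u, -ψ₃ t x ≤ deriv (F t x) u

/-- The assumptions on the diffusion coefficient
`σ_k(t,x,s) = σ_{1,k}(t,x) + κ(x) σ_{2,k}(t,x,s)`. -/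
structure DiffusionAssumptions (n : ℕ) (σ₁ : ℝ → Lp Ell2 2 (volume : Measure (E n)))
    (κ : E n → ℝ) (σ₂ : ℕ → ℝ → E n → ℝ → ℝ) (a b c : ℕ → ℝ) : Prop where
  continuous_σ₁ : Continuous σ₁
  memLp_κ : MemLp κ 2 volume ∧ MemLp κ ∞ volume
  measurable_σ₂ : ∀ k s, AEMeasurable (fun z : ℝ × E n => σ₂ k z.1 z.2 s) volume
  pos : ∀ k, 0 < a k ∧ 0 < b k ∧ 0 < c k
  lipschitz : ∀ k t x s₁ s₂, |σ₂ k t x s₁ - σ₂ k t x s₂| ≤ a k * |s₁ - s₂|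
  growth : ∀ k t x s, |σ₂ k t x s| ≤ b k + c k * |s|
  summable : Summable fun k => a k ^ 2 + b k ^ 2 + c k ^ 2

/-- `g ∈ L²_loc(ℝ, L²(ℝⁿ))`. -/
def MemLocL2 (n : ℕ) (g : ℝ → H n) : Prop :=
  ∀ a b : ℝ, MemLp g 2 (volume.restrict (Set.Icc a b))

/-- The function `σ(t,u)(v)` on `ℝⁿ`, for `u : ℝⁿ → ℝ` and `v ∈ l²`:
`x ↦ ∑_k (σ_{1,k}(t,x) + κ(x) σ_{2,k}(t,x,u(x))) v_k`. -/
noncomputable def sigmaApply {n : ℕ} (σ₁ : ℝ → Lp Ell2 2 (volume : Measure (E n)))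
    (κ : E n → ℝ) (σ₂ : ℕ → ℝ → E n → ℝ → ℝ) (t : ℝ) (u : E n → ℝ) (v : Ell2) (x : E n) : ℝ :=
  ∑' k, ((σ₁ t x : Ell2) k + κ x * σ₂ k t x (u x)) * v k

/-! ### The controlled equation -/

/-- `u ∈ C([0,T],H) ∩ L²(0,T;V) ∩ L^p(0,T;L^p(ℝⁿ))` is a solution of the controlled equation
`du/dt + (-Δ)^α u + F(t,·,u) = g(t) + σ(t,u) v(t)`, `u(0) = u₀`, tested with
`ξ ∈ V ∩ L^p(ℝⁿ)`. In the time integrals `Set.Iic t` is the interval `[0,t]`. -/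
structure IsSolution {n : ℕ} {α : Set.Ioo (0 : ℝ) 1} {T : ℝ} (p : ℝ) (F : ℝ → E n → ℝ → ℝ)
    (g : ℝ → H n) (σ₁ : ℝ → Lp Ell2 2 (volume : Measure (E n))) (κ : E n → ℝ)
    (σ₂ : ℕ → ℝ → E n → ℝ → ℝ) (u₀ : H n) (v : Controls T) (u : pathSpace n α T) : Prop where
  memLp : ∫⁻ t, (∫⁻ x, ‖u.1.1 t x‖ₑ ^ p) ∂timeMeasure T < ∞
  weak_eq : ∀ (t : Set.Icc (0 : ℝ) T) (ξ : V n α), MemLp ξ.toH (ENNReal.ofReal p) volume →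
    inner ℝ (u.1.1 t) ξ.toH
      + (∫ s in Set.Iic t, fracForm n α (V.toH (u.1.2 s)) ξ.toH ∂timeMeasure T)
      + (∫ s in Set.Iic t, (∫ x, F s x (u.1.1 s x) * ξ.toH x) ∂timeMeasure T)
    = inner ℝ u₀ ξ.toH
      + (∫ s in Set.Iic t, inner ℝ (g s) ξ.toH ∂timeMeasure T)
      + ∫ s in Set.Iic t, (∫ x, sigmaApply σ₁ κ σ₂ s (u.1.1 s) (v s) x * ξ.toH x) ∂timeMeasure T

/-- `S_N`, the controls `v` with `∫₀ᵀ ‖v(t)‖² dt ≤ N`. -/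
def controlBall (T N : ℝ) : Set (Controls T) :=
  {v | ∫ t, ‖v t‖ ^ 2 ∂timeMeasure T ≤ N}

/-- `K_N`, the set of the solutions `u_v` of the controlled equation with `v ∈ S_N`. -/
def levelSet {n : ℕ} {α : Set.Ioo (0 : ℝ) 1} {T : ℝ} (p : ℝ) (F : ℝ → E n → ℝ → ℝ)
    (g : ℝ → H n) (σ₁ : ℝ → Lp Ell2 2 (volume : Measure (E n))) (κ : E n → ℝ)
    (σ₂ : ℕ → ℝ → E n → ℝ → ℝ) (u₀ : H n) (N : ℝ) : Set (pathSpace n α T) :=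
  {u | ∃ v ∈ controlBall T N, IsSolution p F g σ₁ κ σ₂ u₀ v u}

end FracControl

open FracControl

/-!
The proof never uses a compact embedding: strong compactness comes from the energy inequality for
the difference of two solutions.

*Energy.* The forcing `G = g - F(u) + σ(u)v` of a solution lies in `L² + L^{p'}` on
`[0,T] × ℝⁿ`, so a solution of the controlled equation is a weak solution of the linear equation
`u' + (-Δ)^α u = G` (`isSolution_iff_weakSol`). Testing the increment `u(t) - u(t-h)` with `u(t)`
and averaging over `t` gives the energy inequality `WeakSol.energy`. Only the inequality is needed,
and only at the values `u(t)`, which lie in `V ∩ L^p` for almost every `t`; no density of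
`V ∩ L^p` and no duality theory for `V` enter. With Grönwall's inequality for an `L²` kernel this
yields bounds that are uniform over a ball of controls (`ControlSystem.exists_bound`) and
uniqueness for a given control (`isSolution_unique`).

*Compactness.* Let `u_k` be solutions whose controls `v_k` are bounded. By the bounds, `(u_k, ξ)` is
equicontinuous in time for `ξ ∈ V ∩ L^p`, so that along a subsequence `u_k(t)` is weakly Cauchy in
`H` for almost every `t` (`exists_subseq_weakly_cauchy`). In the energy inequality for `u_k - u_m`
the term that is not absorbed by Grönwall's inequality is the pairing of `v_k - v_m` with
`∫ (u_k - u_m)(x) B(x, u_N(x)) dx`, where `B` is the `l²`-valued noise coefficient and `N` is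
fixed. Since `B(·, u_N)` is square integrable, this integral is a Hilbert–Schmidt operator applied
to `u_k - u_m`, and tends to zero strongly. Replacing `B(·, u_k)` by `B(·, u_N)` costs
`‖u_k - u_N‖²`, which a weight `exp(2Kt)` turns into a factor `1/2`; iteration shows that
`u_k` is Cauchy in `C([0,T],H) ∩ L²(0,T;V)` (`ControlSystem.cauchy_of_weakly_cauchy`).

*Limit.* If moreover `v_k → v` weakly, the limit is a solution for `v`
(`ControlSystem.weakSol_of_tendsto`): the drift converges by almost everywhere convergence and
Young's inequality, the noise as a product of a strongly and a weakly convergent factor. Together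
this is `exists_subseq_tendsto_solution`. With uniqueness, every subsequence of `u_{v_k}` has a
further subsequence that converges to `u_v`, which is the continuity statement; with the weak
sequential compactness of balls of `L²(0,T;l²)` it is the compactness of the level sets.
-/

namespace FracControl

/-! ### Translations and the energy inequality for increments -/

section Translation

variable {Y : Type*} [NormedAddCommGroup Y] [NormedSpace ℝ Y] [FiniteDimensional ℝ Y]
  [MeasurableSpace Y] [BorelSpace Y] (μ : Measure Y) [μ.IsAddHaarMeasure]
  {B₁ B₂ : Type*} [NormedAddCommGroup B₁] [NormedSpace ℝ B₁] [NormedAddCommGroup B₂]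
  [NormedSpace ℝ B₂]

/-- Pairings of a shifted `L^p` function with an `L^q` function are continuous in the shift. -/
theorem continuous_integral_translate {p q : ℝ≥0∞} [Fact (1 ≤ p)] [Fact (1 ≤ q)]
    [ENNReal.HolderConjugate p q] (hp : p ≠ ∞) (L : B₁ →L[ℝ] B₂ →L[ℝ] ℝ) (e : Y)
    {f : Y → B₁} {g : Y → B₂} (hf : MemLp f p μ) (hg : MemLp g q μ) :
    Continuous fun ρ : ℝ => ∫ y, L (f (y - ρ • e)) (g y) ∂μ := by
  let tr : ℝ → C(Y, Y) := fun ρ => ⟨fun y => y - ρ • e, by fun_prop⟩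
  have htr : Continuous tr := by
    refine ContinuousMap.continuous_of_continuous_uncurry _ ?_
    change Continuous fun z : ℝ × Y => z.2 - z.1 • e
    fun_prop
  have hmp : ∀ ρ, MeasurePreserving (tr ρ) μ μ := fun ρ => measurePreserving_sub_right μ (ρ • e)
  have h1 := Continuous.compMeasurePreservingLp (f := fun _ : ℝ => hf.toLp f)
    continuous_const htr hmp hp
  have h2 : Continuous fun ρ => L.lpPairing μ p q
      (Lp.compMeasurePreserving (tr ρ) (hmp ρ) (hf.toLp f)) (hg.toLp g) :=
    ((L.lpPairing μ p q).continuous.comp h1).clm_apply continuous_const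
  refine h2.congr fun ρ => ?_
  rw [ContinuousLinearMap.lpPairing_eq_integral]
  refine integral_congr_ae ?_
  filter_upwards [Lp.coeFn_compMeasurePreserving (hf.toLp f) (hmp ρ), hg.coeFn_toLp,
    (hmp ρ).quasiMeasurePreserving.ae hf.coeFn_toLp] with y h1 h2 h3
  rw [h1, h2, Function.comp_apply, h3]
  rfl

theorem measurePreserving_shear (e : Y) (S : Set ℝ) :
    MeasurePreserving (fun z : ℝ × Y => (z.1, z.2 - z.1 • e))
      ((volume.restrict S).prod μ) ((volume.restrict S).prod μ) := by
  refine (MeasurePreserving.id _).skew_product (g := fun (r : ℝ) (y : Y) => y - r • e) ?_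
    (ae_of_all _ fun r => (measurePreserving_sub_right μ (r • e)).map_eq)
  have : Continuous (Function.uncurry fun (r : ℝ) (y : Y) => y - r • e) := by
    change Continuous fun z : ℝ × Y => z.2 - z.1 • e
    fun_prop
  exact this.measurable

/-- The integrand of the shifted pairing, jointly in the shift and the point. -/
theorem integrable_translate_prod {p q : ℝ≥0∞} [ENNReal.HolderConjugate p q]
    (L : B₁ →L[ℝ] B₂ →L[ℝ] ℝ) (e : Y) {f : Y → B₁} {g : Y → B₂} (hf : MemLp f p μ)
    (hg : MemLp g q μ) (h : ℝ) :
    Integrable (fun z : ℝ × Y => L (f (z.2 - z.1 • e)) (g z.2))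
      ((volume.restrict (Set.Ioc 0 h)).prod μ) := by
  have hF : MemLp (fun z : ℝ × Y => f z.2) p ((volume.restrict (Set.Ioc 0 h)).prod μ) :=
    hf.comp_snd _
  have hF2 := hF.comp_measurePreserving (measurePreserving_shear μ e (Set.Ioc 0 h))
  have hG : MemLp (fun z : ℝ × Y => g z.2) q ((volume.restrict (Set.Ioc 0 h)).prod μ) :=
    hg.comp_snd _
  exact memLp_one_iff_integrable.1 (L.memLp_of_bilin 1 hF2 hG)

end Translation

/-- The energy inequality from increments. By `½ (‖a‖² - ‖b‖²) ≤ (a - b, a)` the increments of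
`‖z‖²` over a step `h` are at most twice the double integral of `Ψ`; integration over `[0,τ]`
telescopes the left side, and division by `h → 0` gives the claim. Because of the convention
`z(t) = z(0)` for `t ≤ 0` the formula for the increments is needed across time `0` too. -/
theorem norm_sq_sub_le_of_increments {𝓗 : Type*} [NormedAddCommGroup 𝓗] [InnerProductSpace ℝ 𝓗]
    {z : ℝ → 𝓗} (hz : Continuous z) (hz0 : ∀ t ≤ 0, z t = z 0) {τ : ℝ} (hτ : 0 ≤ τ)
    {Ψ : ℝ → ℝ → ℝ}
    (hΨ : Integrable (Function.uncurry Ψ) ((volume.restrict (Set.Ioc 0 1)).prod volume))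
    (hJ : Continuous fun ρ => ∫ t in Set.Icc 0 τ, Ψ ρ t)
    (hinc : ∀ h ∈ Set.Ioc (0 : ℝ) 1, ∀ᵐ t ∂volume.restrict (Set.Icc 0 τ),
      inner ℝ (z t - z (t - h)) (z t) = ∫ ρ in Set.Ioc 0 h, Ψ ρ t) :
    ‖z τ‖ ^ 2 ≤ ‖z 0‖ ^ 2 + 2 * ∫ t in Set.Icc 0 τ, Ψ 0 t := by
  have hn : Continuous fun t => ‖z t‖ ^ 2 := by fun_prop
  have hnI : ∀ a b : ℝ, IntervalIntegrable (fun t => ‖z t‖ ^ 2) volume a b :=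
    fun a b => hn.intervalIntegrable a b
  have key : ∀ h ∈ Set.Ioc (0 : ℝ) 1,
      (∫ t in (τ - h)..τ, ‖z t‖ ^ 2) - h * ‖z 0‖ ^ 2
        ≤ 2 * ∫ ρ in (0 : ℝ)..h, ∫ t in Set.Icc 0 τ, Ψ ρ t := by
    intro h hh
    have hΨh : Integrable (Function.uncurry Ψ)
        ((volume.restrict (Set.Ioc 0 h)).prod (volume.restrict (Set.Icc 0 τ))) := by
      refine hΨ.mono_measure (Measure.prod_mono ?_ Measure.restrict_le_self)
      exact Measure.restrict_mono (Set.Ioc_subset_Ioc_right hh.2) le_rfl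
    have hle : ∫ t in Set.Icc 0 τ, (‖z t‖ ^ 2 - ‖z (t - h)‖ ^ 2)
        ≤ ∫ t in Set.Icc 0 τ, 2 * ∫ ρ in Set.Ioc 0 h, Ψ ρ t := by
      refine integral_mono_ae ?_ (hΨh.integral_prod_right.const_mul 2) ?_
      · exact (by fun_prop : Continuous fun t => ‖z t‖ ^ 2 - ‖z (t - h)‖ ^ 2).integrableOn_Icc
      · filter_upwards [hinc h hh] with t ht
        simp only [← ht]
        have := norm_sub_sq_real (z t) (z (t - h))
        rw [inner_sub_left, real_inner_self_eq_norm_sq, real_inner_comm]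
        nlinarith [sq_nonneg ‖z t - z (t - h)‖]
    rw [integral_const_mul, ← integral_integral_swap hΨh] at hle
    rw [intervalIntegral.integral_of_le hh.1.le]
    refine le_trans (le_of_eq ?_) hle
    rw [integral_Icc_eq_integral_Ioc, ← intervalIntegral.integral_of_le hτ,
      intervalIntegral.integral_sub (hnI _ _)
        ((by fun_prop : Continuous fun t => ‖z (t - h)‖ ^ 2).intervalIntegrable _ _),
      intervalIntegral.integral_comp_sub_right (fun t => ‖z t‖ ^ 2) h]
    have e1 : ∫ t in (0 - h)..0, ‖z t‖ ^ 2 = h * ‖z 0‖ ^ 2 := by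
      have : ∫ t in (0 - h)..0, ‖z t‖ ^ 2 = ∫ t in (0 - h)..0, ‖z 0‖ ^ 2 := by
        refine intervalIntegral.integral_congr fun t ht => ?_
        rw [Set.uIcc_of_le (by linarith [hh.1])] at ht
        simp only [hz0 t ht.2]
      rw [this]
      simp
    have e2 := intervalIntegral.integral_add_adjacent_intervals (hnI 0 (τ - h)) (hnI (τ - h) τ)
    have e3 := intervalIntegral.integral_add_adjacent_intervals (hnI (0 - h) 0) (hnI 0 (τ - h))
    linarith
  -- divide by `h` and let `h → 0`
  have l1 : Tendsto (fun h : ℝ => h⁻¹ * ∫ t in (τ - h)..τ, ‖z t‖ ^ 2) (𝓝[>] 0)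
      (𝓝 (‖z τ‖ ^ 2)) := by
    have hd : HasDerivAt (fun h : ℝ => ∫ t in (τ - h)..τ, ‖z t‖ ^ 2) (‖z τ‖ ^ 2) 0 := by
      have h0 : HasDerivAt (fun x : ℝ => ∫ t in x..τ, ‖z t‖ ^ 2) (-‖z (τ - 0)‖ ^ 2) (τ - 0) :=
        intervalIntegral.integral_hasDerivAt_left (hnI _ _)
          (hn.stronglyMeasurableAtFilter _ _) hn.continuousAt
      exact (h0.scomp (0 : ℝ) ((hasDerivAt_id (0 : ℝ)).const_sub τ)).congr_deriv (by simp)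
    have := hd.tendsto_slope_zero_right
    simpa using this
  have l2 : Tendsto (fun h : ℝ => h⁻¹ * ∫ ρ in (0 : ℝ)..h, ∫ t in Set.Icc 0 τ, Ψ ρ t) (𝓝[>] 0)
      (𝓝 (∫ t in Set.Icc 0 τ, Ψ 0 t)) := by
    have hd := intervalIntegral.integral_hasDerivAt_right
      (hJ.intervalIntegrable 0 0) (hJ.stronglyMeasurableAtFilter volume (𝓝 0))
      hJ.continuousAt
    have := hd.tendsto_slope_zero_right
    simpa using this
  have l3 := (l1.sub_const (‖z 0‖ ^ 2))
  have := le_of_tendsto_of_tendsto l3 (l2.const_mul 2) ?_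
  · linarith
  · filter_upwards [Ioc_mem_nhdsGT (zero_lt_one' ℝ)] with h hh
    have h1 := mul_le_mul_of_nonneg_left (key h hh) (inv_nonneg.2 hh.1.le)
    rw [mul_sub, ← mul_assoc, inv_mul_cancel₀ hh.1.ne', one_mul] at h1
    linarith

/-! ### Jointly measurable representatives, time, `l²` and the space `V` -/

/-- A strongly measurable function of `x` with values in `L²(ν)` has a version that is measurable in
`(x,y)` and correct for every `x`: it is approximated uniformly by functions with countably many
values, at a rate that makes the approximations converge almost everywhere in `y`. -/
theorem exists_joint_representative {X Y F : Type*} [MeasurableSpace X] [MeasurableSpace Y]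
    [NormedAddCommGroup F] [CompleteSpace F] [SecondCountableTopology F] {ν : Measure Y}
    {f : X → Lp F 2 ν} (hf : StronglyMeasurable f) :
    ∃ U : X × Y → F, StronglyMeasurable U ∧ ∀ x, (fun y => U (x, y)) =ᵐ[ν] f x := by
  classical
  borelize F
  rcases isEmpty_or_nonempty X with hX | hX
  · exact ⟨0, stronglyMeasurable_zero, fun x => (hX.false x).elim⟩
  obtain ⟨c, hc, hcl⟩ := hf.isSeparable_range
  have hcne : c.Nonempty := by
    by_contra h
    rw [Set.not_nonempty_iff_eq_empty] at h
    rw [h, closure_empty] at hcl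
    exact hcl (Set.mem_range_self hX.some)
  obtain ⟨d, rfl⟩ := hc.exists_eq_range hcne
  have hex : ∀ (m : ℕ) (x : X), ∃ i, dist (f x) (d i) < (1 / 2 : ℝ) ^ m := by
    intro m x
    obtain ⟨_, ⟨i, rfl⟩, hi⟩ := Metric.mem_closure_iff.1 (hcl (Set.mem_range_self x))
      ((1 / 2 : ℝ) ^ m) (by positivity)
    exact ⟨i, hi⟩
  -- the first member of the dense sequence that is close to `f x` depends measurably on `x`
  let idx : ℕ → X → ℕ := fun m x => Nat.find (hex m x)
  have hidx : ∀ m x, dist (f x) (d (idx m x)) < (1 / 2 : ℝ) ^ m := fun m x =>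
    Nat.find_spec (hex m x)
  have hidxm : ∀ m, Measurable (idx m) := fun m => by
    refine measurable_find (hex m) fun k => ?_
    exact measurableSet_lt (hf.dist stronglyMeasurable_const).measurable measurable_const
  let g : ℕ → X × Y → F := fun m z => d (idx m z.1) z.2
  have hg : ∀ m, Measurable (g m) := fun m => by
    have h1 : Measurable fun z : ℕ × Y => d z.1 z.2 :=
      measurable_from_prod_countable_right fun i => (Lp.stronglyMeasurable (d i)).measurable
    exact h1.comp (((hidxm m).comp measurable_fst).prodMk measurable_snd)
  let S : Set (X × Y) := {z | ∃ l, Tendsto (fun m => g m z) atTop (𝓝 l)}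
  have hS : MeasurableSet S := measurableSet_exists_tendsto hg
  let U : X × Y → F := fun z => if h : z ∈ S then h.choose else 0
  have hU : Measurable U := by
    refine measurable_of_tendsto_metrizable (f := fun m => S.indicator (g m))
      (fun m => (hg m).indicator hS) ?_
    refine tendsto_pi_nhds.2 fun z => ?_
    by_cases h : z ∈ S
    · simpa only [Set.indicator_of_mem h, U, dif_pos h] using h.choose_spec
    · simp only [Set.indicator_of_notMem h, U, dif_neg h, tendsto_const_nhds]
  refine ⟨U, hU.stronglyMeasurable, fun x => ?_⟩
  have hle : ∀ m, eLpNorm (⇑(d (idx m x)) - ⇑(f x)) 2 ν ≤ ENNReal.ofReal ((1 / 2 : ℝ) ^ m) := by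
    intro m
    rw [← eLpNorm_congr_ae (Lp.coeFn_sub (d (idx m x)) (f x)), ← Lp.enorm_def, ← ofReal_norm,
      ← dist_eq_norm, dist_comm]
    exact ENNReal.ofReal_le_ofReal (hidx m x).le
  have hlim0 : Tendsto (fun m => eLpNorm (⇑(d (idx m x)) - ⇑(f x)) 2 ν) atTop (𝓝 0) := by
    refine tendsto_of_tendsto_of_tendsto_of_le_of_le tendsto_const_nhds ?_ (fun _ => zero_le) hle
    rw [← ENNReal.ofReal_zero]
    exact (ENNReal.tendsto_ofReal
      (tendsto_pow_atTop_nhds_zero_of_lt_one (by norm_num) (by norm_num)))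
  have hmeas : ∀ m, AEStronglyMeasurable (⇑(d (idx m x))) ν := fun m => Lp.aestronglyMeasurable _
  obtain ⟨ns, hns, hsub⟩ := (tendstoInMeasure_of_tendsto_eLpNorm (by norm_num) hmeas
    (Lp.aestronglyMeasurable _) hlim0).exists_seq_tendsto_ae
  have hconv : ∀ᵐ y ∂ν, ∃ l, Tendsto (fun m => (d (idx m x)) y) atTop (𝓝 l) := by
    refine Lp.ae_tendsto_of_cauchy_eLpNorm hmeas (p := 2) (by norm_num)
      (B := fun N => ENNReal.ofReal (3 * (1 / 2 : ℝ) ^ N)) ?_ ?_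
    · rw [← ENNReal.ofReal_tsum_of_nonneg (fun _ => by positivity)
        ((summable_geometric_of_lt_one (by norm_num) (by norm_num)).mul_left 3)]
      exact ENNReal.ofReal_ne_top
    · intro N k m hk hm
      rw [← eLpNorm_congr_ae (Lp.coeFn_sub (d (idx k x)) (d (idx m x))), ← Lp.enorm_def,
        ← ofReal_norm, ← dist_eq_norm]
      refine (ENNReal.ofReal_lt_ofReal_iff (by positivity)).2 ?_
      have h1 := dist_triangle_left (d (idx k x)) (d (idx m x)) (f x)
      have h2 := hidx k x
      have h3 := hidx m x
      have h4 : ((1 / 2 : ℝ)) ^ k ≤ (1 / 2 : ℝ) ^ N :=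
        pow_le_pow_of_le_one (by norm_num) (by norm_num) hk
      have h5 : ((1 / 2 : ℝ)) ^ m ≤ (1 / 2 : ℝ) ^ N :=
        pow_le_pow_of_le_one (by norm_num) (by norm_num) hm
      have h6 : (0 : ℝ) < (1 / 2 : ℝ) ^ N := by positivity
      linarith
  filter_upwards [hsub, hconv] with y h1 h2
  have h3 : (x, y) ∈ S := h2
  simp only [U, dif_pos h3]
  exact tendsto_nhds_unique (h3.choose_spec.comp hns.tendsto_atTop) h1

section Time

variable {T : ℝ}

theorem measurePreserving_val_time (T : ℝ) :
    MeasurePreserving (Subtype.val : Set.Icc (0 : ℝ) T → ℝ) (timeMeasure T)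
      (volume.restrict (Set.Icc 0 T)) :=
  ⟨measurable_subtype_coe, by
    rw [(MeasurableEmbedding.subtype_coe measurableSet_Icc).map_comap, Subtype.range_coe]⟩

/-- Integrals over `[0,t]` as a subset of the subtype `[0,T]`, written on the real line. -/
theorem setIntegral_time (hT : 0 ≤ T) {F : Type*} [NormedAddCommGroup F] [NormedSpace ℝ F]
    (t : Set.Icc (0 : ℝ) T) (f : Set.Icc (0 : ℝ) T → F) :
    ∫ s in Set.Iic t, f s ∂timeMeasure T
      = ∫ s in Set.Icc 0 (t : ℝ), f (Set.projIcc 0 T hT s) := by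
  have h := (measurePreserving_val_time T).setIntegral_preimage_emb
    (MeasurableEmbedding.subtype_coe measurableSet_Icc)
    (fun s => f (Set.projIcc 0 T hT s)) (Set.Iic (t : ℝ))
  simp only [Set.projIcc_val] at h
  rw [Measure.restrict_restrict measurableSet_Iic] at h
  have h2 : Set.Iic (t : ℝ) ∩ Set.Icc 0 T = Set.Icc 0 (t : ℝ) := by
    ext s
    simp only [Set.mem_inter_iff, Set.mem_Iic, Set.mem_Icc]
    exact ⟨fun h => ⟨h.2.1, h.1⟩, fun h => ⟨h.2, h.1, h.2.trans t.2.2⟩⟩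
  rw [h2] at h
  exact h

theorem measurePreserving_projIcc (hT : 0 ≤ T) :
    MeasurePreserving (Set.projIcc 0 T hT) (volume.restrict (Set.Icc 0 T)) (timeMeasure T) := by
  refine ⟨continuous_projIcc.measurable, ?_⟩
  rw [← (measurePreserving_val_time T).map_eq, Measure.map_map continuous_projIcc.measurable
    measurable_subtype_coe]
  have : Set.projIcc 0 T hT ∘ Subtype.val = id := by
    funext s
    simp
  rw [this, Measure.map_id]

instance (T : ℝ) : IsFiniteMeasure (timeMeasure T) := by
  refine ⟨?_⟩
  have := (measurePreserving_val_time T).measure_preimage (s := Set.univ)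
    MeasurableSet.univ.nullMeasurableSet
  rw [Set.preimage_univ] at this
  rw [this]
  exact measure_lt_top _ _

end Time

section Ell2

/-- The `k`-th unit vector of `l²`. -/
noncomputable def ell2Unit (k : ℕ) : Ell2 := lp.single (E := fun _ : ℕ => ℝ) 2 k (1 : ℝ)

theorem hasSum_ell2 (f : Ell2) : HasSum (fun k => f k • ell2Unit k) f := by
  have h := lp.hasSum_single (E := fun _ : ℕ => ℝ) (p := 2) (by norm_num) f
  convert h using 2 with k
  rw [ell2Unit, ← lp.single_smul, smul_eq_mul, mul_one]

theorem inner_ell2Unit (f : Ell2) (k : ℕ) : inner ℝ (ell2Unit k) f = f k := by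
  rw [ell2Unit, lp.inner_single_left]
  simp

instance : SecondCountableTopology Ell2 := by
  have h1 : TopologicalSpace.IsSeparable
      (Submodule.span ℝ (Set.range ell2Unit) : Set Ell2) :=
    (Set.countable_range ell2Unit).isSeparable.span
  have h2 : closure (Submodule.span ℝ (Set.range ell2Unit) : Set Ell2) = Set.univ := by
    refine Set.eq_univ_of_forall fun f => ?_
    refine mem_closure_of_tendsto (hasSum_ell2 f) (Eventually.of_forall fun s => ?_)
    exact Submodule.sum_mem _ fun k _ =>
      Submodule.smul_mem _ _ (Submodule.subset_span (Set.mem_range_self k))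
  have h3 := h1.closure
  rw [h2, TopologicalSpace.isSeparable_univ_iff] at h3
  exact UniformSpace.secondCountable_of_separable Ell2

theorem aestronglyMeasurable_ell2 {X : Type*} [MeasurableSpace X] {μ : Measure X} {f : X → Ell2}
    (hf : ∀ k, AEMeasurable (fun x => f x k) μ) : AEStronglyMeasurable f μ := by
  refine aestronglyMeasurable_of_tendsto_ae atTop
    (f := fun N x => ∑ k ∈ Finset.range N, f x k • ell2Unit k) (fun N => ?_)
    (ae_of_all _ fun x => (hasSum_ell2 (f x)).tendsto_sum_nat)
  refine Finset.aestronglyMeasurable_fun_sum _ fun k _ => ?_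
  exact (hf k).aestronglyMeasurable.smul_const _

theorem continuous_ell2_apply (k : ℕ) : Continuous fun f : Ell2 => f k := by
  simp_rw [← inner_ell2Unit]
  fun_prop

theorem norm_sq_ell2 (f : Ell2) : HasSum (fun k => f k ^ 2) (‖f‖ ^ 2) := by
  have h := lp.hasSum_norm (p := 2) (by norm_num) f
  simpa using h

end Ell2

section FracSpace

variable {n : ℕ} {α : Set.Ioo (0 : ℝ) 1}

instance : Fact ((2 : ℝ≥0∞) ≠ ∞) := ⟨by norm_num⟩

theorem fracConst_pos (n : ℕ) (α : Set.Ioo (0 : ℝ) 1) : 0 < fracConst n α := by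
  have h0 : (0 : ℝ) < α := α.2.1
  have h3 := Real.Gamma_pos_of_pos (sub_pos.2 α.2.2)
  have h4 := Real.Gamma_pos_of_pos (show (0 : ℝ) < (n + 2 * (α : ℝ)) / 2 by positivity)
  have := Real.pi_pos
  unfold fracConst
  positivity

theorem fracForm_self_nonneg (u : E n → ℝ) : 0 ≤ fracForm n α u u := by
  have h2 : 0 ≤ ∫ z, fracKernel n α u u z := integral_nonneg fun z => fracKernel_self_nonneg n α _ z
  have h3 := fracConst_nonneg n α
  unfold fracForm
  positivity

theorem V.norm_toH_le (u : V n α) : ‖V.toH u‖ ≤ ‖u‖ := by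
  have h := V.norm_sq_eq u
  have h2 := fracForm_self_nonneg (α := α) (V.toH u)
  exact abs_le_of_sq_le_sq' (by linarith) (norm_nonneg _) |>.2

theorem V.inner_eq (u w : V n α) :
    inner ℝ u w = inner ℝ u.toH w.toH + fracForm n α u.toH w.toH := by
  change (∫ x, u.toH x * w.toH x) + fracForm n α u.toH w.toH = _
  simp only [L2.inner_def, RCLike.inner_apply, conj_trivial, mul_comm (w.toH _)]

/-- The inclusion of `V` in `H` as a continuous linear map. -/
noncomputable def toHL (n : ℕ) (α : Set.Ioo (0 : ℝ) 1) : V n α →L[ℝ] H n :=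
  V.toH.mkContinuous 1 fun u => by rw [one_mul]; exact V.norm_toH_le u

@[simp] theorem toHL_apply (u : V n α) : toHL n α u = V.toH u := rfl

/-- The form of the fractional Laplacian as a bounded bilinear form on `V`, the difference of the
inner products of `V` and of `H`. -/
noncomputable def fracBilin (n : ℕ) (α : Set.Ioo (0 : ℝ) 1) : V n α →L[ℝ] V n α →L[ℝ] ℝ :=
  innerSL ℝ - (innerSL ℝ).bilinearComp (toHL n α) (toHL n α)

theorem fracBilin_apply (u w : V n α) : fracBilin n α u w = fracForm n α u.toH w.toH := by
  have h : fracBilin n α u w = inner ℝ u w - inner ℝ (V.toH u) (V.toH w) := rfl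
  rw [h, V.inner_eq, add_sub_cancel_left]

/-- Closed balls of `V` are closed in `H`, by Fatou's lemma for the kernels. -/
theorem V.exists_of_tendsto {w : ℕ → V n α} {x : H n} {R : ℝ} (hR : ∀ k, ‖w k‖ ≤ R)
    (h : Tendsto (fun k => V.toH (w k)) atTop (𝓝 x)) : ∃ y : V n α, V.toH y = x ∧ ‖y‖ ≤ R := by
  have hR0 : 0 ≤ R := (norm_nonneg _).trans (hR 0)
  obtain ⟨ns, hns, hae⟩ := (tendstoInMeasure_of_tendsto_Lp h).exists_seq_tendsto_ae
  have hker : ∀ᵐ z : E n × E n, Tendsto (fun k => fracKernel n α (V.toH (w (ns k)))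
      (V.toH (w (ns k))) z) atTop (𝓝 (fracKernel n α x x z)) := by
    filter_upwards [ae_prod_of_ae n hae] with z hz
    exact (((hz.1.sub hz.2).mul (hz.1.sub hz.2))).div_const _
  have hC := fracConst_pos n α
  have hbound : ∀ k, ∫⁻ z, ENNReal.ofReal (fracKernel n α (V.toH (w (ns k))) (V.toH (w (ns k))) z)
      ≤ ENNReal.ofReal (2 / fracConst n α * (R ^ 2 - ‖V.toH (w (ns k))‖ ^ 2)) := by
    intro k
    rw [← ofReal_integral_eq_lintegral_ofReal (V.integrable_kernel _ _)
      (ae_of_all _ fun z => fracKernel_self_nonneg n α _ z)]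
    refine ENNReal.ofReal_le_ofReal ?_
    have h1 := V.norm_sq_eq (w (ns k))
    have h2 : ‖w (ns k)‖ ^ 2 ≤ R ^ 2 := pow_le_pow_left₀ (norm_nonneg _) (hR _) 2
    rw [fracForm] at h1
    rw [div_mul_eq_mul_div, le_div_iff₀ hC]
    linarith
  have hfatou : ∫⁻ z, ENNReal.ofReal (fracKernel n α x x z)
      ≤ ENNReal.ofReal (2 / fracConst n α * (R ^ 2 - ‖x‖ ^ 2)) := by
    calc ∫⁻ z, ENNReal.ofReal (fracKernel n α x x z)
        = ∫⁻ z, liminf (fun k => ENNReal.ofReal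
            (fracKernel n α (V.toH (w (ns k))) (V.toH (w (ns k))) z)) atTop := by
          refine lintegral_congr_ae ?_
          filter_upwards [hker] with z hz
          exact (ENNReal.tendsto_ofReal hz).liminf_eq.symm
      _ ≤ liminf (fun k => ∫⁻ z, ENNReal.ofReal
            (fracKernel n α (V.toH (w (ns k))) (V.toH (w (ns k))) z)) atTop :=
          lintegral_liminf_le' fun k => (fracKernel_aesm n α _ _).aemeasurable.ennreal_ofReal
      _ ≤ liminf (fun k => ENNReal.ofReal
            (2 / fracConst n α * (R ^ 2 - ‖V.toH (w (ns k))‖ ^ 2))) atTop :=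
          liminf_le_liminf (Eventually.of_forall hbound)
      _ = _ := by
          refine Tendsto.liminf_eq (ENNReal.tendsto_ofReal ?_)
          exact (tendsto_const_nhds.sub
            (((h.comp hns.tendsto_atTop).norm).pow 2)).const_mul _
  have hint : Integrable (fracKernel n α x x) volume := by
    refine ⟨fracKernel_aesm n α x x, ?_⟩
    rw [hasFiniteIntegral_iff_ofReal (ae_of_all _ fun z => fracKernel_self_nonneg n α _ z)]
    exact hfatou.trans_lt ENNReal.ofReal_lt_top
  let y : V n α := ⟨x, hint⟩
  have hy : V.toH y = x := rfl
  refine ⟨y, hy, ?_⟩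
  have hxR : ‖x‖ ≤ R := le_of_tendsto h.norm
    (Eventually.of_forall fun k => (V.norm_toH_le _).trans (hR k))
  have h3 : ∫ z, fracKernel n α x x z ≤ 2 / fracConst n α * (R ^ 2 - ‖x‖ ^ 2) := by
    rw [← ofReal_integral_eq_lintegral_ofReal hint
      (ae_of_all _ fun z => fracKernel_self_nonneg n α _ z)] at hfatou
    refine (ENNReal.ofReal_le_ofReal_iff ?_).1 hfatou
    have : ‖x‖ ^ 2 ≤ R ^ 2 := pow_le_pow_left₀ (norm_nonneg _) hxR 2
    exact mul_nonneg (by positivity) (by linarith)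
  refine abs_le_of_sq_le_sq' ?_ hR0 |>.2
  rw [V.norm_sq_eq, hy, fracForm]
  rw [div_mul_eq_mul_div, le_div_iff₀ hC] at h3
  linarith

/-- A Cauchy sequence of `V` converges in `H`; by closedness of balls the limit is in `V` and the
convergence is in `V`. -/
instance : CompleteSpace (V n α) := by
  refine Metric.complete_of_cauchySeq_tendsto fun u hu => ?_
  have hH : CauchySeq fun k => V.toH (u k) := by
    have := (toHL n α).uniformContinuous.comp_cauchySeq hu
    exact this
  obtain ⟨x, hx⟩ := cauchySeq_tendsto_of_complete hH
  have hlim : ∀ N, ∀ ε, (∀ m, N ≤ m → ‖u N - u m‖ ≤ ε) →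
      ∃ y : V n α, V.toH y = V.toH (u N) - x ∧ ‖y‖ ≤ ε := by
    intro N ε hN
    refine V.exists_of_tendsto (w := fun k => u N - u (k + N)) (fun k => hN _ (by omega)) ?_
    simp only [map_sub]
    exact tendsto_const_nhds.sub ((tendsto_add_atTop_iff_nat N).2 hx)
  obtain ⟨N₀, hN₀⟩ := Metric.cauchySeq_iff.1 hu 1 one_pos
  obtain ⟨y₀, hy₀, -⟩ := hlim N₀ 1 fun m hm => by
    rw [← dist_eq_norm]
    exact (hN₀ N₀ le_rfl m hm).le
  refine ⟨u N₀ - y₀, Metric.tendsto_atTop.2 fun ε hε => ?_⟩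
  obtain ⟨N, hN⟩ := Metric.cauchySeq_iff.1 hu (ε / 2) (by positivity)
  refine ⟨N, fun k hk => ?_⟩
  obtain ⟨y, hy, hyε⟩ := hlim k (ε / 2) fun m hm => by
    rw [← dist_eq_norm]
    exact (hN k hk m (hk.trans hm)).le
  have : u k - (u N₀ - y₀) = y := V.toH_injective (by rw [map_sub, map_sub, hy, hy₀]; abel)
  rw [dist_eq_norm, this]
  linarith

/-- The path space is closed: limits in `C([0,T],H)` and in `L²(0,T;V)` agree almost everywhere. -/
instance (T : ℝ) : CompleteSpace (pathSpace n α T) := by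
  refine IsClosed.completeSpace_coe (hs := isClosed_of_closure_subset fun u hu => ?_)
  obtain ⟨w, hw, hwu⟩ := mem_closure_iff_seq_limit.1 hu
  have h1 : Tendsto (fun k => (w k).1) atTop (𝓝 u.1) := (continuous_fst.tendsto _).comp hwu
  have h2 : Tendsto (fun k => (w k).2) atTop (𝓝 u.2) := (continuous_snd.tendsto _).comp hwu
  obtain ⟨ns, hns, hae⟩ := (tendstoInMeasure_of_tendsto_Lp h2).exists_seq_tendsto_ae
  have h3 : ∀ᵐ t ∂timeMeasure T, ∀ k, (w k).1 t = V.toH ((w k).2 t) := ae_all_iff.2 hw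
  change ∀ᵐ t ∂timeMeasure T, u.1 t = V.toH (u.2 t)
  filter_upwards [hae, h3] with t ht h3t
  have h4 : Tendsto (fun k => (w (ns k)).1 t) atTop (𝓝 (u.1 t)) :=
    ((ContinuousEvalConst.continuous_eval_const t).tendsto _).comp (h1.comp hns.tendsto_atTop)
  have h5 := ((toHL n α).continuous.tendsto _).comp ht
  refine tendsto_nhds_unique h4 (h5.congr fun k => ?_)
  simp [h3t]

end FracSpace

/-! ### Weak solutions of the linear equation -/

/-- Lebesgue measure on the slab `[0,T] × ℝⁿ`. -/
noncomputable abbrev slab (n : ℕ) (T : ℝ) : Measure (ℝ × E n) :=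
  (volume.restrict (Set.Icc 0 T)).prod volume

/-- Membership in `L²([0,T] × ℝⁿ) + L^{p'}([0,T] × ℝⁿ)`, with `p'` the conjugate exponent of `p`. -/
def MemSumLp (n : ℕ) (T p : ℝ) (G : ℝ × E n → ℝ) : Prop :=
  ∃ G₁ G₂ : ℝ × E n → ℝ, MemLp G₁ 2 (slab n T) ∧
    MemLp G₂ (ENNReal.ofReal p.conjExponent) (slab n T) ∧ ∀ y, G y = G₁ y + G₂ y

/-- `Z` solves the linear equation `Z' + (-Δ)^α Z = G`, `Z(0) = z₀`, on `[0,T]`, tested with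
`V ∩ L^p`. The function `Z` is given in three guises: as a continuous `H`-valued function, as the
`V`-valued function `ZV`, and as the function `U` of time and space. Off `[0,T]` only the constant
extension of `Z` to negative times is used. -/
structure WeakSol {n : ℕ} {α : Set.Ioo (0 : ℝ) 1} (T p : ℝ) (z₀ : H n) (Z : ℝ → H n)
    (ZV : ℝ → V n α) (U G : ℝ × E n → ℝ) : Prop where
  cont : Continuous Z
  const_left : ∀ t ≤ 0, Z t = Z 0
  memV : MemLp ZV 2 (volume.restrict (Set.Icc 0 T))
  ae_eq : ∀ᵐ s ∂volume.restrict (Set.Icc 0 T), Z s = V.toH (ZV s)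
  meas : StronglyMeasurable U
  slice : ∀ s, (fun x => U (s, x)) =ᵐ[volume] Z s
  memLp : MemLp U (ENNReal.ofReal p) (slab n T)
  force : MemSumLp n T p G
  weak : ∀ t ∈ Set.Icc 0 T, ∀ ξ : V n α, MemLp (V.toH ξ) (ENNReal.ofReal p) volume →
    inner ℝ (Z t) (V.toH ξ) + ∫ s in Set.Icc 0 t, fracForm n α (V.toH (ZV s)) (V.toH ξ)
      = inner ℝ z₀ (V.toH ξ) + ∫ s in Set.Icc 0 t, ∫ x, G (s, x) * V.toH ξ x

section Slab

variable {n : ℕ} {T : ℝ}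

theorem slab_eq_restrict (n : ℕ) (T : ℝ) :
    slab n T = ((volume : Measure ℝ).prod (volume : Measure (E n))).restrict
      (Set.Icc 0 T ×ˢ Set.univ) := by
  rw [← Measure.prod_restrict, Measure.restrict_univ]

theorem slab_mono {S T : ℝ} (h : S ≤ T) : slab n S ≤ slab n T :=
  Measure.prod_mono (Measure.restrict_mono (Set.Icc_subset_Icc_right h) le_rfl) le_rfl

/-- Extension by zero off the slab. -/
theorem exists_memLp_extension {p : ℝ≥0∞} {f : ℝ × E n → ℝ} (hf : MemLp f p (slab n T)) :
    ∃ A : ℝ × E n → ℝ, MemLp A p ((volume : Measure ℝ).prod (volume : Measure (E n))) ∧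
      (∀ t ∈ Set.Icc 0 T, ∀ x, A (t, x) = f (t, x)) ∧ ∀ t ∉ Set.Icc 0 T, ∀ x, A (t, x) = 0 := by
  refine ⟨(Set.Icc 0 T ×ˢ Set.univ).indicator f, ?_,
    fun t ht x => Set.indicator_of_mem (Set.mk_mem_prod ht (Set.mem_univ x)) f,
    fun t ht x => Set.indicator_of_notMem (fun h => ht (Set.mem_prod.1 h).1) f⟩
  rw [memLp_indicator_iff_restrict (measurableSet_Icc.prod MeasurableSet.univ),
    ← slab_eq_restrict]
  exact hf

theorem ae_memLp_slice {p : ℝ} (hp : 0 < p) {f : ℝ × E n → ℝ}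
    (hf : MemLp f (ENNReal.ofReal p) (slab n T)) :
    ∀ᵐ s ∂volume.restrict (Set.Icc 0 T), MemLp (fun x => f (s, x)) (ENNReal.ofReal p) volume := by
  have hp0 : ENNReal.ofReal p ≠ 0 := by simpa using hp
  have h1 := (integrable_norm_rpow_iff hf.1 hp0 ENNReal.ofReal_ne_top).2 hf
  filter_upwards [h1.prod_right_ae, hf.1.prodMk_left] with s hs hm
  exact (integrable_norm_rpow_iff hm hp0 ENNReal.ofReal_ne_top).1 hs

theorem MemSumLp.add {p : ℝ} {G G' : ℝ × E n → ℝ} (h : MemSumLp n T p G)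
    (h' : MemSumLp n T p G') : MemSumLp n T p (fun y => G y + G' y) := by
  obtain ⟨A, B, h1, h2, h3⟩ := h
  obtain ⟨A', B', h1', h2', h3'⟩ := h'
  exact ⟨A + A', B + B', h1.add h1', h2.add h2', fun y => by simp [h3, h3']; ring⟩

theorem MemSumLp.neg {p : ℝ} {G : ℝ × E n → ℝ} (h : MemSumLp n T p G) :
    MemSumLp n T p (fun y => - G y) := by
  obtain ⟨A, B, h1, h2, h3⟩ := h
  exact ⟨-A, -B, h1.neg, h2.neg, fun y => by simp [h3]; ring⟩

theorem MemSumLp.sub {p : ℝ} {G G' : ℝ × E n → ℝ} (h : MemSumLp n T p G)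
    (h' : MemSumLp n T p G') : MemSumLp n T p (fun y => G y - G' y) := by
  simpa only [sub_eq_add_neg] using h.add h'.neg

theorem holderConjugate_of_two_lt {p : ℝ} (hp : 2 < p) :
    ENNReal.HolderConjugate (ENNReal.ofReal p.conjExponent) (ENNReal.ofReal p) :=
  ((Real.HolderConjugate.conjExponent (by linarith)).symm).ennrealOfReal

theorem MemSumLp.integrable_mul {p : ℝ} (hp : 2 < p) {G f : ℝ × E n → ℝ}
    (h : MemSumLp n T p G) (hf2 : MemLp f 2 (slab n T))
    (hfp : MemLp f (ENNReal.ofReal p) (slab n T)) :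
    Integrable (fun y => G y * f y) (slab n T) := by
  obtain ⟨A, B, h1, h2, h3⟩ := h
  have := holderConjugate_of_two_lt hp
  have e : (fun y => G y * f y) = fun y => A y * f y + B y * f y := by
    funext y
    rw [h3, add_mul]
  rw [e]
  exact (h1.integrable_mul hf2).add (h2.integrable_mul hfp)

theorem MemSumLp.integrable_mul_test {p : ℝ} (hp : 2 < p) {G : ℝ × E n → ℝ}
    (h : MemSumLp n T p G) {f : E n → ℝ} (hf2 : MemLp f 2 volume)
    (hfp : MemLp f (ENNReal.ofReal p) volume) :
    Integrable (fun y => G y * f y.2) (slab n T) :=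
  h.integrable_mul hp (hf2.comp_snd _) (hfp.comp_snd _)

theorem memLp_two_of_slice {U : ℝ × E n → ℝ} (hU : StronglyMeasurable U) {Z : ℝ → H n}
    (hZ : Continuous Z) (hs : ∀ s, (fun x => U (s, x)) =ᵐ[volume] Z s) (T : ℝ) :
    MemLp U 2 (slab n T) := by
  rw [memLp_two_iff_integrable_sq hU.aestronglyMeasurable]
  have hsq : ∀ s, ∫ x, ‖U (s, x) ^ 2‖ = ‖Z s‖ ^ 2 := by
    intro s
    rw [← real_inner_self_eq_norm_sq, L2.inner_def]
    refine integral_congr_ae ?_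
    filter_upwards [hs s] with x hx
    simp [hx, sq]
  refine (integrable_prod_iff (hU.pow 2).aestronglyMeasurable).2 ⟨ae_of_all _ fun s => ?_, ?_⟩
  · exact ((memLp_congr_ae (hs s)).2 (Lp.memLp (Z s))).integrable_sq
  · change Integrable (fun s => ∫ x, ‖U (s, x) ^ 2‖) _
    simp_rw [hsq]
    exact (hZ.norm.pow 2).integrableOn_Icc

end Slab

section Shift

variable {n : ℕ} {α : Set.Ioo (0 : ℝ) 1}

/-- The regularity of `Ψ(ρ,t)` in `norm_sq_sub_le_of_increments`, where `ρ` is a small time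
shift. -/
def ShiftRegular (τ : ℝ) (Ψ : ℝ → ℝ → ℝ) : Prop :=
  Integrable (Function.uncurry Ψ) ((volume.restrict (Set.Ioc 0 1)).prod volume) ∧
    Continuous fun ρ => ∫ t in Set.Icc 0 τ, Ψ ρ t

theorem ShiftRegular.add {τ : ℝ} {Ψ Ψ' : ℝ → ℝ → ℝ} (h : ShiftRegular τ Ψ)
    (h' : ShiftRegular τ Ψ') (hi : ∀ ρ, Integrable (Ψ ρ) (volume.restrict (Set.Icc 0 τ)))
    (hi' : ∀ ρ, Integrable (Ψ' ρ) (volume.restrict (Set.Icc 0 τ))) :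
    ShiftRegular τ fun ρ t => Ψ ρ t + Ψ' ρ t := by
  refine ⟨h.1.add h'.1, ?_⟩
  simp_rw [integral_add (hi _) (hi' _)]
  exact h.2.add h'.2

/-- Pairings of a shifted `L²(ℝ)` function with values in a normed space are regular. -/
theorem shiftRegular_bilin {B₁ B₂ : Type*} [NormedAddCommGroup B₁] [NormedSpace ℝ B₁]
    [NormedAddCommGroup B₂] [NormedSpace ℝ B₂] (L : B₁ →L[ℝ] B₂ →L[ℝ] ℝ) {τ : ℝ}
    {f : ℝ → B₁} {g : ℝ → B₂} (hf : MemLp f 2 volume) (hg : MemLp g 2 volume)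
    (hg0 : ∀ t ∉ Set.Icc 0 τ, g t = 0) :
    ShiftRegular τ (fun ρ t => L (f (t - ρ)) (g t)) ∧
      ∀ ρ, Integrable (fun t => L (f (t - ρ)) (g t)) (volume.restrict (Set.Icc 0 τ)) := by
  refine ⟨⟨?_, ?_⟩, fun ρ => ?_⟩
  · simpa [Function.uncurry_def] using integrable_translate_prod volume L (1 : ℝ) hf hg 1
  · have := continuous_integral_translate volume (by norm_num) L (1 : ℝ) hf hg
    refine this.congr fun ρ => ?_
    rw [setIntegral_eq_integral_of_forall_compl_eq_zero fun t ht => by simp [hg0 t ht]]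
    simp
  · have h1 := hf.comp_measurePreserving (measurePreserving_sub_right volume ρ)
    exact (memLp_one_iff_integrable.1 (L.memLp_of_bilin 1 h1 hg)).restrict

/-- Pairings in space of a function on `ℝ × ℝⁿ`, shifted in time, with another one are regular. -/
theorem shiftRegular_mul {a b : ℝ≥0∞} [Fact (1 ≤ a)] [Fact (1 ≤ b)]
    [ENNReal.HolderConjugate a b] (ha : a ≠ ∞) {τ : ℝ}
    {f g : ℝ × E n → ℝ} (hf : MemLp f a ((volume : Measure ℝ).prod volume))
    (hg : MemLp g b ((volume : Measure ℝ).prod volume))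
    (hg0 : ∀ t ∉ Set.Icc 0 τ, ∀ x, g (t, x) = 0) :
    ShiftRegular τ (fun ρ t => ∫ x, f (t - ρ, x) * g (t, x)) ∧
      ∀ ρ, Integrable (fun t => ∫ x, f (t - ρ, x) * g (t, x)) (volume.restrict (Set.Icc 0 τ)) := by
  have hi : ∀ ρ : ℝ, Integrable (fun y : ℝ × E n => f (y.1 - ρ, y.2) * g y)
      ((volume : Measure ℝ).prod volume) := by
    intro ρ
    have h1 := hf.comp_measurePreserving
      (measurePreserving_sub_right ((volume : Measure ℝ).prod (volume : Measure (E n))) (ρ, 0))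
    have h2 := h1.integrable_mul hg
    refine h2.congr (ae_of_all _ fun y => ?_)
    simp [Function.comp_def, Prod.sub_def]
  refine ⟨⟨?_, ?_⟩, fun ρ => (hi ρ).integral_prod_left.restrict⟩
  · have h1 := integrable_translate_prod ((volume : Measure ℝ).prod (volume : Measure (E n)))
      (ContinuousLinearMap.mul ℝ ℝ) ((1 : ℝ), (0 : E n)) hf hg 1
    have h2 := ((measurePreserving_prodAssoc (volume.restrict (Set.Ioc (0 : ℝ) 1))
      (volume : Measure ℝ) (volume : Measure (E n))).integrable_comp
        h1.aestronglyMeasurable).2 h1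
    have h3 := h2.integral_prod_left
    refine h3.congr (ae_of_all _ fun z => ?_)
    simp [Function.uncurry, MeasurableEquiv.prodAssoc, Prod.sub_def]
  · have := continuous_integral_translate ((volume : Measure ℝ).prod (volume : Measure (E n)))
      ha (ContinuousLinearMap.mul ℝ ℝ) ((1 : ℝ), (0 : E n)) hf hg
    refine this.congr fun ρ => ?_
    rw [setIntegral_eq_integral_of_forall_compl_eq_zero fun t ht => by simp [hg0 t ht],
      ← integral_prod _ (hi ρ)]
    refine integral_congr_ae (ae_of_all _ fun y => ?_)
    simp [Prod.sub_def]

end Shift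

section Energy

variable {n : ℕ} {α : Set.Ioo (0 : ℝ) 1} {T p : ℝ} {z₀ : H n} {Z : ℝ → H n} {ZV : ℝ → V n α}
  {U G : ℝ × E n → ℝ}

theorem integrable_fracForm {m : Measure ℝ} {W W' : ℝ → V n α} (h : MemLp W 2 m)
    (h' : MemLp W' 2 m) :
    Integrable (fun s => fracForm n α (V.toH (W s)) (V.toH (W' s))) m := by
  simp_rw [← fracBilin_apply]
  exact memLp_one_iff_integrable.1 ((fracBilin n α).memLp_of_bilin 1 h h')

theorem WeakSol.memLp_two (h : WeakSol T p z₀ Z ZV U G) : MemLp U 2 (slab n T) :=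
  memLp_two_of_slice h.meas h.cont h.slice T

theorem WeakSol.integrable_force_mul (h : WeakSol T p z₀ Z ZV U G) (hp : 2 < p) :
    Integrable (fun y => G y * U y) (slab n T) :=
  h.force.integrable_mul hp h.memLp_two h.memLp

/-- The functional `⟨-(-Δ)^α Z(s) + G(s), ξ⟩`, whose time integrals are the increments
of `(Z, ξ)`. -/
noncomputable def testForce (ZV : ℝ → V n α) (G : ℝ × E n → ℝ) (ξ : V n α) (s : ℝ) : ℝ :=
  -fracForm n α (V.toH (ZV s)) (V.toH ξ) + ∫ x, G (s, x) * V.toH ξ x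

theorem WeakSol.integrable_form (h : WeakSol T p z₀ Z ZV U G) (ξ : V n α) :
    Integrable (fun s => fracForm n α (V.toH (ZV s)) (V.toH ξ))
      (volume.restrict (Set.Icc 0 T)) :=
  integrable_fracForm h.memV (memLp_const ξ)

theorem WeakSol.integrable_force_test (h : WeakSol T p z₀ Z ZV U G) (hp : 2 < p) {ξ : V n α}
    (hξ : MemLp (V.toH ξ) (ENNReal.ofReal p) volume) :
    Integrable (fun s => ∫ x, G (s, x) * V.toH ξ x) (volume.restrict (Set.Icc 0 T)) :=
  (h.force.integrable_mul_test hp (Lp.memLp (V.toH ξ)) hξ).integral_prod_left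

theorem WeakSol.integrable_testForce (h : WeakSol T p z₀ Z ZV U G) (hp : 2 < p) {ξ : V n α}
    (hξ : MemLp (V.toH ξ) (ENNReal.ofReal p) volume) :
    Integrable (testForce ZV G ξ) (volume.restrict (Set.Icc 0 T)) :=
  (h.integrable_form ξ).neg.add (h.integrable_force_test hp hξ)

theorem WeakSol.inner_eq (h : WeakSol T p z₀ Z ZV U G) (hp : 2 < p) {ξ : V n α}
    (hξ : MemLp (V.toH ξ) (ENNReal.ofReal p) volume) {t : ℝ} (ht : t ∈ Set.Icc 0 T) :
    inner ℝ (Z t) (V.toH ξ) = inner ℝ z₀ (V.toH ξ) + ∫ s in (0 : ℝ)..t, testForce ZV G ξ s := by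
  have hm : volume.restrict (Set.Icc 0 t) ≤ volume.restrict (Set.Icc 0 T) :=
    Measure.restrict_mono (Set.Icc_subset_Icc_right ht.2) le_rfl
  have h1 := h.weak t ht ξ hξ
  rw [intervalIntegral.integral_of_le ht.1, ← integral_Icc_eq_integral_Ioc]
  simp only [testForce]
  have hneg : Integrable (fun s => -fracForm n α (V.toH (ZV s)) (V.toH ξ))
      (volume.restrict (Set.Icc 0 t)) := ((h.integrable_form ξ).mono_measure hm).neg
  rw [integral_add hneg ((h.integrable_force_test hp hξ).mono_measure hm), integral_neg]
  linarith

/-- The increments of `(Z, ξ)`, also across time `0`, before which `Z` is constant. -/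
theorem WeakSol.inner_sub_eq (h : WeakSol T p z₀ Z ZV U G) (hp : 2 < p) {ξ : V n α}
    (hξ : MemLp (V.toH ξ) (ENNReal.ofReal p) volume) {r t : ℝ} (ht : t ∈ Set.Icc 0 T)
    (hrt : r ≤ t) :
    inner ℝ (Z t - Z r) (V.toH ξ)
      = ∫ s in r..t, (Set.Icc 0 T).indicator (testForce ZV G ξ) s := by
  have hT0 : (0 : ℝ) ∈ Set.Icc 0 T := ⟨le_rfl, ht.1.trans ht.2⟩
  set φ := (Set.Icc 0 T).indicator (testForce ZV G ξ)
  have hφ : Integrable φ volume :=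
    (integrable_indicator_iff measurableSet_Icc).2 (h.integrable_testForce hp hξ)
  have hφI : ∀ a b : ℝ, IntervalIntegrable φ volume a b := fun a b => hφ.intervalIntegrable
  have h0 : inner ℝ (Z 0) (V.toH ξ) = inner ℝ z₀ (V.toH ξ) := by
    rw [h.inner_eq hp hξ hT0]
    simp
  have hpos : ∀ r ∈ Set.Icc 0 T,
      inner ℝ (Z r) (V.toH ξ) = inner ℝ z₀ (V.toH ξ) + ∫ s in (0 : ℝ)..r, φ s := by
    intro r hr
    rw [h.inner_eq hp hξ hr]
    congr 1
    refine intervalIntegral.integral_congr fun s hs => ?_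
    rw [Set.uIcc_of_le hr.1] at hs
    simp only [φ]
    rw [Set.indicator_of_mem (Set.mem_Icc.2 ⟨hs.1, hs.2.trans hr.2⟩)]
  have hr : inner ℝ (Z r) (V.toH ξ) = inner ℝ z₀ (V.toH ξ) + ∫ s in (0 : ℝ)..r, φ s := by
    rcases le_total 0 r with hr | hr
    · exact hpos r ⟨hr, hrt.trans ht.2⟩
    · rw [h.const_left r hr, h0, intervalIntegral.integral_symm, intervalIntegral.integral_of_le hr,
        integral_Ioc_eq_integral_Ioo, setIntegral_eq_zero_of_forall_eq_zero, neg_zero, add_zero]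
      intro s hs
      exact Set.indicator_of_notMem (fun hs' => (not_le.2 hs.2) hs'.1) _
  rw [inner_sub_left, hr, hpos t ht,
    ← intervalIntegral.integral_add_adjacent_intervals (hφI r 0) (hφI 0 t),
    intervalIntegral.integral_symm 0 r]
  ring

/-- The equation at time `0` says that `Z(0) - z₀` is orthogonal to `V ∩ L^p`, hence to `Z(s)` for
almost every `s`, hence to `Z(0)`. As `V ∩ L^p` is not assumed dense, this replaces
`Z(0) = z₀`. -/
theorem WeakSol.norm_zero_le (h : WeakSol T p z₀ Z ZV U G) (hT : 0 < T) (hp : 2 < p) :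
    ‖Z 0‖ ≤ ‖z₀‖ := by
  have hT0 : (0 : ℝ) ∈ Set.Icc 0 T := ⟨le_rfl, hT.le⟩
  have hc : Continuous fun s => inner ℝ (Z 0 - z₀) (Z s) := continuous_const.inner h.cont
  have hae : (fun s => inner ℝ (Z 0 - z₀) (Z s)) =ᵐ[volume.restrict (Set.Icc 0 T)]
      fun _ => (0 : ℝ) := by
    filter_upwards [h.ae_eq, ae_memLp_slice (by linarith) h.memLp] with s hs hs2
    have hξ : MemLp (V.toH (ZV s)) (ENNReal.ofReal p) volume := by
      rw [← hs]
      exact (memLp_congr_ae (h.slice s)).1 hs2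
    rw [hs, inner_sub_left, h.inner_eq hp hξ hT0]
    simp
  have h0 := Measure.eqOn_Icc_of_ae_eq volume hT.ne hae hc.continuousOn continuousOn_const hT0
  simp only [inner_sub_left, real_inner_self_eq_norm_sq] at h0
  have h1 := real_inner_le_norm z₀ (Z 0)
  by_contra hlt
  push Not at hlt
  nlinarith [norm_nonneg z₀, norm_nonneg (Z 0)]

/-- The energy inequality. The increments of `Z` are tested with `Z(t)` itself, which lies in
`V ∩ L^p` for almost every `t`, and the resulting pairings are continuous in the shift because
translations are continuous in `L²` and `L^{p'}`. -/
theorem WeakSol.energy (h : WeakSol T p z₀ Z ZV U G) (hT : 0 < T) (hp : 2 < p) {τ : ℝ}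
    (hτ : τ ∈ Set.Icc 0 T) :
    ‖Z τ‖ ^ 2 + 2 * ∫ s in Set.Icc 0 τ, fracForm n α (V.toH (ZV s)) (V.toH (ZV s))
      ≤ ‖z₀‖ ^ 2 + 2 * ∫ s in Set.Icc 0 τ, ∫ x, G (s, x) * U (s, x) := by
  obtain ⟨G₁, G₂, hG₁, hG₂, hG⟩ := h.force
  have hm : volume.restrict (Set.Icc 0 τ) ≤ volume.restrict (Set.Icc 0 T) :=
    Measure.restrict_mono (Set.Icc_subset_Icc_right hτ.2) le_rfl
  have hconj := holderConjugate_of_two_lt hp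
  have hq1 : Fact (1 ≤ ENNReal.ofReal p.conjExponent) := ⟨hconj.one_le⟩
  have hp1 : Fact (1 ≤ ENNReal.ofReal p) := ⟨hconj.symm.one_le⟩
  set W := (Set.Icc 0 T).indicator ZV with hWdef
  set Wτ := (Set.Icc 0 τ).indicator ZV with hWτdef
  have hW : MemLp W 2 volume := (memLp_indicator_iff_restrict measurableSet_Icc).2 h.memV
  have hWτ : MemLp Wτ 2 volume :=
    (memLp_indicator_iff_restrict measurableSet_Icc).2 (h.memV.mono_measure hm)
  obtain ⟨A, hA, hAin, hAout⟩ := exists_memLp_extension hG₁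
  obtain ⟨B, hB, hBin, hBout⟩ := exists_memLp_extension hG₂
  obtain ⟨Uτ, hU2, hUin, hUout⟩ :=
    exists_memLp_extension (h.memLp_two.mono_measure (slab_mono hτ.2))
  have hUp : MemLp Uτ (ENNReal.ofReal p) ((volume : Measure ℝ).prod volume) := by
    obtain ⟨Uτ', hU', hUin', hUout'⟩ :=
      exists_memLp_extension (h.memLp.mono_measure (slab_mono hτ.2))
    have : Uτ = Uτ' := by
      funext ⟨t, x⟩
      by_cases ht : t ∈ Set.Icc 0 τ
      · rw [hUin t ht, hUin' t ht]
      · rw [hUout t ht, hUout' t ht]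
    rwa [this]
  -- `Ψ(ρ,t)` is `⟨-(-Δ)^α Z(t-ρ) + G(t-ρ), Z(t)⟩`, with `G` and `Z` extended by zero
  obtain ⟨r1, i1⟩ := shiftRegular_bilin (-fracBilin n α) (τ := τ) hW hWτ
    fun t ht => Set.indicator_of_notMem ht _
  obtain ⟨r2, i2⟩ := shiftRegular_mul (by norm_num) hA hU2 hUout
  obtain ⟨r3, i3⟩ := shiftRegular_mul ENNReal.ofReal_ne_top hB hUp hUout
  have r23 := r2.add r3 i2 i3
  have r123 := r1.add r23 i1 fun ρ => (i2 ρ).add (i3 ρ)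
  have key := norm_sq_sub_le_of_increments h.cont h.const_left hτ.1 r123.1 r123.2 ?_
  · have h0 := h.norm_zero_le hT hp
    have h02 : ‖Z 0‖ ^ 2 ≤ ‖z₀‖ ^ 2 := pow_le_pow_left₀ (norm_nonneg _) h0 2
    have hform : Integrable (fun s => fracForm n α (V.toH (ZV s)) (V.toH (ZV s)))
        (volume.restrict (Set.Icc 0 τ)) :=
      integrable_fracForm (h.memV.mono_measure hm) (h.memV.mono_measure hm)
    have hGU : Integrable (fun s => ∫ x, G (s, x) * U (s, x)) (volume.restrict (Set.Icc 0 τ)) :=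
      (h.integrable_force_mul hp).integral_prod_left.mono_measure hm
    have hval : ∫ t in Set.Icc 0 τ, ((-fracBilin n α) (W (t - 0)) (Wτ t)
          + ((∫ x, A (t - 0, x) * Uτ (t, x)) + ∫ x, B (t - 0, x) * Uτ (t, x)))
        = ∫ t in Set.Icc 0 τ, (-fracForm n α (V.toH (ZV t)) (V.toH (ZV t))
          + ∫ x, G (t, x) * U (t, x)) := by
      have e1 : ∀ᵐ t ∂volume.restrict (Set.Icc 0 T), Integrable fun x => G₁ (t, x) * U (t, x) :=
        (hG₁.integrable_mul h.memLp_two).prod_right_ae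
      have e2 : ∀ᵐ t ∂volume.restrict (Set.Icc 0 T), Integrable fun x => G₂ (t, x) * U (t, x) :=
        (hG₂.integrable_mul h.memLp).prod_right_ae
      refine integral_congr_ae ?_
      filter_upwards [ae_mono hm e1, ae_mono hm e2, ae_restrict_mem measurableSet_Icc]
        with t h1 h2 ht
      have htT : t ∈ Set.Icc 0 T := ⟨ht.1, ht.2.trans hτ.2⟩
      simp only [sub_zero, hAin t htT, hBin t htT, hUin t ht]
      rw [← integral_add h1 h2, hWdef, hWτdef, Set.indicator_of_mem htT, Set.indicator_of_mem ht]
      simp [fracBilin_apply, hG, add_mul]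
    have hneg : Integrable (fun s => -fracForm n α (V.toH (ZV s)) (V.toH (ZV s)))
        (volume.restrict (Set.Icc 0 τ)) := hform.neg
    rw [hval, integral_add hneg hGU, integral_neg] at key
    linarith
  · -- the increment over a step `η`, tested with the fixed element `Z(t)` of `V ∩ L^p`
    intro η hη
    have e0 := h.ae_eq
    have e1 := ae_memLp_slice (by linarith) h.memLp
    filter_upwards [ae_mono hm e0, ae_mono hm e1, ae_restrict_mem measurableSet_Icc]
      with t h1 h2 ht
    have htT : t ∈ Set.Icc 0 T := ⟨ht.1, ht.2.trans hτ.2⟩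
    have hξ : MemLp (V.toH (ZV t)) (ENNReal.ofReal p) volume := by
      rw [← h1]
      exact (memLp_congr_ae (h.slice t)).1 h2
    have hinc := h.inner_sub_eq hp hξ htT (sub_le_self t hη.1.le)
    rw [← h1] at hinc
    rw [hinc, ← intervalIntegral.integral_of_le hη.1.le]
    have hsub := intervalIntegral.integral_comp_sub_left (a := 0) (b := η)
      ((Set.Icc 0 T).indicator (testForce ZV G (ZV t))) t
    rw [sub_zero] at hsub
    rw [← hsub]
    have e3 : ∀ᵐ s ∂volume.restrict (Set.Icc 0 T),
        Integrable fun x => G₁ (s, x) * V.toH (ZV t) x :=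
      (hG₁.integrable_mul ((Lp.memLp (V.toH (ZV t))).comp_snd
        (volume.restrict (Set.Icc 0 T)))).prod_right_ae
    have e4 : ∀ᵐ s ∂volume.restrict (Set.Icc 0 T),
        Integrable fun x => G₂ (s, x) * V.toH (ZV t) x :=
      (hG₂.integrable_mul (hξ.comp_snd (volume.restrict (Set.Icc 0 T)))).prod_right_ae
    have e5 := (ae_restrict_iff' measurableSet_Icc).1 (e3.and e4)
    have e6 := (Measure.measurePreserving_sub_left volume t).quasiMeasurePreserving.ae e5
    refine intervalIntegral.integral_congr_ae ?_
    filter_upwards [e6] with ρ hρ _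
    have hUt : ∀ᵐ x, Uτ (t, x) = V.toH (ZV t) x := by
      filter_upwards [h.slice t] with x hx
      rw [← h1, ← hx, hUin t ht]
    by_cases hmem : t - ρ ∈ Set.Icc 0 T
    · have c1 : ∫ x, A (t - ρ, x) * Uτ (t, x) = ∫ x, G₁ (t - ρ, x) * V.toH (ZV t) x := by
        refine integral_congr_ae ?_
        filter_upwards [hUt] with x hx
        rw [hAin _ hmem, hx]
      have c2 : ∫ x, B (t - ρ, x) * Uτ (t, x) = ∫ x, G₂ (t - ρ, x) * V.toH (ZV t) x := by
        refine integral_congr_ae ?_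
        filter_upwards [hUt] with x hx
        rw [hBin _ hmem, hx]
      rw [c1, c2, ← integral_add (hρ hmem).1 (hρ hmem).2, Set.indicator_of_mem hmem, hWdef, hWτdef,
        Set.indicator_of_mem hmem, Set.indicator_of_mem ht]
      simp [fracBilin_apply, hG, add_mul, testForce]
    · rw [Set.indicator_of_notMem hmem, hWdef, Set.indicator_of_notMem hmem]
      simp [hAout _ hmem, hBout _ hmem]

theorem WeakSol.sub {z₀' : H n} {Z' : ℝ → H n} {ZV' : ℝ → V n α} {U' G' : ℝ × E n → ℝ}
    (h : WeakSol T p z₀ Z ZV U G) (h' : WeakSol T p z₀' Z' ZV' U' G') (hp : 2 < p) :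
    WeakSol T p (z₀ - z₀') (fun s => Z s - Z' s) (fun s => ZV s - ZV' s)
      (fun y => U y - U' y) (fun y => G y - G' y) where
  cont := h.cont.sub h'.cont
  const_left t ht := by rw [h.const_left t ht, h'.const_left t ht]
  memV := h.memV.sub h'.memV
  ae_eq := by
    filter_upwards [h.ae_eq, h'.ae_eq] with s h1 h2
    rw [h1, h2, map_sub]
  meas := h.meas.sub h'.meas
  slice s := by
    filter_upwards [h.slice s, h'.slice s, Lp.coeFn_sub (Z s) (Z' s)] with x h1 h2 h3
    rw [h3, Pi.sub_apply, ← h1, ← h2]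
  memLp := h.memLp.sub h'.memLp
  force := h.force.sub h'.force
  weak t ht ξ hξ := by
    have hm : volume.restrict (Set.Icc 0 t) ≤ volume.restrict (Set.Icc 0 T) :=
      Measure.restrict_mono (Set.Icc_subset_Icc_right ht.2) le_rfl
    have e1 := h.weak t ht ξ hξ
    have e2 := h'.weak t ht ξ hξ
    have i1 := (h.integrable_form ξ).mono_measure hm
    have i2 := (h'.integrable_form ξ).mono_measure hm
    have i3 := (h.integrable_force_test hp hξ).mono_measure hm
    have i4 := (h'.integrable_force_test hp hξ).mono_measure hm
    have c1 : ∀ s, fracForm n α (V.toH (ZV s - ZV' s)) (V.toH ξ)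
        = fracForm n α (V.toH (ZV s)) (V.toH ξ) - fracForm n α (V.toH (ZV' s)) (V.toH ξ) := by
      intro s
      rw [← fracBilin_apply, ← fracBilin_apply, ← fracBilin_apply, map_sub]
      rfl
    have c2 : ∫ s in Set.Icc 0 t, ∫ x, (G (s, x) - G' (s, x)) * V.toH ξ x
        = ∫ s in Set.Icc 0 t, ((∫ x, G (s, x) * V.toH ξ x) - ∫ x, G' (s, x) * V.toH ξ x) := by
      refine integral_congr_ae ?_
      have j1 := (h.force.integrable_mul_test hp (Lp.memLp (V.toH ξ)) hξ).prod_right_ae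
      have j2 := (h'.force.integrable_mul_test hp (Lp.memLp (V.toH ξ)) hξ).prod_right_ae
      filter_upwards [ae_mono hm j1, ae_mono hm j2] with s k1 k2
      rw [← integral_sub k1 k2]
      simp only [sub_mul]
    simp only [c1, c2]
    rw [integral_sub i1 i2, integral_sub i3 i4, inner_sub_left, inner_sub_left]
    linarith

end Energy

/-! ### Grönwall's inequality and the coefficients of the controlled equation -/

section Gronwall

variable {T K : ℝ}

theorem integral_exp_le {μ : ℝ} (hμ : 0 < μ) {t : ℝ} (ht : 0 ≤ t) :
    ∫ s in Set.Icc 0 t, Real.exp (μ * (s - t)) ≤ 1 / μ := by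
  rw [integral_Icc_eq_integral_Ioc, ← intervalIntegral.integral_of_le ht]
  have hd : ∀ s ∈ Set.uIcc 0 t, HasDerivAt (fun s => Real.exp (μ * (s - t)) / μ)
      (Real.exp (μ * (s - t))) s := by
    intro s _
    have := (((hasDerivAt_id s).sub_const t).const_mul μ).exp.div_const μ
    refine this.congr_deriv ?_
    simp only [id]
    field_simp
  rw [intervalIntegral.integral_eq_sub_of_hasDerivAt hd
    ((by fun_prop : Continuous fun s => Real.exp (μ * (s - t))).intervalIntegrable _ _)]
  simp only [sub_self, mul_zero, Real.exp_zero]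
  have := Real.exp_pos (μ * (0 - t))
  have : 0 ≤ Real.exp (μ * (0 - t)) / μ := by positivity
  linarith

/-- With the rate `2K`, an `L²` weight of squared norm at most `K` gains a factor `1/2`. -/
theorem integral_mul_exp_le (hK : 0 < K) {a : ℝ → ℝ}
    (ha : MemLp a 2 (volume.restrict (Set.Icc 0 T)))
    (haK : ∫ s in Set.Icc 0 T, a s ^ 2 ≤ K) {t : ℝ} (ht : t ∈ Set.Icc 0 T) :
    ∫ s in Set.Icc 0 t, a s * Real.exp (2 * K * s) ≤ 1 / 2 * Real.exp (2 * K * t) := by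
  have hm : volume.restrict (Set.Icc 0 t) ≤ volume.restrict (Set.Icc 0 T) :=
    Measure.restrict_mono (Set.Icc_subset_Icc_right ht.2) le_rfl
  have hsq : Integrable (fun s => a s ^ 2) (volume.restrict (Set.Icc 0 T)) := ha.integrable_sq
  have hexp : MemLp (fun s => Real.exp (2 * K * s)) 2 (volume.restrict (Set.Icc 0 t)) :=
    (memLp_two_iff_integrable_sq (by fun_prop)).2
      (by fun_prop : Continuous fun s => Real.exp (2 * K * s) ^ 2).integrableOn_Icc
  have hexp2 : Integrable (fun s => Real.exp (4 * K * (s - t))) (volume.restrict (Set.Icc 0 t)) :=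
    (by fun_prop : Continuous fun s => Real.exp (4 * K * (s - t))).integrableOn_Icc
  have h1 : ∫ s in Set.Icc 0 t, a s * Real.exp (2 * K * s)
      ≤ ∫ s in Set.Icc 0 t, Real.exp (2 * K * t) *
        (1 / (4 * K) * a s ^ 2 + K * Real.exp (4 * K * (s - t))) := by
    refine integral_mono ((ha.mono_measure hm).integrable_mul hexp)
      ((((hsq.mono_measure hm).const_mul _).add (hexp2.const_mul _)).const_mul _) fun s => ?_
    have e1 : Real.exp (2 * K * s) = Real.exp (2 * K * t) * Real.exp (2 * K * (s - t)) := by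
      rw [← Real.exp_add]
      ring_nf
    have e2 : Real.exp (4 * K * (s - t)) = Real.exp (2 * K * (s - t)) ^ 2 := by
      rw [← Real.exp_nat_mul]
      ring_nf
    simp only [e1, e2]
    rw [mul_left_comm]
    refine mul_le_mul_of_nonneg_left ?_ (Real.exp_pos _).le
    -- `a e ≤ a²/(4K) + K e²`, where both terms integrate to at most `1/4`
    have e3 : 1 / (4 * K) * a s ^ 2 + K * Real.exp (2 * K * (s - t)) ^ 2
        - a s * Real.exp (2 * K * (s - t))
        = (a s - 2 * K * Real.exp (2 * K * (s - t))) ^ 2 / (4 * K) := by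
      field_simp
      ring
    have : 0 ≤ (a s - 2 * K * Real.exp (2 * K * (s - t))) ^ 2 / (4 * K) := by positivity
    linarith
  refine h1.trans ?_
  rw [integral_const_mul, integral_add ((hsq.mono_measure hm).const_mul _) (hexp2.const_mul _),
    integral_const_mul, integral_const_mul, mul_comm]
  refine mul_le_mul_of_nonneg_right ?_ (Real.exp_pos _).le
  have h2 : ∫ s in Set.Icc 0 t, a s ^ 2 ≤ K :=
    (integral_mono_measure hm (ae_of_all _ fun s => sq_nonneg (a s)) hsq).trans haK
  have h3 := integral_exp_le (show (0 : ℝ) < 4 * K by positivity) ht.1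
  have h4 : 1 / (4 * K) * ∫ s in Set.Icc 0 t, a s ^ 2 ≤ 1 / (4 * K) * K :=
    mul_le_mul_of_nonneg_left h2 (by positivity)
  have h5 := mul_le_mul_of_nonneg_left h3 hK.le
  have e1 : 1 / (4 * K) * K = 1 / 4 := by field_simp
  have e2 : K * (1 / (4 * K)) = 1 / 4 := by field_simp
  linarith

/-- Grönwall's inequality with a square integrable kernel, evaluated where `y(t) exp(-2Kt)` is
maximal. -/
theorem gronwall_sq_integrable (hT : 0 ≤ T) (hK : 0 < K) {a : ℝ → ℝ}
    (ha : MemLp a 2 (volume.restrict (Set.Icc 0 T))) (ha0 : ∀ s, 0 ≤ a s)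
    (haK : ∫ s in Set.Icc 0 T, a s ^ 2 ≤ K) {y : ℝ → ℝ} (hy : Continuous y) (hy0 : ∀ s, 0 ≤ y s)
    {A : ℝ} (hA : 0 ≤ A) (h : ∀ t ∈ Set.Icc 0 T, y t ≤ A + ∫ s in Set.Icc 0 t, a s * y s) :
    ∀ t ∈ Set.Icc 0 T, y t ≤ 2 * A * Real.exp (2 * K * T) := by
  obtain ⟨t₀, ht₀, hmax⟩ := isCompact_Icc.exists_isMaxOn (Set.nonempty_Icc.2 hT)
    (by fun_prop : Continuous fun s => y s * Real.exp (-(2 * K * s))).continuousOn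
  set S := y t₀ * Real.exp (-(2 * K * t₀)) with hS
  have hS0 : 0 ≤ S := mul_nonneg (hy0 _) (Real.exp_pos _).le
  have hle : ∀ s ∈ Set.Icc 0 T, y s ≤ S * Real.exp (2 * K * s) := by
    intro s hs
    have := mul_le_mul_of_nonneg_right (isMaxOn_iff.1 hmax s hs) (Real.exp_pos (2 * K * s)).le
    rwa [mul_assoc, ← Real.exp_add, neg_add_cancel, Real.exp_zero, mul_one] at this
  have hm : volume.restrict (Set.Icc 0 t₀) ≤ volume.restrict (Set.Icc 0 T) :=
    Measure.restrict_mono (Set.Icc_subset_Icc_right ht₀.2) le_rfl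
  have hy2 : MemLp y 2 (volume.restrict (Set.Icc 0 t₀)) :=
    (memLp_two_iff_integrable_sq hy.aestronglyMeasurable).2 (hy.pow 2).integrableOn_Icc
  have hexp : MemLp (fun s => Real.exp (2 * K * s)) 2 (volume.restrict (Set.Icc 0 t₀)) :=
    (memLp_two_iff_integrable_sq (by fun_prop)).2
      (by fun_prop : Continuous fun s => Real.exp (2 * K * s) ^ 2).integrableOn_Icc
  have h1 : ∫ s in Set.Icc 0 t₀, a s * y s
      ≤ ∫ s in Set.Icc 0 t₀, S * (a s * Real.exp (2 * K * s)) := by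
    refine integral_mono_ae ((ha.mono_measure hm).integrable_mul hy2)
      (((ha.mono_measure hm).integrable_mul hexp).const_mul S) ?_
    filter_upwards [ae_restrict_mem measurableSet_Icc] with s hs
    have := mul_le_mul_of_nonneg_left (hle s ⟨hs.1, hs.2.trans ht₀.2⟩) (ha0 s)
    change a s * y s ≤ S * (a s * Real.exp (2 * K * s))
    linarith
  rw [integral_const_mul] at h1
  have h2 := mul_le_mul_of_nonneg_left (integral_mul_exp_le hK ha haK ht₀) hS0
  have h3 := h t₀ ht₀
  have h4 : y t₀ = S * Real.exp (2 * K * t₀) := by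
    rw [hS, mul_assoc, ← Real.exp_add, neg_add_cancel, Real.exp_zero, mul_one]
  have h5 : S * Real.exp (2 * K * t₀) ≤ 2 * A := by linarith
  have h6 : S ≤ 2 * A := by
    refine le_trans ?_ h5
    exact le_mul_of_one_le_right hS0 (Real.one_le_exp (by have := ht₀.1; positivity))
  intro t ht
  refine (hle t ht).trans (mul_le_mul h6 ?_ (Real.exp_pos _).le (by positivity))
  exact Real.exp_le_exp.2 (mul_le_mul_of_nonneg_left ht.2 (by positivity))

end Gronwall

/-- The coefficients of the controlled equation, in jointly measurable form: the drift `F`, the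
external force `g` and the `l²`-valued noise coefficient `B`, with the bounds that the estimates
use. The constant `C` serves all of them. `F_mono` is the one-sided Lipschitz condition that a lower
bound of `∂F/∂u` gives, `F_coercive` the coercivity up to the integrable function `ψ`. The noise
coefficient is Lipschitz in its last argument and of linear growth over `φ`, which is bounded in
`L²(ℝⁿ)` uniformly in time. In that last argument no joint measurability is demanded: `B_meas` asks
only for measurability along functions of time and space. -/
structure ControlSystem (n : ℕ) (T p : ℝ) where
  F : ℝ × E n → ℝ → ℝ
  g : ℝ × E n → ℝ
  B : ℝ × E n → ℝ → Ell2
  φ : ℝ × E n → ℝ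
  ψ : ℝ × E n → ℝ
  lam : ℝ
  C : ℝ
  T_pos : 0 < T
  two_lt : 2 < p
  C_nonneg : 0 ≤ C
  lam_pos : 0 < lam
  F_cont : Continuous fun z : (ℝ × E n) × ℝ => F z.1 z.2
  F_growth : ∀ᵐ y ∂slab n T, ∀ r, |F y r| ≤ C * (|r| + |r| ^ (p - 1))
  F_mono : ∀ᵐ y ∂slab n T, ∀ r r', -(C * (r - r') ^ 2) ≤ (F y r - F y r') * (r - r')
  F_coercive : ∀ᵐ y ∂slab n T, ∀ r, lam * |r| ^ p - ψ y ≤ F y r * r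
  ψ_int : Integrable ψ (slab n T)
  g_mem : MemLp g 2 (slab n T)
  B_meas : ∀ U : ℝ × E n → ℝ, StronglyMeasurable U →
    AEStronglyMeasurable (fun y => B y (U y)) (slab n T)
  B_lip : ∀ y r r', ‖B y r - B y r'‖ ≤ C * |r - r'|
  B_growth : ∀ y r, ‖B y r‖ ≤ φ y + C * |r|
  φ_meas : StronglyMeasurable φ
  φ_int : ∀ s ∈ Set.Icc 0 T, Integrable (fun x => φ (s, x) ^ 2) ∧ ∫ x, φ (s, x) ^ 2 ≤ C

namespace ControlSystem

variable {n : ℕ} {α : Set.Ioo (0 : ℝ) 1} {T p : ℝ} (S : ControlSystem n T p)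

/-- The right-hand side `g - F(U) + σ(U) w` of the controlled equation. -/
noncomputable def forcing (U : ℝ × E n → ℝ) (w : ℝ → Ell2) (y : ℝ × E n) : ℝ :=
  S.g y - S.F y (U y) + inner ℝ (S.B y (U y)) (w y.1)

theorem integral_slice_sq {U : ℝ × E n → ℝ} {z : H n} {s : ℝ}
    (h : (fun x => U (s, x)) =ᵐ[volume] z) :
    Integrable (fun x => U (s, x) ^ 2) ∧ ∫ x, U (s, x) ^ 2 = ‖z‖ ^ 2 := by
  refine ⟨((memLp_congr_ae h).2 (Lp.memLp z)).integrable_sq, ?_⟩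
  rw [← real_inner_self_eq_norm_sq, L2.inner_def]
  refine integral_congr_ae ?_
  filter_upwards [h] with x hx
  simp [hx, sq]

/-- An integrable weight in time times a quadratic expression in `φ` and `U` is integrable, because
the slices in space of the latter are bounded in `L¹`. -/
theorem integrable_weight_mul {U : ℝ × E n → ℝ} {Z : ℝ → H n} (hU : StronglyMeasurable U)
    (hZ : Continuous Z) (hs : ∀ s, (fun x => U (s, x)) =ᵐ[volume] Z s) {a : ℝ → ℝ}
    (ha : Integrable a (volume.restrict (Set.Icc 0 T))) (ha0 : ∀ s, 0 ≤ a s) {c d : ℝ}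
    (hc : 0 ≤ c) (hd : 0 ≤ d) :
    Integrable (fun y : ℝ × E n => a y.1 * (c * S.φ y ^ 2 + d * U y ^ 2)) (slab n T) ∧
      ∀ s ∈ Set.Icc 0 T, ∫ x, a s * (c * S.φ (s, x) ^ 2 + d * U (s, x) ^ 2)
        ≤ a s * (c * S.C + d * ‖Z s‖ ^ 2) := by
  have hint : ∀ s ∈ Set.Icc 0 T,
      Integrable fun x => a s * (c * S.φ (s, x) ^ 2 + d * U (s, x) ^ 2) := fun s hs' =>
    (((S.φ_int s hs').1.const_mul c).add ((integral_slice_sq (hs s)).1.const_mul d)).const_mul _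
  have hle : ∀ s ∈ Set.Icc 0 T, ∫ x, a s * (c * S.φ (s, x) ^ 2 + d * U (s, x) ^ 2)
        ≤ a s * (c * S.C + d * ‖Z s‖ ^ 2) := by
    intro s hs'
    rw [integral_const_mul, integral_add ((S.φ_int s hs').1.const_mul c)
      ((integral_slice_sq (hs s)).1.const_mul d), integral_const_mul, integral_const_mul,
      (integral_slice_sq (hs s)).2]
    have := mul_le_mul_of_nonneg_left (S.φ_int s hs').2 hc
    exact mul_le_mul_of_nonneg_left (by linarith) (ha0 s)
  refine ⟨?_, hle⟩
  have hmeas : AEStronglyMeasurable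
      (fun y : ℝ × E n => a y.1 * (c * S.φ y ^ 2 + d * U y ^ 2)) (slab n T) :=
    (ha.1.comp_fst).mul
      (((S.φ_meas.pow 2).const_mul c).add ((hU.pow 2).const_mul d)).aestronglyMeasurable
  refine (integrable_prod_iff hmeas).2 ⟨?_, ?_⟩
  · filter_upwards [ae_restrict_mem measurableSet_Icc] with s hs'
    exact hint s hs'
  · obtain ⟨M, hM⟩ := isCompact_Icc.exists_bound_of_continuousOn
      (s := Set.Icc 0 T) (hZ.norm.pow 2).continuousOn
    refine (ha.mul_const (c * S.C + d * M)).mono' hmeas.norm.integral_prod_right' ?_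
    filter_upwards [ae_restrict_mem measurableSet_Icc] with s hs'
    rw [Real.norm_of_nonneg (integral_nonneg fun x => norm_nonneg _)]
    have e : ∀ x, ‖a s * (c * S.φ (s, x) ^ 2 + d * U (s, x) ^ 2)‖
        = a s * (c * S.φ (s, x) ^ 2 + d * U (s, x) ^ 2) := fun x =>
      Real.norm_of_nonneg (mul_nonneg (ha0 s) (by positivity))
    simp only [e]
    refine (hle s hs').trans (mul_le_mul_of_nonneg_left ?_ (ha0 s))
    have : ‖Z s‖ ^ 2 ≤ M := (le_abs_self _).trans (hM s hs')
    have := mul_le_mul_of_nonneg_left this hd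
    linarith

theorem memLp_noise {U : ℝ × E n → ℝ} {Z : ℝ → H n} (hU : StronglyMeasurable U)
    (hZ : Continuous Z) (hs : ∀ s, (fun x => U (s, x)) =ᵐ[volume] Z s) {w : ℝ → Ell2}
    (hw : MemLp w 2 (volume.restrict (Set.Icc 0 T))) :
    MemLp (fun y => inner ℝ (S.B y (U y)) (w y.1)) 2 (slab n T) := by
  have hm : AEStronglyMeasurable (fun y => inner ℝ (S.B y (U y)) (w y.1)) (slab n T) :=
    (S.B_meas U hU).inner hw.1.comp_fst
  rw [memLp_two_iff_integrable_sq hm]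
  have h1 := (S.integrable_weight_mul hU hZ hs (a := fun s => ‖w s‖ ^ 2) (c := 2)
    (d := 2 * S.C ^ 2) ((memLp_two_iff_integrable_sq_norm hw.1).1 hw) (fun s => sq_nonneg _)
    (by norm_num) (by positivity)).1
  refine h1.mono' (hm.pow 2) (ae_of_all _ fun y => ?_)
  rw [Real.norm_of_nonneg (sq_nonneg _), ← sq_abs]
  have h2 : |inner ℝ (S.B y (U y)) (w y.1)| ≤ (S.φ y + S.C * |U y|) * ‖w y.1‖ :=
    (abs_real_inner_le_norm _ _).trans
      (mul_le_mul_of_nonneg_right (S.B_growth y (U y)) (norm_nonneg _))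
  refine (pow_le_pow_left₀ (abs_nonneg _) h2 2).trans ?_
  rw [mul_pow, mul_comm]
  refine mul_le_mul_of_nonneg_left ?_ (sq_nonneg _)
  rw [← sq_abs (U y)]
  nlinarith [sq_nonneg (S.φ y - S.C * |U y|)]

/-- Where `|U| ≤ 1` the drift is bounded by a multiple of `|U|`, elsewhere by one of `|U|^{p-1}`. -/
theorem memSumLp_drift {U : ℝ × E n → ℝ} (hU : StronglyMeasurable U)
    (hU2 : MemLp U 2 (slab n T)) (hUp : MemLp U (ENNReal.ofReal p) (slab n T)) :
    MemSumLp n T p (fun y => S.F y (U y)) := by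
  have hp := S.two_lt
  have hFm : StronglyMeasurable fun y => S.F y (U y) :=
    S.F_cont.comp_stronglyMeasurable (stronglyMeasurable_id.prodMk hU)
  have hset : MeasurableSet {y | |U y| ≤ 1} := measurableSet_le hU.norm.measurable measurable_const
  refine ⟨{y | |U y| ≤ 1}.indicator fun y => S.F y (U y),
    {y | |U y| ≤ 1}ᶜ.indicator fun y => S.F y (U y), ?_, ?_, fun y => ?_⟩
  · refine (hU2.const_mul (2 * S.C)).mono (hFm.indicator hset).aestronglyMeasurable ?_
    filter_upwards [S.F_growth] with y hy
    by_cases h : |U y| ≤ 1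
    · rw [Set.indicator_of_mem (by exact h), Real.norm_eq_abs, Real.norm_eq_abs, abs_mul,
        abs_of_nonneg (mul_nonneg zero_le_two S.C_nonneg)]
      refine (hy _).trans ?_
      have : |U y| ^ (p - 1) ≤ |U y| ^ (1 : ℝ) :=
        Real.rpow_le_rpow_of_exponent_ge' (abs_nonneg _) h zero_le_one (by linarith)
      rw [Real.rpow_one] at this
      nlinarith [S.C_nonneg]
    · rw [Set.indicator_of_notMem (by exact h), norm_zero]
      exact norm_nonneg _
  · have hpow : MemLp (fun y => ‖U y‖ ^ (p - 1)) (ENNReal.ofReal p.conjExponent) (slab n T) := by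
      have := hUp.norm_rpow_div (ENNReal.ofReal (p - 1))
      rw [← ENNReal.ofReal_div_of_pos (by linarith), ENNReal.toReal_ofReal (by linarith)] at this
      exact this
    refine (hpow.const_mul (2 * S.C)).mono (hFm.indicator hset.compl).aestronglyMeasurable ?_
    filter_upwards [S.F_growth] with y hy
    by_cases h : |U y| ≤ 1
    · rw [Set.indicator_of_notMem (by simpa using h), norm_zero]
      exact norm_nonneg _
    · rw [Set.indicator_of_mem (by exact h), Real.norm_eq_abs, Real.norm_eq_abs, abs_mul,
        abs_of_nonneg (mul_nonneg zero_le_two S.C_nonneg), Real.norm_eq_abs,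
        abs_of_nonneg (by positivity : 0 ≤ |U y| ^ (p - 1))]
      refine (hy _).trans ?_
      push Not at h
      have : |U y| ^ (1 : ℝ) ≤ |U y| ^ (p - 1) :=
        Real.rpow_le_rpow_of_exponent_le h.le (by linarith)
      rw [Real.rpow_one] at this
      nlinarith [S.C_nonneg]
  · by_cases h : |U y| ≤ 1 <;> simp [Set.indicator, h]

theorem memSumLp_of_memLp_two {G : ℝ × E n → ℝ} (h : MemLp G 2 (slab n T)) : MemSumLp n T p G :=
  ⟨G, 0, h, MemLp.zero, fun y => by simp⟩

theorem memSumLp_forcing {U : ℝ × E n → ℝ} {Z : ℝ → H n} (hU : StronglyMeasurable U)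
    (hZ : Continuous Z) (hs : ∀ s, (fun x => U (s, x)) =ᵐ[volume] Z s)
    (hUp : MemLp U (ENNReal.ofReal p) (slab n T)) {w : ℝ → Ell2}
    (hw : MemLp w 2 (volume.restrict (Set.Icc 0 T))) : MemSumLp n T p (S.forcing U w) :=
  ((memSumLp_of_memLp_two S.g_mem).sub
    (S.memSumLp_drift hU (memLp_two_of_slice hU hZ hs T) hUp)).add
      (memSumLp_of_memLp_two (S.memLp_noise hU hZ hs hw))

end ControlSystem

/-! ### A priori bounds -/

namespace ControlSystem

variable {n : ℕ} {α : Set.Ioo (0 : ℝ) 1} {T p : ℝ} (S : ControlSystem n T p)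

theorem integrable_abs_rpow {U : ℝ × E n → ℝ} (hp : 0 < p) {m : Measure (ℝ × E n)}
    (hUp : MemLp U (ENNReal.ofReal p) m) : Integrable (fun y => |U y| ^ p) m := by
  have := (integrable_norm_rpow_iff hUp.1 (by simpa using hp) ENNReal.ofReal_ne_top).2 hUp
  simpa only [ENNReal.toReal_ofReal hp.le, Real.norm_eq_abs] using this

/-- The pointwise estimate of forcing times solution: `F` is the value of the drift, `q` stands for
`|U|^p`, `f` for the noise and `b`, `w` for the norms of its coefficient and of the control. -/
theorem two_mul_forcing_mul_le {g F U f φ C b w lam q ψ : ℝ} (hF : lam * q - ψ ≤ F * U)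
    (hb : b ≤ φ + C * |U|) (hf : |f| ≤ b * w) (hw : 0 ≤ w) (hC : 0 ≤ C) :
    2 * ((g - F + f) * U)
      ≤ (g ^ 2 + 2 * |ψ|) - 2 * lam * q + (1 + w) * (1 * φ ^ 2 + (1 + 2 * C) * U ^ 2) := by
  have h1 : f * U ≤ (φ + C * |U|) * w * |U| := by
    calc f * U ≤ |f * U| := le_abs_self _
      _ = |f| * |U| := abs_mul _ _
      _ ≤ (φ + C * |U|) * w * |U| := by
        refine mul_le_mul_of_nonneg_right (hf.trans ?_) (abs_nonneg _)
        exact mul_le_mul_of_nonneg_right hb hw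
  have h2 : 2 * ((φ + C * |U|) * w * |U|) ≤ w * (φ ^ 2 + (1 + 2 * C) * U ^ 2) := by
    have : 2 * ((φ + C * |U|) * |U|) ≤ φ ^ 2 + (1 + 2 * C) * U ^ 2 := by
      rw [← sq_abs U]
      nlinarith [sq_nonneg (φ - |U|)]
    nlinarith
  have h3 := le_abs_self ψ
  have h4 := sq_nonneg (g - U)
  have h5 : 0 ≤ φ ^ 2 + 2 * C * U ^ 2 := by positivity
  nlinarith

variable {S}

theorem memLp_two_kernel (D : ℝ) {w : ℝ → Ell2}
    (hw : MemLp w 2 (volume.restrict (Set.Icc 0 T))) :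
    MemLp (fun s => D * (1 + ‖w s‖)) 2 (volume.restrict (Set.Icc 0 T)) := by
  have h : MemLp (fun s => 1 + ‖w s‖) 2 (volume.restrict (Set.Icc 0 T)) :=
    (memLp_const (1 : ℝ)).add hw.norm
  exact h.const_mul D

theorem memLp_two_of_continuous {f : ℝ → ℝ} (hf : Continuous f) (t : ℝ) :
    MemLp f 2 (volume.restrict (Set.Icc 0 t)) :=
  (memLp_two_iff_integrable_sq hf.aestronglyMeasurable).2 (hf.pow 2).integrableOn_Icc

/-- The energy inequality, with the forcing estimated pointwise by Young's inequality. -/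
theorem energy_le {u₀ : H n} {Z : ℝ → H n} {ZV : ℝ → V n α} {U : ℝ × E n → ℝ} {w : ℝ → Ell2}
    (hw : MemLp w 2 (volume.restrict (Set.Icc 0 T)))
    (hsol : WeakSol T p u₀ Z ZV U (S.forcing U w)) {t : ℝ} (ht : t ∈ Set.Icc 0 T) :
    1 + ‖Z t‖ ^ 2 + 2 * (∫ s in Set.Icc 0 t, fracForm n α (V.toH (ZV s)) (V.toH (ZV s)))
      + 2 * S.lam * (∫ y, |U y| ^ p ∂slab n t)
      ≤ (1 + ‖u₀‖ ^ 2 + ∫ y, (S.g y ^ 2 + 2 * |S.ψ y|) ∂slab n T)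
        + ∫ s in Set.Icc 0 t, (1 + 2 * S.C) * (1 + ‖w s‖) * (1 + ‖Z s‖ ^ 2) := by
  have hT := S.T_pos
  have hp := S.two_lt
  have hC := S.C_nonneg
  have ih₁ : Integrable (fun y => S.g y ^ 2 + 2 * |S.ψ y|) (slab n T) :=
    S.g_mem.integrable_sq.add (S.ψ_int.abs.const_mul 2)
  have hwn : MemLp (fun s => 1 + ‖w s‖) 2 (volume.restrict (Set.Icc 0 T)) :=
    (memLp_const (1 : ℝ)).add hw.norm
  obtain ⟨iW, hW⟩ := S.integrable_weight_mul hsol.meas hsol.cont hsol.slice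
    (a := fun s => 1 + ‖w s‖) (c := 1) (d := 1 + 2 * S.C) (hwn.integrable (by norm_num))
    (fun s => by positivity) zero_le_one (by linarith)
  have hm : volume.restrict (Set.Icc 0 t) ≤ volume.restrict (Set.Icc 0 T) :=
    Measure.restrict_mono (Set.Icc_subset_Icc_right ht.2) le_rfl
  have hms := slab_mono (n := n) ht.2
  have iW' := iW.mono_measure hms
  have iU := (integrable_abs_rpow (by linarith) hsol.memLp).mono_measure hms
  have iGU := (hsol.integrable_force_mul hp).mono_measure hms
  have e1 := hsol.energy hT hp ht
  rw [← integral_prod (fun y => S.forcing U w y * U y) iGU] at e1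
  have e2 : ∫ y, 2 * (S.forcing U w y * U y) ∂slab n t
      ≤ ∫ y, ((S.g y ^ 2 + 2 * |S.ψ y|) - 2 * S.lam * |U y| ^ p
        + (1 + ‖w y.1‖) * (1 * S.φ y ^ 2 + (1 + 2 * S.C) * U y ^ 2)) ∂slab n t := by
    refine integral_mono_ae (iGU.const_mul 2)
      (((ih₁.mono_measure hms).sub (iU.const_mul _)).add iW') ?_
    filter_upwards [ae_mono hms S.F_coercive] with y hy
    exact two_mul_forcing_mul_le (hy (U y)) (S.B_growth y (U y)) (abs_real_inner_le_norm _ _)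
      (norm_nonneg _) hC
  have isub : Integrable (fun y => (S.g y ^ 2 + 2 * |S.ψ y|) - 2 * S.lam * |U y| ^ p)
    (slab n t) := (ih₁.mono_measure hms).sub (iU.const_mul _)
  rw [integral_add isub iW', integral_sub (ih₁.mono_measure hms) (iU.const_mul _),
    integral_const_mul, integral_const_mul] at e2
  have h0 : ∀ y, 0 ≤ S.g y ^ 2 + 2 * |S.ψ y| := fun y => by positivity
  have e3 : ∫ y, (S.g y ^ 2 + 2 * |S.ψ y|) ∂slab n t ≤ ∫ y, (S.g y ^ 2 + 2 * |S.ψ y|) ∂slab n T :=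
    integral_mono_measure hms (ae_of_all _ h0) ih₁
  have e4 : ∫ y, (1 + ‖w y.1‖) * (1 * S.φ y ^ 2 + (1 + 2 * S.C) * U y ^ 2) ∂slab n t
      ≤ ∫ s in Set.Icc 0 t, (1 + 2 * S.C) * (1 + ‖w s‖) * (1 + ‖Z s‖ ^ 2) := by
    rw [integral_prod _ iW']
    refine integral_mono_ae iW'.integral_prod_left ?_ ?_
    · exact ((memLp_two_kernel (1 + 2 * S.C) hw).mono_measure hm).integrable_mul
        (memLp_two_of_continuous (continuous_const.add (hsol.cont.norm.pow 2)) t)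
    · filter_upwards [ae_restrict_mem measurableSet_Icc] with s hs
      refine (hW s ⟨hs.1, hs.2.trans ht.2⟩).trans ?_
      have e : (1 + 2 * S.C) * (1 + ‖w s‖) * (1 + ‖Z s‖ ^ 2)
          = (1 + ‖w s‖) * ((1 + 2 * S.C) * (1 + ‖Z s‖ ^ 2)) := by ring
      rw [e]
      exact mul_le_mul_of_nonneg_left (by linarith) (by positivity)
  linarith

/-- The summand `1` makes the bound positive, as Grönwall's inequality requires. -/
theorem integral_kernel_sq_le {D K : ℝ} (hT : 0 ≤ T) {w : ℝ → Ell2}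
    (hw : MemLp w 2 (volume.restrict (Set.Icc 0 T)))
    (hwK : ∫ s in Set.Icc 0 T, ‖w s‖ ^ 2 ≤ K) :
    ∫ s in Set.Icc 0 T, (D * (1 + ‖w s‖)) ^ 2 ≤ D ^ 2 * (2 * T + 2 * |K|) + 1 := by
  have hwn : MemLp (fun s => ‖w s‖) 2 (volume.restrict (Set.Icc 0 T)) := hw.norm
  have ha1 : MemLp (fun s => D * (1 + ‖w s‖)) 2 (volume.restrict (Set.Icc 0 T)) :=
    memLp_two_kernel D hw
  have e1 : ∫ s in Set.Icc 0 T, (D * (1 + ‖w s‖)) ^ 2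
      ≤ ∫ s in Set.Icc 0 T, D ^ 2 * (2 + 2 * ‖w s‖ ^ 2) := by
    refine integral_mono ha1.integrable_sq
      (((integrable_const 2).add (hwn.integrable_sq.const_mul 2)).const_mul (D ^ 2)) fun s => ?_
    simp only [mul_pow]
    refine mul_le_mul_of_nonneg_left ?_ (sq_nonneg D)
    nlinarith [sq_nonneg (1 - ‖w s‖)]
  rw [integral_const_mul, integral_add (integrable_const 2) (hwn.integrable_sq.const_mul 2),
    integral_const_mul] at e1
  simp only [integral_const, measureReal_restrict_apply_univ, Real.volume_real_Icc, sub_zero,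
    smul_eq_mul, max_eq_left hT] at e1
  have e2 := le_abs_self K
  have e3 : D ^ 2 * (T * 2 + 2 * ∫ s in Set.Icc 0 T, ‖w s‖ ^ 2)
      ≤ D ^ 2 * (2 * T + 2 * |K|) := mul_le_mul_of_nonneg_left (by linarith) (sq_nonneg D)
  linarith

/-- A priori bounds, uniform over the controls in a ball. -/
theorem exists_bound (S : ControlSystem n T p) (α : Set.Ioo (0 : ℝ) 1) (u₀ : H n) (K : ℝ) :
    ∃ R, 0 ≤ R ∧ ∀ (Z : ℝ → H n) (ZV : ℝ → V n α) (U : ℝ × E n → ℝ) (w : ℝ → Ell2),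
      MemLp w 2 (volume.restrict (Set.Icc 0 T)) → ∫ s in Set.Icc 0 T, ‖w s‖ ^ 2 ≤ K →
      WeakSol T p u₀ Z ZV U (S.forcing U w) →
      (∀ t ∈ Set.Icc 0 T, ‖Z t‖ ^ 2 ≤ R) ∧
        ∫ s in Set.Icc 0 T, fracForm n α (V.toH (ZV s)) (V.toH (ZV s)) ≤ R ∧
        ∫ y, |U y| ^ p ∂slab n T ≤ R := by
  have hT := S.T_pos
  have hC := S.C_nonneg
  have hlam := S.lam_pos
  obtain ⟨D, hD⟩ : ∃ D, D = 1 + 2 * S.C := ⟨_, rfl⟩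
  have hD1 : 1 ≤ D := by linarith
  obtain ⟨K', hK'⟩ : ∃ K', K' = D ^ 2 * (2 * T + 2 * |K|) + 1 := ⟨_, rfl⟩
  have hK'0 : 0 < K' := by rw [hK']; positivity
  obtain ⟨A, hA⟩ : ∃ A, A = 1 + ‖u₀‖ ^ 2 + ∫ y, (S.g y ^ 2 + 2 * |S.ψ y|) ∂slab n T := ⟨_, rfl⟩
  have hA0 : 0 ≤ A := by
    have : 0 ≤ ∫ y, (S.g y ^ 2 + 2 * |S.ψ y|) ∂slab n T := integral_nonneg fun y => by positivity
    rw [hA]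
    positivity
  obtain ⟨M, hM⟩ : ∃ M, M = 2 * A * Real.exp (2 * K' * T) := ⟨_, rfl⟩
  have hM0 : 0 ≤ M := by rw [hM]; positivity
  obtain ⟨R₀, hR₀⟩ : ∃ R₀, R₀ = A + M * (T + K') := ⟨_, rfl⟩
  have hR₀0 : 0 ≤ R₀ := by rw [hR₀]; positivity
  refine ⟨M + R₀ / 2 + R₀ / (2 * S.lam), by positivity, fun Z ZV U w hw hwK hsol => ?_⟩
  have ha2 : MemLp (fun s => D * (1 + ‖w s‖)) 2 (volume.restrict (Set.Icc 0 T)) :=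
    memLp_two_kernel D hw
  have haK := integral_kernel_sq_le (D := D) hT.le hw hwK
  rw [← hK'] at haK
  have main := fun t (ht : t ∈ Set.Icc 0 T) => energy_le hw hsol ht
  rw [← hA, ← hD] at main
  have hform : ∀ t, 0 ≤ ∫ s in Set.Icc 0 t, fracForm n α (V.toH (ZV s)) (V.toH (ZV s)) :=
    fun t => integral_nonneg fun s => fracForm_self_nonneg _
  have hpow : ∀ t, 0 ≤ ∫ y, |U y| ^ p ∂slab n t := fun t => integral_nonneg fun y => by positivity
  have hpow' : ∀ t, 0 ≤ 2 * S.lam * ∫ y, |U y| ^ p ∂slab n t := fun t =>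
    mul_nonneg (by positivity) (hpow t)
  have hZ : ∀ t ∈ Set.Icc 0 T, 1 + ‖Z t‖ ^ 2 ≤ M := by
    rw [hM]
    refine gronwall_sq_integrable (y := fun s => 1 + ‖Z s‖ ^ 2) hT.le hK'0 ha2
      (fun s => by positivity) haK (continuous_const.add (hsol.cont.norm.pow 2))
      (fun s => by positivity) hA0 fun t ht => ?_
    have h1 := main t ht
    have h2 := hform t
    have h3 := hpow' t
    linarith
  have hT' : T ∈ Set.Icc 0 T := ⟨hT.le, le_rfl⟩
  have hlast : ∫ s in Set.Icc 0 T, D * (1 + ‖w s‖) * (1 + ‖Z s‖ ^ 2) ≤ M * (T + K') := by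
    have e1 : ∫ s in Set.Icc 0 T, D * (1 + ‖w s‖) * (1 + ‖Z s‖ ^ 2)
        ≤ ∫ s in Set.Icc 0 T, M * (1 + (D * (1 + ‖w s‖)) ^ 2) := by
      refine integral_mono_ae (ha2.integrable_mul (memLp_two_of_continuous
        (continuous_const.add (hsol.cont.norm.pow 2)) T))
        (((integrable_const 1).add ha2.integrable_sq).const_mul M) ?_
      filter_upwards [ae_restrict_mem measurableSet_Icc] with s hs
      have h1 := hZ s hs
      have h2 : 0 ≤ D * (1 + ‖w s‖) := by positivity
      have h3 : D * (1 + ‖w s‖) ≤ 1 + (D * (1 + ‖w s‖)) ^ 2 := by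
        nlinarith [sq_nonneg (D * (1 + ‖w s‖) - 1)]
      calc D * (1 + ‖w s‖) * (1 + ‖Z s‖ ^ 2) ≤ D * (1 + ‖w s‖) * M :=
            mul_le_mul_of_nonneg_left h1 h2
        _ ≤ (1 + (D * (1 + ‖w s‖)) ^ 2) * M := mul_le_mul_of_nonneg_right h3 hM0
        _ = _ := mul_comm _ _
    rw [integral_const_mul, integral_add (integrable_const 1) ha2.integrable_sq] at e1
    simp only [integral_const, measureReal_restrict_apply_univ, Real.volume_real_Icc, sub_zero,
      smul_eq_mul, max_eq_left hT.le, mul_one] at e1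
    refine e1.trans (mul_le_mul_of_nonneg_left (by linarith) hM0)
  have hfin := main T hT'
  have f1 := hform T
  have f2 := hpow' T
  have f3 := sq_nonneg ‖Z T‖
  have g1 : 0 ≤ R₀ / 2 := by positivity
  have g2 : 0 ≤ R₀ / (2 * S.lam) := by positivity
  refine ⟨fun t ht => ?_, ?_, ?_⟩
  · have := hZ t ht
    linarith
  · linarith
  · have : ∫ y, |U y| ^ p ∂slab n T ≤ R₀ / (2 * S.lam) := by
      rw [le_div_iff₀ (by positivity)]
      linarith
    linarith

end ControlSystem

/-! ### Subsequences that are weakly Cauchy at almost every time -/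

section WeakCompactness

variable {𝓗 : Type*} [NormedAddCommGroup 𝓗] [InnerProductSpace ℝ 𝓗]

/-- The vectors against which a bounded sequence of a Hilbert space is weakly Cauchy form a closed
subspace. -/
theorem cauchySeq_inner_of_mem_closure_span {z : ℕ → 𝓗} {M : ℝ} (hz : ∀ k, ‖z k‖ ≤ M) {D : Set 𝓗}
    (hD : ∀ ξ ∈ D, CauchySeq fun k => (inner ℝ ξ (z k) : ℝ)) {φ : 𝓗}
    (hφ : φ ∈ closure (Submodule.span ℝ D : Set 𝓗)) :
    CauchySeq fun k => (inner ℝ φ (z k) : ℝ) := by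
  have hM : 0 ≤ M := (norm_nonneg _).trans (hz 0)
  have hspan : ∀ ξ ∈ Submodule.span ℝ D, CauchySeq fun k => (inner ℝ ξ (z k) : ℝ) := by
    intro ξ hξ
    induction hξ using Submodule.span_induction with
    | mem x hx => exact hD x hx
    | zero => simpa using cauchySeq_const (0 : ℝ)
    | add x y _ _ hx hy =>
      simp only [inner_add_left]
      exact hx.add hy
    | smul a x _ hx =>
      simp only [real_inner_smul_left]
      exact (uniformContinuous_const_smul a).comp_cauchySeq hx
  rw [Metric.cauchySeq_iff]
  intro ε hε
  obtain ⟨ξ, hξ, hdist⟩ := Metric.mem_closure_iff.1 hφ (ε / (4 * (M + 1))) (by positivity)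
  obtain ⟨N, hN⟩ := Metric.cauchySeq_iff.1 (hspan ξ hξ) (ε / 2) (by positivity)
  refine ⟨N, fun k hk m hm => ?_⟩
  have h1 := hN k hk m hm
  rw [Real.dist_eq] at h1 ⊢
  have h2 : ∀ j, |inner ℝ φ (z j) - inner ℝ ξ (z j)| ≤ ε / 4 := by
    intro j
    rw [← inner_sub_left]
    refine (abs_real_inner_le_norm _ _).trans ?_
    rw [← dist_eq_norm]
    calc dist φ ξ * ‖z j‖ ≤ ε / (4 * (M + 1)) * M :=
          mul_le_mul hdist.le (hz j) (norm_nonneg _) (by positivity)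
      _ ≤ ε / (4 * (M + 1)) * (M + 1) := by gcongr; linarith
      _ = ε / 4 := by field_simp
  have h3 := h2 k
  have h4 := h2 m
  rw [abs_le] at h3 h4
  rw [abs_lt] at h1 ⊢
  constructor <;> linarith

/-- A diagonal sequence, by compactness of a countable product of intervals. -/
theorem exists_subseq_cauchySeq_inner {ι : Type*} [Countable ι] {a : ℕ → ι → ℝ} {b : ι → ℝ}
    (h : ∀ k i, |a k i| ≤ b i) :
    ∃ ns : ℕ → ℕ, StrictMono ns ∧ ∀ i, CauchySeq fun k => a (ns k) i := by
  have hc : IsCompact (Set.univ.pi fun i => Set.Icc (-b i) (b i)) :=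
    isCompact_univ_pi fun i => isCompact_Icc
  obtain ⟨l, -, ns, hns, hl⟩ := hc.tendsto_subseq (x := a)
    (fun k i _ => abs_le.1 (h k i))
  exact ⟨ns, hns, fun i => (tendsto_pi_nhds.1 hl i).cauchySeq⟩

/-- Let the functions `Z k : [0,T] → 𝓗` be bounded, let `(Z k, ξ)` be equicontinuous for `ξ ∈ D`,
and let `Z k` take values in `D` at almost every time. Then a subsequence is weakly Cauchy at
almost every time. It is not required that `D` be dense: on the orthogonal complement of the span
of `D` the functions vanish. -/
theorem exists_subseq_weakly_cauchy [CompleteSpace 𝓗] [SecondCountableTopology 𝓗] {T : ℝ}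
    (hT : 0 ≤ T) {Z : ℕ → ℝ → 𝓗} {M : ℝ} (hM : ∀ k, ∀ t ∈ Set.Icc 0 T, ‖Z k t‖ ≤ M) {D : Set 𝓗}
    (hD : ∀ ξ ∈ D, ∀ η > 0, ∃ c, 0 ≤ c ∧ ∀ k, ∀ r ∈ Set.Icc 0 T, ∀ t ∈ Set.Icc 0 T,
      |(inner ℝ (Z k t - Z k r) ξ : ℝ)| ≤ η + c * |t - r|)
    (hZD : ∀ k, ∀ᵐ s ∂volume.restrict (Set.Icc 0 T), Z k s ∈ D) :
    ∃ ns : ℕ → ℕ, StrictMono ns ∧ ∀ᵐ s ∂volume.restrict (Set.Icc 0 T), ∀ φ : 𝓗,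
      CauchySeq fun k => (inner ℝ φ (Z (ns k) s) : ℝ) := by
  obtain ⟨D₀, hD₀D, hD₀c, hD₀⟩ :=
    (TopologicalSpace.IsSeparable.of_separableSpace D).exists_countable_dense_subset
  have : Countable D₀ := hD₀c
  have hproj : ∀ q : ℚ, (Set.projIcc 0 T hT (q : ℝ) : ℝ) ∈ Set.Icc 0 T := fun q =>
    (Set.projIcc 0 T hT (q : ℝ)).2
  obtain ⟨ns, hns, hC⟩ := exists_subseq_cauchySeq_inner (ι := D₀ × ℚ)
    (a := fun k i => inner ℝ (i.1 : 𝓗) (Z k (Set.projIcc 0 T hT (i.2 : ℝ))))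
    (b := fun i => ‖(i.1 : 𝓗)‖ * M) fun k i => (abs_real_inner_le_norm _ _).trans
      (mul_le_mul_of_nonneg_left (hM k _ (hproj i.2)) (norm_nonneg _))
  refine ⟨ns, hns, ?_⟩
  -- by equicontinuity, convergence at rational times gives convergence at all times
  have hD₀all : ∀ t ∈ Set.Icc 0 T, ∀ ξ ∈ D₀, CauchySeq fun k => (inner ℝ ξ (Z (ns k) t) : ℝ) := by
    intro t ht ξ hξ
    rw [Metric.cauchySeq_iff]
    intro ε hε
    obtain ⟨c, hc, hcZ⟩ := hD ξ (hD₀D hξ) (ε / 8) (by positivity)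
    obtain ⟨q, hq1, hq2⟩ := exists_rat_btwn (show t - ε / (8 * (c + 1)) < t by
      have : 0 < ε / (8 * (c + 1)) := by positivity
      linarith)
    obtain ⟨N, hN⟩ := Metric.cauchySeq_iff.1 (hC (⟨ξ, hξ⟩, q)) (ε / 2) (by positivity)
    refine ⟨N, fun k hk m hm => ?_⟩
    have h1 := hN k hk m hm
    have hdist : |t - Set.projIcc 0 T hT (q : ℝ)| ≤ ε / (8 * (c + 1)) := by
      have hp1 : (Set.projIcc 0 T hT (q : ℝ) : ℝ) = max 0 (min T q) := rfl
      rw [hp1, min_eq_right (hq2.le.trans ht.2), abs_le]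
      constructor
      · have : max 0 (q : ℝ) ≤ t := max_le ht.1 hq2.le
        have : 0 < ε / (8 * (c + 1)) := by positivity
        linarith
      · have := le_max_right 0 (q : ℝ)
        linarith
    have h2 : ∀ j, |inner ℝ ξ (Z (ns j) t) - inner ℝ ξ (Z (ns j) (Set.projIcc 0 T hT (q : ℝ)))|
        ≤ ε / 8 + ε / 8 := by
      intro j
      rw [← inner_sub_right, real_inner_comm]
      refine (hcZ (ns j) _ (hproj q) t ht).trans ?_
      have : c * |t - Set.projIcc 0 T hT (q : ℝ)| ≤ (c + 1) * (ε / (8 * (c + 1))) :=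
        mul_le_mul (by linarith) hdist (abs_nonneg _) (by positivity)
      have e : (c + 1) * (ε / (8 * (c + 1))) = ε / 8 := by field_simp
      linarith
    have h3 := h2 k
    have h4 := h2 m
    rw [Real.dist_eq] at h1 ⊢
    rw [abs_le] at h3 h4
    rw [abs_lt] at h1 ⊢
    constructor <;> linarith
  filter_upwards [ae_all_iff.2 hZD, ae_restrict_mem measurableSet_Icc] with s hs hsT φ
  -- only the projection of `φ` to the closed span of `D` matters
  set W := (Submodule.span ℝ D₀).topologicalClosure with hW
  have hWc : (W : Set 𝓗) = closure (Submodule.span ℝ D₀ : Set 𝓗) :=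
    Submodule.topologicalClosure_coe _
  have hcW : CompleteSpace W := (Submodule.isClosed_topologicalClosure _).completeSpace_coe
  have hDW : ∀ z ∈ D, z ∈ W := fun z hz => by
    rw [← SetLike.mem_coe, hWc]
    exact closure_mono Submodule.subset_span (hD₀ hz)
  have hproj : ∀ k, (inner ℝ φ (Z (ns k) s) : ℝ) = inner ℝ (W.starProjection φ) (Z (ns k) s) := by
    intro k
    rw [Submodule.inner_starProjection_left_eq_right,
      Submodule.starProjection_eq_self_iff.2 (hDW _ (hs (ns k)))]
  simp only [hproj]
  refine cauchySeq_inner_of_mem_closure_span (M := M) (D := D₀) (fun k => hM _ s hsT)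
    (hD₀all s hsT) ?_
  rw [← hWc]
  exact Submodule.starProjection_apply_mem W φ

end WeakCompactness

/-! ### Equicontinuity in time -/

/-- Young's inequality for the exponents `p` and `p/(p-1)`, with a small factor. -/
theorem rpow_sub_one_mul_le {p η a b : ℝ} (hp : 1 < p) (hη : 0 < η) (ha : 0 ≤ a) (hb : 0 ≤ b) :
    a ^ (p - 1) * b ≤ η * a ^ p + η ^ (1 - p) * b ^ p := by
  have ha' : 0 ≤ a ^ p := Real.rpow_nonneg ha _
  have hb' : 0 ≤ b ^ p := Real.rpow_nonneg hb _
  have hη' : 0 ≤ η ^ (1 - p) := Real.rpow_nonneg hη.le _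
  rcases le_or_gt b (η * a) with h | h
  · rcases ha.eq_or_lt with rfl | ha0
    · rw [Real.zero_rpow (by linarith), zero_mul]
      positivity
    · have : a ^ (p - 1) * b ≤ a ^ (p - 1) * (η * a) :=
        mul_le_mul_of_nonneg_left h (Real.rpow_nonneg ha _)
      have e : a ^ (p - 1) * a = a ^ p := by
        rw [← Real.rpow_add_one ha0.ne', sub_add_cancel]
      have : a ^ (p - 1) * (η * a) = η * a ^ p := by rw [← e]; ring
      have : 0 ≤ η ^ (1 - p) * b ^ p := mul_nonneg hη' hb'
      linarith
  · have hb0 : 0 < b := lt_of_le_of_lt (mul_nonneg hη.le ha) h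
    have hle : a ≤ b / η := by
      rw [le_div_iff₀ hη]
      linarith
    have h1 : a ^ (p - 1) ≤ (b / η) ^ (p - 1) := Real.rpow_le_rpow ha hle (by linarith)
    have e : (b / η) ^ (p - 1) * b = η ^ (1 - p) * b ^ p := by
      rw [Real.div_rpow hb hη.le, show (1 - p) = -(p - 1) by ring, Real.rpow_neg hη.le,
        div_mul_eq_mul_div, ← Real.rpow_add_one hb0.ne', sub_add_cancel]
      field_simp
    have h2 := mul_le_mul_of_nonneg_right h1 hb
    have : 0 ≤ η * a ^ p := mul_nonneg hη.le ha'
    linarith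

theorem mul_le_young {η a b : ℝ} (hη : 0 < η) : a * b ≤ η * a ^ 2 + η⁻¹ * b ^ 2 := by
  have e : η * a ^ 2 + η⁻¹ * b ^ 2 - a * b
      = η⁻¹ * ((η * a - b / 2) ^ 2 + 3 / 4 * b ^ 2) := by
    field_simp
    ring
  have : 0 ≤ η⁻¹ * ((η * a - b / 2) ^ 2 + 3 / 4 * b ^ 2) := by positivity
  linarith

theorem V.abs_fracForm_le {n : ℕ} {α : Set.Ioo (0 : ℝ) 1} (u w : V n α) :
    |fracForm n α u.toH w.toH| ≤ 2 * ‖u‖ * ‖w‖ := by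
  have h1 := abs_le.1 (abs_real_inner_le_norm u w)
  have h2 := abs_le.1 ((abs_real_inner_le_norm u.toH w.toH).trans
    (mul_le_mul u.norm_toH_le w.norm_toH_le (norm_nonneg _) (norm_nonneg _)))
  rw [V.inner_eq] at h1
  rw [abs_le]
  constructor <;> linarith [h1.1, h1.2, h2.1, h2.2]

namespace ControlSystem

variable {n : ℕ} {α : Set.Ioo (0 : ℝ) 1} {T p : ℝ} (S : ControlSystem n T p)

/-- The energy density that controls the forcing; its integral is bounded by the a priori bounds.
The factors `1` keep the last term in the form of `integrable_weight_mul`. -/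
noncomputable def density (U : ℝ × E n → ℝ) (w : ℝ → Ell2) (y : ℝ × E n) : ℝ :=
  S.g y ^ 2 + U y ^ 2 + |U y| ^ p + ‖w y.1‖ ^ 2 * (1 * S.φ y ^ 2 + 1 * U y ^ 2)

theorem density_nonneg (U : ℝ × E n → ℝ) (w : ℝ → Ell2) (y : ℝ × E n) : 0 ≤ S.density U w y := by
  unfold density
  positivity

/-- The drift, tested with `b`, is small in terms of the energy of `r` up to a multiple of the test
function. This gives equicontinuity, and uniform integrability in the passage to the limit. -/
theorem drift_mul_le {η : ℝ} (hη : 0 < η) : ∃ c, 0 ≤ c ∧ ∀ᵐ y ∂slab n T, ∀ r b : ℝ,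
    |S.F y r * b| ≤ η * (r ^ 2 + |r| ^ p) + c * (b ^ 2 + |b| ^ p) := by
  have hC := S.C_nonneg
  have hp := S.two_lt
  refine ⟨η⁻¹ * S.C ^ 2 + η ^ (1 - p) * S.C ^ p, by positivity, ?_⟩
  filter_upwards [S.F_growth] with y hy r b
  have hq1 : 0 ≤ η⁻¹ * S.C ^ 2 := by positivity
  have hq2 : 0 ≤ η ^ (1 - p) * S.C ^ p := by positivity
  have h1 : |r| * (S.C * |b|) ≤ η * r ^ 2 + η⁻¹ * S.C ^ 2 * b ^ 2 := by
    have := mul_le_young (a := |r|) (b := S.C * |b|) hη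
    rw [sq_abs, mul_pow, sq_abs] at this
    linarith
  have h2 : |r| ^ (p - 1) * (S.C * |b|) ≤ η * |r| ^ p + η ^ (1 - p) * S.C ^ p * |b| ^ p := by
    have := rpow_sub_one_mul_le (p := p) (a := |r|) (b := S.C * |b|) (by linarith) hη
      (abs_nonneg _) (by positivity)
    rw [Real.mul_rpow hC (abs_nonneg _)] at this
    linarith
  have h3 : |S.F y r * b| ≤ |r| * (S.C * |b|) + |r| ^ (p - 1) * (S.C * |b|) := by
    rw [abs_mul]
    have := mul_le_mul_of_nonneg_right (hy r) (abs_nonneg b)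
    linarith
  have h4 : 0 ≤ |b| ^ p := by positivity
  nlinarith [mul_nonneg hq1 h4, mul_nonneg hq2 (sq_nonneg b)]

theorem forcing_mul_le {η : ℝ} (hη : 0 < η) : ∃ c, 0 ≤ c ∧ ∀ (U : ℝ × E n → ℝ) (w : ℝ → Ell2),
    ∀ᵐ y ∂slab n T, ∀ b : ℝ,
      |S.forcing U w y * b| ≤ η * S.density U w y + c * (b ^ 2 + |b| ^ p) := by
  have hC := S.C_nonneg
  obtain ⟨c, hc, hF⟩ := S.drift_mul_le hη
  refine ⟨c + η⁻¹ * (2 + S.C ^ 2), by positivity, fun U w => ?_⟩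
  filter_upwards [hF] with y hy b
  have h1 := hy (U y) b
  have h2 : |S.g y| * |b| ≤ η * S.g y ^ 2 + η⁻¹ * b ^ 2 := by
    have := mul_le_young (a := |S.g y|) (b := |b|) hη
    rwa [sq_abs, sq_abs] at this
  have h3 : ‖w y.1‖ * S.φ y * |b| ≤ η * (‖w y.1‖ ^ 2 * S.φ y ^ 2) + η⁻¹ * b ^ 2 := by
    have := mul_le_young (a := ‖w y.1‖ * S.φ y) (b := |b|) hη
    rwa [sq_abs, mul_pow] at this
  have h4 : ‖w y.1‖ * |U y| * (S.C * |b|)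
      ≤ η * (‖w y.1‖ ^ 2 * U y ^ 2) + η⁻¹ * (S.C ^ 2 * b ^ 2) := by
    have := mul_le_young (a := ‖w y.1‖ * |U y|) (b := S.C * |b|) hη
    rwa [mul_pow, sq_abs, mul_pow, sq_abs] at this
  have h5 : |inner ℝ (S.B y (U y)) (w y.1)| * |b|
      ≤ ‖w y.1‖ * S.φ y * |b| + ‖w y.1‖ * |U y| * (S.C * |b|) := by
    have := mul_le_mul_of_nonneg_right ((abs_real_inner_le_norm (S.B y (U y)) (w y.1)).trans
      (mul_le_mul_of_nonneg_right (S.B_growth y (U y)) (norm_nonneg _))) (abs_nonneg b)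
    linarith
  have h6 : |S.forcing U w y * b| ≤ |S.g y| * |b| + |S.F y (U y) * b|
      + |inner ℝ (S.B y (U y)) (w y.1)| * |b| := by
    rw [forcing, abs_mul, abs_mul, ← add_mul, ← add_mul]
    refine mul_le_mul_of_nonneg_right ?_ (abs_nonneg _)
    exact (abs_add_le _ _).trans (add_le_add (abs_sub _ _) le_rfl)
  have h7 : 0 ≤ η⁻¹ * (2 + S.C ^ 2) * |b| ^ p := by positivity
  simp only [density]
  nlinarith

variable {S}

/-- The number `R` bounds a solution in the energy spaces and its control `w` in `L²(0,T;l²)`. -/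
structure Bounded (T p R : ℝ) (Z : ℝ → H n) (ZV : ℝ → V n α) (U : ℝ × E n → ℝ)
    (w : ℝ → Ell2) : Prop where
  memLp_w : MemLp w 2 (volume.restrict (Set.Icc 0 T))
  control : ∫ s in Set.Icc 0 T, ‖w s‖ ^ 2 ≤ R
  sup : ∀ t ∈ Set.Icc 0 T, ‖Z t‖ ^ 2 ≤ R
  form : ∫ s in Set.Icc 0 T, fracForm n α (V.toH (ZV s)) (V.toH (ZV s)) ≤ R
  pow : ∫ y, |U y| ^ p ∂slab n T ≤ R

theorem integral_sq_slab_le {U : ℝ × E n → ℝ} {Z : ℝ → H n} (hT : 0 ≤ T)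
    (hU : StronglyMeasurable U) (hZ : Continuous Z)
    (hs : ∀ s, (fun x => U (s, x)) =ᵐ[volume] Z s) {R : ℝ}
    (hR : ∀ t ∈ Set.Icc 0 T, ‖Z t‖ ^ 2 ≤ R) : ∫ y, U y ^ 2 ∂slab n T ≤ T * R := by
  rw [integral_prod _ (memLp_two_of_slice hU hZ hs T).integrable_sq]
  simp only [(integral_slice_sq (hs _)).2]
  have : ∫ s in Set.Icc 0 T, ‖Z s‖ ^ 2 ≤ ∫ s in Set.Icc 0 T, R := by
    refine integral_mono_ae ?_ (integrable_const R) ?_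
    · exact (by fun_prop : Continuous fun s => ‖Z s‖ ^ 2).integrableOn_Icc
    · filter_upwards [ae_restrict_mem measurableSet_Icc] with s hs using hR s hs
  simpa [hT] using this

theorem integrable_density {u₀ : H n} {Z : ℝ → H n} {ZV : ℝ → V n α} {U : ℝ × E n → ℝ}
    {w : ℝ → Ell2} {R : ℝ} (hsol : WeakSol T p u₀ Z ZV U (S.forcing U w))
    (hb : Bounded T p R Z ZV U w) :
    Integrable (S.density U w) (slab n T) ∧ ∫ y, S.density U w y ∂slab n T
      ≤ (∫ y, S.g y ^ 2 ∂slab n T) + T * R + R + R * (S.C + R) := by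
  have hT := S.T_pos
  have hp := S.two_lt
  have hC := S.C_nonneg
  have hR : 0 ≤ R := (sq_nonneg _).trans (hb.sup 0 ⟨le_rfl, hT.le⟩)
  have iw : Integrable (fun s => ‖w s‖ ^ 2) (volume.restrict (Set.Icc 0 T)) :=
    (memLp_two_iff_integrable_sq_norm hb.memLp_w.1).1 hb.memLp_w
  obtain ⟨iW, hW⟩ := S.integrable_weight_mul hsol.meas hsol.cont hsol.slice
    (a := fun s => ‖w s‖ ^ 2) (c := 1) (d := 1) iw (fun s => by positivity) zero_le_one zero_le_one
  have i1 : Integrable (fun y => S.g y ^ 2) (slab n T) := S.g_mem.integrable_sq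
  have i2 : Integrable (fun y => U y ^ 2) (slab n T) := hsol.memLp_two.integrable_sq
  have i3 := integrable_abs_rpow (by linarith) hsol.memLp
  have i12 : Integrable (fun y => S.g y ^ 2 + U y ^ 2) (slab n T) := i1.add i2
  have i123 : Integrable (fun y => S.g y ^ 2 + U y ^ 2 + |U y| ^ p) (slab n T) := i12.add i3
  refine ⟨i123.add iW, ?_⟩
  have hWle : ∫ y, ‖w y.1‖ ^ 2 * (1 * S.φ y ^ 2 + 1 * U y ^ 2) ∂slab n T ≤ R * (S.C + R) := by
    rw [integral_prod _ iW]
    calc ∫ s in Set.Icc 0 T, ∫ x, ‖w s‖ ^ 2 * (1 * S.φ (s, x) ^ 2 + 1 * U (s, x) ^ 2)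
        ≤ ∫ s in Set.Icc 0 T, ‖w s‖ ^ 2 * (S.C + R) := by
          refine integral_mono_ae iW.integral_prod_left (iw.mul_const _) ?_
          filter_upwards [ae_restrict_mem measurableSet_Icc] with s hs
          refine (hW s hs).trans (mul_le_mul_of_nonneg_left ?_ (sq_nonneg _))
          have := hb.sup s hs
          linarith
      _ ≤ R * (S.C + R) := by
          rw [integral_mul_const]
          exact mul_le_mul_of_nonneg_right hb.control (by linarith)
  have h2 := integral_sq_slab_le hT.le hsol.meas hsol.cont hsol.slice hb.sup
  have h3 := hb.pow
  simp only [density]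
  rw [integral_add i123 iW, integral_add i12 i3, integral_add i1 i2]
  linarith

theorem integral_norm_sq_le {u₀ : H n} {Z : ℝ → H n} {ZV : ℝ → V n α} {U G : ℝ × E n → ℝ}
    {w : ℝ → Ell2} {R : ℝ} (hT : 0 ≤ T) (hsol : WeakSol T p u₀ Z ZV U G)
    (hb : Bounded T p R Z ZV U w) : ∫ s in Set.Icc 0 T, ‖ZV s‖ ^ 2 ≤ T * R + R := by
  have e : ∫ s in Set.Icc 0 T, ‖ZV s‖ ^ 2 = ∫ s in Set.Icc 0 T,
      (‖Z s‖ ^ 2 + fracForm n α (V.toH (ZV s)) (V.toH (ZV s))) := by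
    refine integral_congr_ae ?_
    filter_upwards [hsol.ae_eq] with s hs
    rw [V.norm_sq_eq, hs]
  have i1 : Integrable (fun s => ‖Z s‖ ^ 2) (volume.restrict (Set.Icc 0 T)) :=
    (hsol.cont.norm.pow 2).integrableOn_Icc
  rw [e, integral_add i1 (integrable_fracForm hsol.memV hsol.memV)]
  have : ∫ s in Set.Icc 0 T, ‖Z s‖ ^ 2 ≤ ∫ s in Set.Icc 0 T, R := by
    refine integral_mono_ae i1 (integrable_const R) ?_
    filter_upwards [ae_restrict_mem measurableSet_Icc] with s hs using hb.sup s hs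
  simp only [integral_const, measureReal_restrict_apply_univ, Real.volume_real_Icc, sub_zero,
    smul_eq_mul, max_eq_left hT] at this
  linarith [hb.form]

/-- Equicontinuity in time of the solutions, tested with elements of `V ∩ L^p`. -/
theorem exists_modulus (S : ControlSystem n T p) (u₀ : H n) (R : ℝ) {ξ : V n α}
    (hξ : MemLp (V.toH ξ) (ENNReal.ofReal p) volume) {η : ℝ} (hη : 0 < η) :
    ∃ c, 0 ≤ c ∧ ∀ (Z : ℝ → H n) (ZV : ℝ → V n α) (U : ℝ × E n → ℝ) (w : ℝ → Ell2),
      WeakSol T p u₀ Z ZV U (S.forcing U w) → Bounded T p R Z ZV U w →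
      ∀ r ∈ Set.Icc 0 T, ∀ t ∈ Set.Icc 0 T,
        |(inner ℝ (Z t - Z r) (V.toH ξ) : ℝ)| ≤ η + c * |t - r| := by
  have hT := S.T_pos
  have hp := S.two_lt
  obtain ⟨R', hR'⟩ : ∃ R', R' = (T * R + R)
      + ((∫ y, S.g y ^ 2 ∂slab n T) + T * R + R + R * (S.C + R)) := ⟨_, rfl⟩
  obtain ⟨η', hη', hη'R⟩ : ∃ η', 0 < η' ∧ η' * R' ≤ η := by
    refine ⟨η / (|R'| + 1), by positivity, ?_⟩
    rw [div_mul_eq_mul_div, div_le_iff₀ (by positivity)]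
    exact mul_le_mul_of_nonneg_left (by linarith [le_abs_self R']) hη.le
  obtain ⟨c, hc, hforce⟩ := S.forcing_mul_le hη'
  have iξ2 : Integrable (fun x => V.toH ξ x ^ 2) := (Lp.memLp (V.toH ξ)).integrable_sq
  have iξp : Integrable (fun x => |V.toH ξ x| ^ p) := by
    have := (integrable_norm_rpow_iff hξ.1 (by simpa using by linarith)
      ENNReal.ofReal_ne_top).2 hξ
    simpa only [ENNReal.toReal_ofReal (show 0 ≤ p by linarith), Real.norm_eq_abs] using this
  have iξ : Integrable (fun x => V.toH ξ x ^ 2 + |V.toH ξ x| ^ p) := iξ2.add iξp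
  obtain ⟨cξ, hcξ⟩ : ∃ cξ, cξ = ∫ x, (V.toH ξ x ^ 2 + |V.toH ξ x| ^ p) := ⟨_, rfl⟩
  have hcξ0 : 0 ≤ cξ := by rw [hcξ]; exact integral_nonneg fun x => by positivity
  refine ⟨η'⁻¹ * (2 * ‖ξ‖) ^ 2 + c * cξ, by positivity,
    fun Z ZV U w hsol hb => ?_⟩
  obtain ⟨iD, hD⟩ := integrable_density hsol hb
  have hV := integral_norm_sq_le hT.le hsol hb
  have iV : Integrable (fun s => ‖ZV s‖ ^ 2) (volume.restrict (Set.Icc 0 T)) :=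
    (memLp_two_iff_integrable_sq_norm hsol.memV.1).1 hsol.memV
  have iG := hsol.force.integrable_mul_test hp (Lp.memLp (V.toH ξ)) hξ
  set k : ℝ := η'⁻¹ * (2 * ‖ξ‖) ^ 2 + c * cξ with hk
  -- the derivative of `(Z, ξ)` is small plus bounded
  have hpt : ∀ᵐ s ∂volume.restrict (Set.Icc 0 T), |testForce ZV (S.forcing U w) ξ s|
      ≤ η' * (‖ZV s‖ ^ 2 + ∫ x, S.density U w (s, x)) + k := by
    filter_upwards [Measure.ae_ae_of_ae_prod (hforce U w), iD.prod_right_ae, iG.prod_right_ae]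
      with s h1 h2 h3
    have e1 : |fracForm n α (V.toH (ZV s)) (V.toH ξ)|
        ≤ η' * ‖ZV s‖ ^ 2 + η'⁻¹ * (2 * ‖ξ‖) ^ 2 := by
      have := V.abs_fracForm_le (ZV s) ξ
      have h := mul_le_young (a := ‖ZV s‖) (b := 2 * ‖ξ‖) hη'
      linarith
    have e2 : |∫ x, S.forcing U w (s, x) * V.toH ξ x|
        ≤ η' * (∫ x, S.density U w (s, x)) + c * cξ := by
      rw [hcξ, ← integral_const_mul, ← integral_const_mul,
        ← integral_add (h2.const_mul _) (iξ.const_mul _), ← Real.norm_eq_abs]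
      refine (norm_integral_le_integral_norm _).trans ?_
      refine integral_mono_ae h3.norm ((h2.const_mul _).add (iξ.const_mul _)) ?_
      filter_upwards [h1] with x hx
      exact hx _
    have e3 : |testForce ZV (S.forcing U w) ξ s| ≤ |fracForm n α (V.toH (ZV s)) (V.toH ξ)|
        + |∫ x, S.forcing U w (s, x) * V.toH ξ x| := by
      rw [testForce, ← abs_neg (fracForm n α (V.toH (ZV s)) (V.toH ξ))]
      exact abs_add_le _ _
    linarith
  have iB : Integrable (fun s => ‖ZV s‖ ^ 2 + ∫ x, S.density U w (s, x))
    (volume.restrict (Set.Icc 0 T)) := iV.add iD.integral_prod_left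
  have hB : ∫ s in Set.Icc 0 T, (‖ZV s‖ ^ 2 + ∫ x, S.density U w (s, x)) ≤ R' := by
    rw [integral_add iV iD.integral_prod_left, ← integral_prod _ iD, hR']
    linarith
  have hB0 : ∀ s, 0 ≤ ‖ZV s‖ ^ 2 + ∫ x, S.density U w (s, x) := fun s =>
    add_nonneg (sq_nonneg _) (integral_nonneg fun x => S.density_nonneg _ _ _)
  have key : ∀ r ∈ Set.Icc 0 T, ∀ t ∈ Set.Icc 0 T, r ≤ t →
      |(inner ℝ (Z t - Z r) (V.toH ξ) : ℝ)| ≤ η + k * (t - r) := by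
    intro r hr t ht hrt
    have hm : volume.restrict (Set.Ioc r t) ≤ volume.restrict (Set.Icc 0 T) :=
      Measure.restrict_mono
        (fun s hs => Set.mem_Icc.2 ⟨hr.1.trans hs.1.le, hs.2.trans ht.2⟩) le_rfl
    rw [hsol.inner_sub_eq hp hξ ht hrt, intervalIntegral.integral_of_le hrt, ← Real.norm_eq_abs]
    refine (norm_integral_le_integral_norm _).trans ?_
    calc ∫ s in Set.Ioc r t, ‖(Set.Icc 0 T).indicator (testForce ZV (S.forcing U w) ξ) s‖
        ≤ ∫ s in Set.Ioc r t,
            (η' * (‖ZV s‖ ^ 2 + ∫ x, S.density U w (s, x)) + k) := by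
          refine integral_mono_of_nonneg (ae_of_all _ fun s => norm_nonneg _)
            (((iB.mono_measure hm).const_mul _).add (integrable_const k)) ?_
          filter_upwards [ae_mono hm hpt] with s hs
          refine le_trans ?_ hs
          rw [← Real.norm_eq_abs]
          exact norm_indicator_le_norm_self _ _
      _ = η' * (∫ s in Set.Ioc r t, (‖ZV s‖ ^ 2 + ∫ x, S.density U w (s, x)))
            + k * (t - r) := by
          rw [integral_add ((iB.mono_measure hm).const_mul _) (integrable_const k),
            integral_const_mul]
          simp [hrt, mul_comm]
      _ ≤ η' * R' + k * (t - r) := by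
          have := (integral_mono_measure hm (ae_of_all _ hB0) iB).trans hB
          have := mul_le_mul_of_nonneg_left this hη'.le
          linarith
      _ ≤ η + k * (t - r) := by linarith
  intro r hr t ht
  rcases le_total r t with h | h
  · rw [abs_of_nonneg (sub_nonneg.2 h)]
    exact key r hr t ht h
  · rw [abs_sub_comm t r, abs_of_nonneg (sub_nonneg.2 h), ← neg_sub (Z r) (Z t), inner_neg_left,
      abs_neg]
    exact key t ht r hr h

end ControlSystem

/-! ### The difference of two solutions -/

/-- Integration against an `l²`-valued function in `L²` is a Hilbert–Schmidt operator, hence maps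
bounded weakly null families to strongly null ones. -/
theorem tendsto_norm_integral_smul_zero {X : Type*} [MeasurableSpace X] {μ : Measure X}
    {B : X → Ell2} (hB : MemLp B 2 μ) {ι : Type*} {l : Filter ι} {h : ι → Lp ℝ 2 μ} {M : ℝ}
    (hM : ∀ᶠ i in l, ‖h i‖ ≤ M)
    (hw : ∀ φ : Lp ℝ 2 μ, Tendsto (fun i => (inner ℝ φ (h i) : ℝ)) l (𝓝 0)) :
    Tendsto (fun i => ‖∫ x, h i x • B x ∂μ‖ ^ 2) l (𝓝 0) := by
  have hcoord : ∀ k, MemLp (fun x => B x k) 2 μ := fun k =>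
    hB.mono ((continuous_ell2_apply k).comp_aestronglyMeasurable hB.1)
      (ae_of_all _ fun x => lp.norm_apply_le_norm two_ne_zero (B x) k)
  have hint : ∀ i, Integrable (fun x => h i x • B x) μ := fun i =>
    memLp_one_iff_integrable.1 (hB.smul (Lp.memLp (h i)))
  have hinner : ∀ i k, (∫ x, h i x • B x ∂μ : Ell2) k = inner ℝ ((hcoord k).toLp) (h i) := by
    intro i k
    rw [← inner_ell2Unit, ← integral_inner (hint i), L2.inner_def]
    refine integral_congr_ae ?_
    filter_upwards [(hcoord k).coeFn_toLp] with x hx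
    rw [real_inner_smul_right, inner_ell2Unit, hx]
    simp
  have hsum : Summable fun k => ‖(hcoord k).toLp‖ ^ 2 := by
    refine summable_of_sum_le (fun k => sq_nonneg _) (c := ∫ x, ‖B x‖ ^ 2 ∂μ) fun s => ?_
    have e : ∀ k, ‖(hcoord k).toLp‖ ^ 2 = ∫ x, B x k ^ 2 ∂μ := by
      intro k
      rw [← real_inner_self_eq_norm_sq, L2.inner_def]
      refine integral_congr_ae ?_
      filter_upwards [(hcoord k).coeFn_toLp] with x hx
      simp [hx, sq]
    simp only [e]
    rw [← integral_finsetSum _ fun k _ => (hcoord k).integrable_sq]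
    refine integral_mono (integrable_finsetSum _ fun k _ => (hcoord k).integrable_sq)
      ((memLp_two_iff_integrable_sq_norm hB.1).1 hB) fun x => ?_
    exact sum_le_hasSum s (fun k _ => sq_nonneg _) (norm_sq_ell2 (B x))
  have hnorm : ∀ i, ‖∫ x, h i x • B x ∂μ‖ ^ 2
      = ∑' k, (inner ℝ ((hcoord k).toLp) (h i) : ℝ) ^ 2 := by
    intro i
    rw [← (norm_sq_ell2 (∫ x, h i x • B x ∂μ)).tsum_eq]
    simp only [hinner]
  simp only [hnorm]
  rw [show (0 : ℝ) = ∑' _ : ℕ, (0 : ℝ) by simp]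
  refine tendsto_tsum_of_dominated_convergence (hsum.mul_right (M ^ 2)) (fun k => ?_) ?_
  · simpa using (hw ((hcoord k).toLp)).pow 2
  · filter_upwards [hM] with i hi k
    rw [Real.norm_of_nonneg (sq_nonneg _), ← mul_pow, ← sq_abs]
    refine pow_le_pow_left₀ (abs_nonneg _) ((abs_real_inner_le_norm _ _).trans ?_) 2
    exact mul_le_mul_of_nonneg_left hi (norm_nonneg _)

theorem slice_sub {n : ℕ} {U U' : ℝ × E n → ℝ} {Z Z' : ℝ → H n} {s : ℝ}
    (h : (fun x => U (s, x)) =ᵐ[volume] Z s) (h' : (fun x => U' (s, x)) =ᵐ[volume] Z' s) :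
    (fun x => U (s, x) - U' (s, x)) =ᵐ[volume] (Z s - Z' s : H n) := by
  filter_upwards [h, h', Lp.coeFn_sub (Z s) (Z' s)] with x h1 h2 h3
  rw [h3, Pi.sub_apply, ← h1, ← h2]

namespace ControlSystem

variable {n : ℕ} {α : Set.Ioo (0 : ℝ) 1} {T p : ℝ} (S : ControlSystem n T p)

theorem ae_memLp_noise_slice {U : ℝ × E n → ℝ} {Z : ℝ → H n} (hU : StronglyMeasurable U)
    (hs : ∀ s, (fun x => U (s, x)) =ᵐ[volume] Z s) :
    ∀ᵐ s ∂volume.restrict (Set.Icc 0 T), MemLp (fun x => S.B (s, x) (U (s, x))) 2 volume ∧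
      ∫ x, ‖S.B (s, x) (U (s, x))‖ ^ 2 ≤ 2 * S.C + 2 * S.C ^ 2 * ‖Z s‖ ^ 2 := by
  filter_upwards [(S.B_meas U hU).prodMk_left, ae_restrict_mem measurableSet_Icc] with s hm hsT
  have i1 := (S.φ_int s hsT).1
  obtain ⟨i2, e2⟩ := integral_slice_sq (hs s)
  have i3 : Integrable (fun x => 2 * S.φ (s, x) ^ 2 + 2 * S.C ^ 2 * U (s, x) ^ 2) :=
    (i1.const_mul 2).add (i2.const_mul _)
  have hle : ∀ x, ‖S.B (s, x) (U (s, x))‖ ^ 2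
      ≤ 2 * S.φ (s, x) ^ 2 + 2 * S.C ^ 2 * U (s, x) ^ 2 := by
    intro x
    refine (pow_le_pow_left₀ (norm_nonneg _) (S.B_growth (s, x) (U (s, x))) 2).trans ?_
    rw [← sq_abs (U (s, x))]
    nlinarith [sq_nonneg (S.φ (s, x) - S.C * |U (s, x)|)]
  have i4 : Integrable (fun x => ‖S.B (s, x) (U (s, x))‖ ^ 2) :=
    i3.mono' (hm.norm.pow 2) (ae_of_all _ fun x => by
      rw [Real.norm_of_nonneg (sq_nonneg _)]
      exact hle x)
  refine ⟨(memLp_two_iff_integrable_sq_norm hm).2 i4, (integral_mono i4 i3 hle).trans ?_⟩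
  rw [integral_add (i1.const_mul 2) (i2.const_mul _), integral_const_mul, integral_const_mul, e2]
  linarith [(S.φ_int s hsT).2]

/-- The noise operator applied to a function of space, `∫ z(x) B(s,x,U(s,x)) dx`. -/
noncomputable def noisePairing (U : ℝ × E n → ℝ) (z : ℝ × E n → ℝ) (s : ℝ) : Ell2 :=
  ∫ x, z (s, x) • S.B (s, x) (U (s, x))

theorem aestronglyMeasurable_noisePairing {U z : ℝ × E n → ℝ} (hU : StronglyMeasurable U)
    (hz : AEStronglyMeasurable z (slab n T)) :
    AEStronglyMeasurable (S.noisePairing U z) (volume.restrict (Set.Icc 0 T)) :=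
  (hz.smul (S.B_meas U hU)).integral_prod_right'

/-- The noise, applied to `e` and tested with `z`, is the inner product of `e` with the noise
pairing. -/
theorem ae_noisePairing {U : ℝ × E n → ℝ} {Z : ℝ → H n} (hU : StronglyMeasurable U)
    (hs : ∀ s, (fun x => U (s, x)) =ᵐ[volume] Z s) {z : ℝ × E n → ℝ} {ζ : ℝ → H n}
    (hz : ∀ s, (fun x => z (s, x)) =ᵐ[volume] ζ s) :
    ∀ᵐ s ∂volume.restrict (Set.Icc 0 T),
      (∀ e : Ell2, Integrable (fun x => inner ℝ (S.B (s, x) (U (s, x))) e * z (s, x)) ∧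
        ∫ x, inner ℝ (S.B (s, x) (U (s, x))) e * z (s, x) = inner ℝ (S.noisePairing U z s) e) ∧
      ‖S.noisePairing U z s‖ ≤ ‖ζ s‖ ^ 2 + (2 * S.C + 2 * S.C ^ 2 * ‖Z s‖ ^ 2) := by
  filter_upwards [S.ae_memLp_noise_slice hU hs] with s hB
  obtain ⟨hB, hBle⟩ := hB
  have hz2 : MemLp (fun x => z (s, x)) 2 volume := (memLp_congr_ae (hz s)).2 (Lp.memLp (ζ s))
  have hint : Integrable (fun x => z (s, x) • S.B (s, x) (U (s, x))) :=
    memLp_one_iff_integrable.1 (hB.smul hz2)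
  have hin : ∀ (e : Ell2) x, (inner ℝ (S.B (s, x) (U (s, x))) e * z (s, x) : ℝ)
      = inner ℝ e (z (s, x) • S.B (s, x) (U (s, x))) := by
    intro e x
    rw [real_inner_smul_right, real_inner_comm, mul_comm]
  refine ⟨fun e => ⟨?_, ?_⟩, ?_⟩
  · simp only [hin]
    exact hint.const_inner e
  · simp only [hin]
    rw [integral_inner hint, real_inner_comm]
    rfl
  · obtain ⟨i1, e1⟩ := integral_slice_sq (hz s)
    have i2 : Integrable (fun x => ‖S.B (s, x) (U (s, x))‖ ^ 2) :=
      (memLp_two_iff_integrable_sq_norm hB.1).1 hB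
    refine (norm_integral_le_integral_norm _).trans ?_
    calc ∫ x, ‖z (s, x) • S.B (s, x) (U (s, x))‖
        ≤ ∫ x, (z (s, x) ^ 2 + ‖S.B (s, x) (U (s, x))‖ ^ 2) := by
          refine integral_mono hint.norm (i1.add i2) fun x => ?_
          simp only [norm_smul, Real.norm_eq_abs]
          rw [← sq_abs (z (s, x))]
          nlinarith [sq_nonneg (|z (s, x)| - ‖S.B (s, x) (U (s, x))‖),
            sq_nonneg (|z (s, x)|), sq_nonneg (‖S.B (s, x) (U (s, x))‖)]
      _ ≤ _ := by
          rw [integral_add i1 i2, e1]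
          linarith

variable {S}

/-- The energy inequality for the difference of two solutions. The noise coefficients are compared
with the one along a third function, so that the difference of the controls meets a fixed
coefficient. -/
theorem energy_sub_le {u₀ : H n} {Z Z' Z₁ : ℝ → H n} {ZV ZV' : ℝ → V n α}
    {U U' U₁ : ℝ × E n → ℝ} {w w' : ℝ → Ell2}
    (h : WeakSol T p u₀ Z ZV U (S.forcing U w)) (h' : WeakSol T p u₀ Z' ZV' U' (S.forcing U' w'))
    (hU₁ : StronglyMeasurable U₁)
    (hs₁ : ∀ s, (fun x => U₁ (s, x)) =ᵐ[volume] Z₁ s) {t : ℝ} (ht : t ∈ Set.Icc 0 T)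
    {b : ℝ → ℝ} (hb : Integrable b (volume.restrict (Set.Icc 0 t)))
    (hle : ∀ᵐ s ∂volume.restrict (Set.Icc 0 T),
      2 * S.C * ‖Z s - Z' s‖ ^ 2 + S.C * ‖w s‖ * (‖Z s - Z₁ s‖ ^ 2 + ‖Z s - Z' s‖ ^ 2)
        + S.C * ‖w' s‖ * (‖Z' s - Z₁ s‖ ^ 2 + ‖Z s - Z' s‖ ^ 2)
        + 2 * inner ℝ (S.noisePairing U₁ (fun y => U y - U' y) s) (w s - w' s) ≤ b s) :
    ‖Z t - Z' t‖ ^ 2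
      + 2 * (∫ s in Set.Icc 0 t, fracForm n α (V.toH (ZV s - ZV' s)) (V.toH (ZV s - ZV' s)))
      ≤ ∫ s in Set.Icc 0 t, b s := by
  have hT := S.T_pos
  have hp := S.two_lt
  have hC := S.C_nonneg
  have hm : volume.restrict (Set.Icc 0 t) ≤ volume.restrict (Set.Icc 0 T) :=
    Measure.restrict_mono (Set.Icc_subset_Icc_right ht.2) le_rfl
  have hd := h.sub h' hp
  have iG := hd.integrable_force_mul hp
  have e1 := hd.energy hT hp ht
  simp only [norm_zero, ne_eq, OfNat.ofNat_ne_zero, not_false_eq_true, zero_pow, zero_add,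
    sub_self] at e1
  refine e1.trans ?_
  rw [← integral_const_mul]
  refine integral_mono_ae ((iG.mono_measure (slab_mono ht.2)).integral_prod_left.const_mul 2)
    hb ?_
  filter_upwards [ae_mono hm hle, ae_mono hm iG.prod_right_ae,
    ae_mono hm (Measure.ae_ae_of_ae_prod S.F_mono),
    ae_mono hm (S.ae_noisePairing hU₁ hs₁ (z := fun y => U y - U' y) (ζ := fun s => Z s - Z' s)
      fun s => slice_sub (h.slice s) (h'.slice s))] with s hle hi hF hP
  refine le_trans ?_ hle
  obtain ⟨iz, ez⟩ := integral_slice_sq (U := fun y => U y - U' y)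
    (slice_sub (h.slice s) (h'.slice s))
  obtain ⟨ia, ea⟩ := integral_slice_sq (U := fun y => U y - U₁ y)
    (slice_sub (h.slice s) (hs₁ s))
  obtain ⟨ia', ea'⟩ := integral_slice_sq (U := fun y => U' y - U₁ y)
    (slice_sub (h'.slice s) (hs₁ s))
  obtain ⟨iP, eP⟩ := hP.1 (w s - w' s)
  have j1 : Integrable (fun x => 2 * S.C * (U (s, x) - U' (s, x)) ^ 2) := iz.const_mul _
  have j2 : Integrable (fun x => S.C * ‖w s‖ *
      ((U (s, x) - U₁ (s, x)) ^ 2 + (U (s, x) - U' (s, x)) ^ 2)) := (ia.add iz).const_mul _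
  have j3 : Integrable (fun x => S.C * ‖w' s‖ *
      ((U' (s, x) - U₁ (s, x)) ^ 2 + (U (s, x) - U' (s, x)) ^ 2)) := (ia'.add iz).const_mul _
  have j4 : Integrable (fun x => 2 * (inner ℝ (S.B (s, x) (U₁ (s, x))) (w s - w' s)
      * (U (s, x) - U' (s, x)))) := iP.const_mul 2
  have j12 : Integrable (fun x => 2 * S.C * (U (s, x) - U' (s, x)) ^ 2 + S.C * ‖w s‖ *
      ((U (s, x) - U₁ (s, x)) ^ 2 + (U (s, x) - U' (s, x)) ^ 2)) := j1.add j2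
  have j123 : Integrable (fun x => 2 * S.C * (U (s, x) - U' (s, x)) ^ 2 + S.C * ‖w s‖ *
      ((U (s, x) - U₁ (s, x)) ^ 2 + (U (s, x) - U' (s, x)) ^ 2) + S.C * ‖w' s‖ *
      ((U' (s, x) - U₁ (s, x)) ^ 2 + (U (s, x) - U' (s, x)) ^ 2)) := j12.add j3
  rw [← eP, ← ez, ← ea, ← ea', ← integral_add ia iz, ← integral_add ia' iz, ← integral_const_mul,
    ← integral_const_mul, ← integral_const_mul, ← integral_const_mul, ← integral_const_mul,
    ← integral_add j1 j2,
    ← integral_add j12 j3, ← integral_add j123 j4]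
  refine integral_mono_ae (hi.const_mul 2) (j123.add j4) ?_
  filter_upwards [hF] with x hFx
  have f1 := hFx (U (s, x)) (U' (s, x))
  have f2 : |inner ℝ (S.B (s, x) (U (s, x)) - S.B (s, x) (U₁ (s, x))) (w s)|
      ≤ S.C * |U (s, x) - U₁ (s, x)| * ‖w s‖ := (abs_real_inner_le_norm _ _).trans
    (mul_le_mul_of_nonneg_right (S.B_lip _ _ _) (norm_nonneg _))
  have f3 : |inner ℝ (S.B (s, x) (U' (s, x)) - S.B (s, x) (U₁ (s, x))) (w' s)|
      ≤ S.C * |U' (s, x) - U₁ (s, x)| * ‖w' s‖ := (abs_real_inner_le_norm _ _).trans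
    (mul_le_mul_of_nonneg_right (S.B_lip _ _ _) (norm_nonneg _))
  -- the two Lipschitz differences of the noise coefficient are absorbed in squares
  have young : ∀ {i d a W : ℝ}, 0 ≤ W → |i| ≤ S.C * |a| * W →
      2 * (|i| * |d|) ≤ S.C * W * (a ^ 2 + d ^ 2) := by
    intro i d a W hW hi
    have g1 := mul_le_mul_of_nonneg_right hi (abs_nonneg d)
    have g2 : 2 * (|a| * |d|) ≤ a ^ 2 + d ^ 2 := by
      rw [← sq_abs a, ← sq_abs d]
      nlinarith [sq_nonneg (|a| - |d|)]
    have g3 := mul_le_mul_of_nonneg_left g2 (mul_nonneg hC hW)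
    linarith
  have f4 := young (d := U (s, x) - U' (s, x)) (norm_nonneg _) f2
  have f5 := young (d := U (s, x) - U' (s, x)) (norm_nonneg _) f3
  rw [← abs_mul] at f4 f5
  have f6 := le_abs_self
    (inner ℝ (S.B (s, x) (U (s, x)) - S.B (s, x) (U₁ (s, x))) (w s) * (U (s, x) - U' (s, x)))
  have f7 := neg_abs_le
    (inner ℝ (S.B (s, x) (U' (s, x)) - S.B (s, x) (U₁ (s, x))) (w' s) * (U (s, x) - U' (s, x)))
  simp only [inner_sub_left] at f4 f5 f6 f7
  simp only [forcing, inner_sub_right]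
  linarith

/-- Solutions with the same control coincide. -/
theorem eq_of_same_control {u₀ : H n} {Z Z' : ℝ → H n} {ZV ZV' : ℝ → V n α}
    {U U' : ℝ × E n → ℝ} {w : ℝ → Ell2} (hw : MemLp w 2 (volume.restrict (Set.Icc 0 T)))
    (h : WeakSol T p u₀ Z ZV U (S.forcing U w)) (h' : WeakSol T p u₀ Z' ZV' U' (S.forcing U' w)) :
    ∀ t ∈ Set.Icc 0 T, Z t = Z' t := by
  have hT := S.T_pos
  have hC := S.C_nonneg
  have hk := memLp_two_kernel (3 * S.C) hw
  have hKK := integral_kernel_sq_le (D := 3 * S.C) hT.le hw le_rfl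
  have hc : Continuous fun s => ‖Z s - Z' s‖ ^ 2 := (h.cont.sub h'.cont).norm.pow 2
  have key := gronwall_sq_integrable (y := fun s => ‖Z s - Z' s‖ ^ 2) hT.le
    (by positivity : 0 < (3 * S.C) ^ 2 * (2 * T + 2 * |∫ s in Set.Icc 0 T, ‖w s‖ ^ 2|) + 1)
    hk (fun s => by positivity) hKK hc (fun s => by positivity) le_rfl fun t ht => by
      have hm : volume.restrict (Set.Icc 0 t) ≤ volume.restrict (Set.Icc 0 T) :=
        Measure.restrict_mono (Set.Icc_subset_Icc_right ht.2) le_rfl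
      have := energy_sub_le h h' h'.meas h'.slice ht
        (b := fun s => 3 * S.C * (1 + ‖w s‖) * ‖Z s - Z' s‖ ^ 2)
        ((hk.mono_measure hm).integrable_mul (memLp_two_of_continuous hc t))
        (ae_of_all _ fun s => by
          simp only [sub_self, norm_zero, inner_zero_right]
          have := mul_nonneg hC (sq_nonneg ‖Z s - Z' s‖)
          linarith)
      have h2 : 0 ≤ ∫ s in Set.Icc 0 t,
          fracForm n α (V.toH (ZV s - ZV' s)) (V.toH (ZV s - ZV' s)) :=
        integral_nonneg fun s => fracForm_self_nonneg _
      linarith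
  intro t ht
  have := key t ht
  simp only [mul_zero, zero_mul] at this
  have h0 : ‖Z t - Z' t‖ = 0 := by nlinarith [norm_nonneg (Z t - Z' t)]
  exact sub_eq_zero.1 (norm_eq_zero.1 h0)

end ControlSystem

/-! ### From weak to strong convergence -/

namespace ControlSystem

variable {n : ℕ} {α : Set.Ioo (0 : ℝ) 1} {T p : ℝ} {S : ControlSystem n T p}

theorem norm_sub_sq_le_four_mul {𝓗 : Type*} [SeminormedAddCommGroup 𝓗] {a b : 𝓗} {R : ℝ}
    (ha : ‖a‖ ^ 2 ≤ R) (hb : ‖b‖ ^ 2 ≤ R) : ‖a - b‖ ^ 2 ≤ 4 * R := by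
  have := pow_le_pow_left₀ (norm_nonneg _) (norm_sub_le a b) 2
  nlinarith [sq_nonneg (‖a‖ - ‖b‖)]

section Sequence

variable {u₀ : H n} {R : ℝ} {Z : ℕ → ℝ → H n} {ZV : ℕ → ℝ → V n α} {U : ℕ → ℝ × E n → ℝ}
  {w : ℕ → ℝ → Ell2}

/-- For a fixed coefficient `B(·, U j)` the noise pairing of `U i - U i'` tends to zero in
`L²(0,T;l²)`: at almost every time by the Hilbert–Schmidt property, and boundedly. -/
theorem tendsto_integral_noisePairing_sq
    (hsol : ∀ k, WeakSol T p u₀ (Z k) (ZV k) (U k) (S.forcing (U k) (w k)))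
    (hb : ∀ k, Bounded T p R (Z k) (ZV k) (U k) (w k))
    (hweak : ∀ᵐ s ∂volume.restrict (Set.Icc 0 T), ∀ φ : H n,
      CauchySeq fun k => (inner ℝ φ (Z k s) : ℝ)) (j : ℕ) :
    Tendsto (fun i : ℕ × ℕ => ∫ s in Set.Icc 0 T,
      ‖S.noisePairing (U j) (fun y => U i.1 y - U i.2 y) s‖ ^ 2) atTop (𝓝 0) := by
  have hC := S.C_nonneg
  have hmeas : ∀ i : ℕ × ℕ, AEStronglyMeasurable
      (S.noisePairing (U j) (fun y => U i.1 y - U i.2 y)) (volume.restrict (Set.Icc 0 T)) :=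
    fun i => S.aestronglyMeasurable_noisePairing (hsol j).meas
      ((hsol i.1).meas.sub (hsol i.2).meas).aestronglyMeasurable
  have hslice : ∀ (i : ℕ × ℕ) s, (fun x => U i.1 (s, x) - U i.2 (s, x))
      =ᵐ[volume] (Z i.1 s - Z i.2 s : H n) := fun i s =>
    slice_sub ((hsol i.1).slice s) ((hsol i.2).slice s)
  have h0 : ∫ _ in Set.Icc 0 T, (0 : ℝ) = 0 := by simp
  refine (congrArg 𝓝 h0) ▸ (tendsto_integral_filter_of_dominated_convergence (l := atTop)
    (F := fun (i : ℕ × ℕ) s => ‖S.noisePairing (U j) (fun y => U i.1 y - U i.2 y) s‖ ^ 2)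
    (fun _ => (4 * R + (2 * S.C + 2 * S.C ^ 2 * R)) ^ 2)
    (Eventually.of_forall fun i => (hmeas i).norm.pow 2)
    (Eventually.of_forall fun i => ?_) (integrable_const _) ?_)
  · filter_upwards [S.ae_noisePairing (hsol j).meas (hsol j).slice
      (z := fun y => U i.1 y - U i.2 y) (hslice i), ae_restrict_mem measurableSet_Icc]
      with s hs hsT
    rw [Real.norm_of_nonneg (sq_nonneg _)]
    refine pow_le_pow_left₀ (norm_nonneg _) (hs.2.trans ?_) 2
    have h1 := norm_sub_sq_le_four_mul ((hb i.1).sup s hsT) ((hb i.2).sup s hsT)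
    have h2 := mul_le_mul_of_nonneg_left ((hb j).sup s hsT)
      (show 0 ≤ 2 * S.C ^ 2 by positivity)
    linarith
  · filter_upwards [hweak, S.ae_memLp_noise_slice (hsol j).meas (hsol j).slice,
      ae_restrict_mem measurableSet_Icc] with s hs hB hsT
    have e : ∀ i : ℕ × ℕ, S.noisePairing (U j) (fun y => U i.1 y - U i.2 y) s
        = ∫ x, (Z i.1 s - Z i.2 s : H n) x • S.B (s, x) (U j (s, x)) := by
      intro i
      refine integral_congr_ae ?_
      filter_upwards [hslice i s] with x hx
      rw [← hx]
    simp only [e]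
    refine tendsto_norm_integral_smul_zero hB.1 (M := 4 * R + 1)
      (Eventually.of_forall fun i => ?_) fun φ => ?_
    · have h1 := norm_sub_sq_le_four_mul ((hb i.1).sup s hsT) ((hb i.2).sup s hsT)
      nlinarith [sq_nonneg (‖Z i.1 s - Z i.2 s‖ - 1)]
    · have := cauchySeq_iff_tendsto_dist_atTop_0.1 (hs φ)
      simp only [Real.dist_eq] at this
      simp only [inner_sub_right]
      exact (tendsto_zero_iff_abs_tendsto_zero _).2 this

/-- The pairing of the difference of the controls with a fixed noise coefficient is small in
`L¹(0,T)`: by Young's inequality, as the controls are bounded in `L²` and the noise pairing is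
small there. -/
theorem exists_noise_bound
    (hsol : ∀ k, WeakSol T p u₀ (Z k) (ZV k) (U k) (S.forcing (U k) (w k)))
    (hb : ∀ k, Bounded T p R (Z k) (ZV k) (U k) (w k))
    (hweak : ∀ᵐ s ∂volume.restrict (Set.Icc 0 T), ∀ φ : H n,
      CauchySeq fun k => (inner ℝ φ (Z k s) : ℝ)) (j : ℕ) {ε : ℝ} (hε : 0 < ε) :
    ∃ N, ∀ k ≥ N, ∀ m ≥ N, ∃ β : ℝ → ℝ, Integrable β (volume.restrict (Set.Icc 0 T)) ∧
      (∀ s, 0 ≤ β s) ∧ ∫ s in Set.Icc 0 T, β s ≤ ε ∧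
      ∀ s, 2 * inner ℝ (S.noisePairing (U j) (fun y => U k y - U m y) s) (w k s - w m s)
        ≤ β s := by
  have hT := S.T_pos
  have hC := S.C_nonneg
  have hR : 0 ≤ R := (sq_nonneg _).trans ((hb 0).sup 0 ⟨le_rfl, hT.le⟩)
  -- `4R` bounds `‖w k - w m‖²` in `L¹`
  obtain ⟨η, hη, hηR⟩ : ∃ η, 0 < η ∧ 2 * η * (4 * R) ≤ ε / 2 := by
    refine ⟨ε / (16 * (R + 1)), by positivity, ?_⟩
    have : 2 * (ε / (16 * (R + 1))) * (4 * (R + 1)) = ε / 2 := by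
      field_simp
      norm_num
    have h2 : 0 ≤ 2 * (ε / (16 * (R + 1))) := by positivity
    nlinarith
  have ht := (tendsto_integral_noisePairing_sq hsol hb hweak j).eventually
    (gt_mem_nhds (show 0 < ε * η / 4 by positivity))
  obtain ⟨N, hN⟩ := eventually_atTop.1 ht
  refine ⟨max N.1 N.2, fun k hk m hm => ?_⟩
  have hQ := hN (k, m) ⟨(le_max_left _ _).trans hk, (le_max_right _ _).trans hm⟩
  have hslice : ∀ s, (fun x => U k (s, x) - U m (s, x)) =ᵐ[volume] (Z k s - Z m s : H n) :=
    fun s => slice_sub ((hsol k).slice s) ((hsol m).slice s)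
  have hmeas : AEStronglyMeasurable
      (S.noisePairing (U j) (fun y => U k y - U m y)) (volume.restrict (Set.Icc 0 T)) :=
    S.aestronglyMeasurable_noisePairing (hsol j).meas
      ((hsol k).meas.sub (hsol m).meas).aestronglyMeasurable
  have iP : Integrable (fun s => ‖S.noisePairing (U j) (fun y => U k y - U m y) s‖ ^ 2)
      (volume.restrict (Set.Icc 0 T)) := by
    refine (integrable_const ((4 * R + (2 * S.C + 2 * S.C ^ 2 * R)) ^ 2)).mono'
      (hmeas.norm.pow 2) ?_
    filter_upwards [S.ae_noisePairing (hsol j).meas (hsol j).slice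
      (z := fun y => U k y - U m y) hslice, ae_restrict_mem measurableSet_Icc] with s hs hsT
    rw [Real.norm_of_nonneg (sq_nonneg _)]
    refine pow_le_pow_left₀ (norm_nonneg _) (hs.2.trans ?_) 2
    have h1 := norm_sub_sq_le_four_mul ((hb k).sup s hsT) ((hb m).sup s hsT)
    have h2 := mul_le_mul_of_nonneg_left ((hb j).sup s hsT)
      (show 0 ≤ 2 * S.C ^ 2 by positivity)
    linarith
  have iwk := (memLp_two_iff_integrable_sq_norm (hb k).memLp_w.1).1 (hb k).memLp_w
  have iwm := (memLp_two_iff_integrable_sq_norm (hb m).memLp_w.1).1 (hb m).memLp_w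
  have hwkm := (hb k).memLp_w.sub (hb m).memLp_w
  have iw : Integrable (fun s => ‖w k s - w m s‖ ^ 2) (volume.restrict (Set.Icc 0 T)) :=
    (memLp_two_iff_integrable_sq_norm hwkm.1).1 hwkm
  have hw : ∫ s in Set.Icc 0 T, ‖w k s - w m s‖ ^ 2 ≤ 4 * R := by
    have : ∫ s in Set.Icc 0 T, ‖w k s - w m s‖ ^ 2
        ≤ ∫ s in Set.Icc 0 T, (2 * ‖w k s‖ ^ 2 + 2 * ‖w m s‖ ^ 2) := by
      refine integral_mono iw ((iwk.const_mul 2).add (iwm.const_mul 2)) fun s => ?_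
      have := pow_le_pow_left₀ (norm_nonneg _) (norm_sub_le (w k s) (w m s)) 2
      have h2 := sq_nonneg (‖w k s‖ - ‖w m s‖)
      simp only
      nlinarith
    rw [integral_add (iwk.const_mul 2) (iwm.const_mul 2), integral_const_mul,
      integral_const_mul] at this
    linarith [(hb k).control, (hb m).control]
  refine ⟨fun s => 2 * η * ‖w k s - w m s‖ ^ 2
      + 2 * η⁻¹ * ‖S.noisePairing (U j) (fun y => U k y - U m y) s‖ ^ 2,
    (iw.const_mul _).add (iP.const_mul _), fun s => by positivity, ?_, fun s => ?_⟩
  · rw [integral_add (iw.const_mul _) (iP.const_mul _), integral_const_mul, integral_const_mul]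
    have h1 := mul_le_mul_of_nonneg_left hw (show 0 ≤ 2 * η by positivity)
    have h2 := mul_le_mul_of_nonneg_left hQ.le (show 0 ≤ 2 * η⁻¹ by positivity)
    have h3 : 2 * η⁻¹ * (ε * η / 4) = ε / 2 := by
      field_simp
      norm_num
    linarith
  · have h1 := real_inner_le_norm (S.noisePairing (U j) (fun y => U k y - U m y) s)
      (w k s - w m s)
    have h2 := mul_le_young (a := ‖w k s - w m s‖)
      (b := ‖S.noisePairing (U j) (fun y => U k y - U m y) s‖) hη
    linarith

/-- The contraction step: once the solutions are `a`-close in the norm with weight `exp(-2Kt)`, they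
are eventually `(a/2 + ε)`-close. Here `K` bounds the squared `L²` norms of the kernels
`4C(1 + ‖w k‖)`, and the coefficient along `U N` is the fixed one to compare with. -/
theorem contraction_step
    (hsol : ∀ k, WeakSol T p u₀ (Z k) (ZV k) (U k) (S.forcing (U k) (w k)))
    (hb : ∀ k, Bounded T p R (Z k) (ZV k) (U k) (w k))
    (hweak : ∀ᵐ s ∂volume.restrict (Set.Icc 0 T), ∀ φ : H n,
      CauchySeq fun k => (inner ℝ φ (Z k s) : ℝ)) {K : ℝ}
    (hK : K = (4 * S.C) ^ 2 * (2 * T + 2 * |R|) + 1) {a : ℝ} (ha : 0 ≤ a) {N : ℕ}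
    (hN : ∀ k ≥ N, ∀ m ≥ N, ∀ t ∈ Set.Icc 0 T, ‖Z k t - Z m t‖ ^ 2 ≤ a * Real.exp (2 * K * t))
    {ε : ℝ} (hε : 0 < ε) :
    ∃ N', ∀ k ≥ N', ∀ m ≥ N', ∀ t ∈ Set.Icc 0 T, ‖Z k t - Z m t‖ ^ 2 + 2 * (∫ s in Set.Icc 0 t,
      fracForm n α (V.toH (ZV k s - ZV m s)) (V.toH (ZV k s - ZV m s)))
        ≤ (a / 2 + ε) * Real.exp (2 * K * t) := by
  have hT := S.T_pos
  have hC := S.C_nonneg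
  have hK0 : 0 < K := by rw [hK]; positivity
  obtain ⟨N', hN'⟩ := exists_noise_bound hsol hb hweak N hε
  refine ⟨max N N', fun k hk m hm t ht => ?_⟩
  obtain ⟨β, iβ, hβ0, hβ, hβle⟩ :=
    hN' k ((le_max_right _ _).trans hk) m ((le_max_right _ _).trans hm)
  have hk' : k ≥ N := (le_max_left _ _).trans hk
  have hm' : m ≥ N := (le_max_left _ _).trans hm
  have hmeas : volume.restrict (Set.Icc 0 t) ≤ volume.restrict (Set.Icc 0 T) :=
    Measure.restrict_mono (Set.Icc_subset_Icc_right ht.2) le_rfl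
  have hker : ∀ k, MemLp (fun s => 4 * S.C * (1 + ‖w k s‖)) 2 (volume.restrict (Set.Icc 0 T)) :=
    fun k => memLp_two_kernel _ (hb k).memLp_w
  have hkerle : ∀ k, ∫ s in Set.Icc 0 t, 4 * S.C * (1 + ‖w k s‖) * Real.exp (2 * K * s)
      ≤ 1 / 2 * Real.exp (2 * K * t) := fun k => by
    refine integral_mul_exp_le hK0 (hker k) ?_ ht
    rw [hK]
    exact integral_kernel_sq_le hT.le (hb k).memLp_w (hb k).control
  have iker : ∀ k, Integrable (fun s => 4 * S.C * (1 + ‖w k s‖) * Real.exp (2 * K * s))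
      (volume.restrict (Set.Icc 0 t)) := fun k =>
    ((hker k).mono_measure hmeas).integrable_mul
      (memLp_two_of_continuous (f := fun s => Real.exp (2 * K * s)) (by fun_prop) t)
  have isum : Integrable (fun s => a / 2 * (4 * S.C * (1 + ‖w k s‖) * Real.exp (2 * K * s))
      + a / 2 * (4 * S.C * (1 + ‖w m s‖) * Real.exp (2 * K * s)))
      (volume.restrict (Set.Icc 0 t)) := ((iker k).const_mul _).add ((iker m).const_mul _)
  refine (energy_sub_le (hsol k) (hsol m) (hsol N).meas (hsol N).slice ht
    (b := fun s => a / 2 * (4 * S.C * (1 + ‖w k s‖) * Real.exp (2 * K * s))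
      + a / 2 * (4 * S.C * (1 + ‖w m s‖) * Real.exp (2 * K * s)) + β s)
    (isum.add (iβ.mono_measure hmeas)) ?_).trans ?_
  · -- all the distances in `energy_sub_le` are below the weighted bound `a exp(2Ks)`
    filter_upwards [ae_restrict_mem measurableSet_Icc] with s hs
    have h1 := hβle s
    have h2 := hN k hk' m hm' s hs
    have h3 := hN k hk' N le_rfl s hs
    have h4 := hN m hm' N le_rfl s hs
    have h5 := mul_le_mul_of_nonneg_left h2 hC
    have h6 := mul_le_mul_of_nonneg_left (add_le_add h3 h2)
      (mul_nonneg hC (norm_nonneg (w k s)))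
    have h7 := mul_le_mul_of_nonneg_left (add_le_add h4 h2)
      (mul_nonneg hC (norm_nonneg (w m s)))
    have h8 : 0 ≤ S.C * (a * Real.exp (2 * K * s)) := by positivity
    linarith
  · rw [integral_add isum (iβ.mono_measure hmeas), integral_add ((iker k).const_mul _)
      ((iker m).const_mul _), integral_const_mul, integral_const_mul]
    have h1 := mul_le_mul_of_nonneg_left (hkerle k) (show 0 ≤ a / 2 by positivity)
    have h2 := mul_le_mul_of_nonneg_left (hkerle m) (show 0 ≤ a / 2 by positivity)
    have h3 : ∫ s in Set.Icc 0 t, β s ≤ ε :=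
      (integral_mono_measure hmeas (ae_of_all _ hβ0) iβ).trans hβ
    have h4 : ε * 1 ≤ ε * Real.exp (2 * K * t) :=
      mul_le_mul_of_nonneg_left (Real.one_le_exp (by have := ht.1; positivity)) hε.le
    linarith

/-- A sequence of solutions that is weakly Cauchy in `H` at almost every time is Cauchy in
`C([0,T],H)` and in `L²(0,T;V)`. -/
theorem cauchy_of_weakly_cauchy
    (hsol : ∀ k, WeakSol T p u₀ (Z k) (ZV k) (U k) (S.forcing (U k) (w k)))
    (hb : ∀ k, Bounded T p R (Z k) (ZV k) (U k) (w k))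
    (hweak : ∀ᵐ s ∂volume.restrict (Set.Icc 0 T), ∀ φ : H n,
      CauchySeq fun k => (inner ℝ φ (Z k s) : ℝ)) {ε : ℝ} (hε : 0 < ε) :
    ∃ N, ∀ k ≥ N, ∀ m ≥ N, (∀ t ∈ Set.Icc 0 T, ‖Z k t - Z m t‖ ^ 2 ≤ ε) ∧
      ∫ s in Set.Icc 0 T, ‖ZV k s - ZV m s‖ ^ 2 ≤ ε := by
  have hT := S.T_pos
  have hp := S.two_lt
  have hC := S.C_nonneg
  have hR : 0 ≤ R := (sq_nonneg _).trans ((hb 0).sup 0 ⟨le_rfl, hT.le⟩)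
  obtain ⟨K, hK⟩ : ∃ K, K = (4 * S.C) ^ 2 * (2 * T + 2 * |R|) + 1 := ⟨_, rfl⟩
  have hK0 : 0 < K := by rw [hK]; positivity
  have hform : ∀ k m t, 0 ≤ ∫ s in Set.Icc 0 t,
      fracForm n α (V.toH (ZV k s - ZV m s)) (V.toH (ZV k s - ZV m s)) := fun k m t =>
    integral_nonneg fun s => fracForm_self_nonneg _
  -- the iteration starts from the a priori bound `4R` and has the fixed point `2δ`
  have iter : ∀ δ > 0, ∀ i : ℕ, ∃ N, ∀ k ≥ N, ∀ m ≥ N, ∀ t ∈ Set.Icc 0 T,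
      ‖Z k t - Z m t‖ ^ 2 ≤ (4 * R / 2 ^ i + 2 * δ) * Real.exp (2 * K * t) := by
    intro δ hδ i
    induction i with
    | zero =>
      refine ⟨0, fun k _ m _ t ht => ?_⟩
      have h1 := norm_sub_sq_le_four_mul ((hb k).sup t ht) ((hb m).sup t ht)
      have h2 : (1 : ℝ) ≤ Real.exp (2 * K * t) :=
        Real.one_le_exp (by have := ht.1; positivity)
      have h3 : 0 ≤ 4 * R + 2 * δ := by positivity
      simp only [pow_zero, div_one]
      nlinarith
    | succ i ih =>
      obtain ⟨N, hN⟩ := ih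
      obtain ⟨N', hN'⟩ := contraction_step hsol hb hweak hK (by positivity) hN hδ
      refine ⟨N', fun k hk m hm t ht => ?_⟩
      have h1 := hN' k hk m hm t ht
      have h2 := hform k m t
      have e : (4 * R / 2 ^ i + 2 * δ) / 2 + δ = 4 * R / 2 ^ (i + 1) + 2 * δ := by
        rw [pow_succ]
        field_simp
        ring
      rw [e] at h1
      linarith
  obtain ⟨δ, hδ, hδε⟩ : ∃ δ, 0 < δ ∧ 4 * δ * Real.exp (2 * K * T) * (T + 1) = ε :=
    ⟨ε / (4 * Real.exp (2 * K * T) * (T + 1)), by positivity, by field_simp⟩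
  obtain ⟨i, hi⟩ := pow_unbounded_of_one_lt (4 * R / δ) one_lt_two
  obtain ⟨N, hN⟩ := iter δ hδ i
  have hi' : 4 * R / 2 ^ i ≤ δ := by
    rw [div_lt_iff₀ hδ] at hi
    rw [div_le_iff₀ (by positivity)]
    linarith
  -- one more step recovers the form, which the iteration drops
  obtain ⟨N', hN'⟩ := contraction_step hsol hb hweak hK (by positivity) hN hδ
  have hexp : ∀ t ∈ Set.Icc 0 T, Real.exp (2 * K * t) ≤ Real.exp (2 * K * T) := fun t ht =>
    Real.exp_le_exp.2 (mul_le_mul_of_nonneg_left ht.2 (by positivity))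
  have hfin : ∀ k ≥ N', ∀ m ≥ N', ∀ t ∈ Set.Icc 0 T, ‖Z k t - Z m t‖ ^ 2
      + 2 * (∫ s in Set.Icc 0 t, fracForm n α (V.toH (ZV k s - ZV m s)) (V.toH (ZV k s - ZV m s)))
      ≤ 4 * δ * Real.exp (2 * K * T) := by
    intro k hk m hm t ht
    refine (hN' k hk m hm t ht).trans ?_
    exact mul_le_mul (by linarith) (hexp t ht) (Real.exp_pos _).le (by positivity)
  have hpos : 0 < 4 * δ * Real.exp (2 * K * T) := by positivity
  have hsup : ∀ k ≥ N', ∀ m ≥ N', ∀ t ∈ Set.Icc 0 T,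
      ‖Z k t - Z m t‖ ^ 2 ≤ 4 * δ * Real.exp (2 * K * T) := by
    intro k hk m hm t ht
    have := hfin k hk m hm t ht
    linarith [hform k m t]
  refine ⟨N', fun k hk m hm => ⟨fun t ht => (hsup k hk m hm t ht).trans ?_, ?_⟩⟩
  · nlinarith
  · have hd := (hsol k).sub (hsol m) hp
    have i1 : Integrable (fun s => ‖Z k s - Z m s‖ ^ 2) (volume.restrict (Set.Icc 0 T)) :=
      (hd.cont.norm.pow 2).integrableOn_Icc
    have e : ∫ s in Set.Icc 0 T, ‖ZV k s - ZV m s‖ ^ 2 = ∫ s in Set.Icc 0 T,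
        (‖Z k s - Z m s‖ ^ 2
          + fracForm n α (V.toH (ZV k s - ZV m s)) (V.toH (ZV k s - ZV m s))) := by
      refine integral_congr_ae ?_
      filter_upwards [hd.ae_eq] with s hs
      rw [V.norm_sq_eq, hs]
    rw [e, integral_add i1 (integrable_fracForm hd.memV hd.memV)]
    have h1 : ∫ s in Set.Icc 0 T, ‖Z k s - Z m s‖ ^ 2
        ≤ ∫ _ in Set.Icc 0 T, 4 * δ * Real.exp (2 * K * T) := by
      refine integral_mono_ae i1 (integrable_const _) ?_
      filter_upwards [ae_restrict_mem measurableSet_Icc] with s hs using hsup k hk m hm s hs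
    simp only [integral_const, measureReal_restrict_apply_univ, Real.volume_real_Icc, sub_zero,
      smul_eq_mul, max_eq_left hT.le] at h1
    have h2 := hfin k hk m hm T ⟨hT.le, le_rfl⟩
    have h3 := sq_nonneg ‖Z k T - Z m T‖
    nlinarith

end Sequence

end ControlSystem

/-! ### Passage to the limit in the equation -/

theorem tendsto_zero_of_le_mul_add {a b : ℕ → ℝ} {A : ℝ} (ha : ∀ k, 0 ≤ a k)
    (hb : Tendsto b atTop (𝓝 0)) (h : ∀ η > 0, ∀ k, a k ≤ η * A + η⁻¹ * b k) :
    Tendsto a atTop (𝓝 0) := by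
  rw [Metric.tendsto_atTop]
  intro ε hε
  obtain ⟨η, hη, hηA⟩ : ∃ η, 0 < η ∧ η * A ≤ ε / 2 := by
    refine ⟨ε / (2 * (|A| + 1)), by positivity, ?_⟩
    rw [div_mul_eq_mul_div, div_le_iff₀ (by positivity)]
    nlinarith [le_abs_self A, abs_nonneg A]
  obtain ⟨N, hN⟩ := Metric.tendsto_atTop.1 hb (η * (ε / 2)) (by positivity)
  refine ⟨N, fun k hk => ?_⟩
  have h1 := hN k hk
  rw [Real.dist_eq, sub_zero] at h1 ⊢
  rw [abs_of_nonneg (ha k)]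
  have h2 := h η hη k
  have h3 : η⁻¹ * b k < η⁻¹ * (η * (ε / 2)) :=
    mul_lt_mul_of_pos_left ((le_abs_self _).trans_lt h1) (by positivity)
  rw [inv_mul_cancel_left₀ hη.ne'] at h3
  linarith

/-- A form of Vitali's theorem: the functions `h k` are dominated by a fixed integrable function, up
to small multiples of functions `D k` that are bounded in `L¹`. -/
theorem tendsto_integral_zero_of_small_add {X : Type*} [MeasurableSpace X] {μ : Measure X}
    {h D : ℕ → X → ℝ} (hi : ∀ k, Integrable (h k) μ) (h0 : ∀ k x, 0 ≤ h k x)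
    (hlim : ∀ᵐ x ∂μ, Tendsto (fun k => h k x) atTop (𝓝 0)) (hD : ∀ k, Integrable (D k) μ)
    (hD0 : ∀ k x, 0 ≤ D k x) {R : ℝ} (hR : ∀ k, ∫ x, D k x ∂μ ≤ R)
    (hdom : ∀ η > 0, ∃ G : X → ℝ, Integrable G μ ∧ ∀ k, ∀ᵐ x ∂μ, h k x ≤ η * D k x + G x) :
    Tendsto (fun k => ∫ x, h k x ∂μ) atTop (𝓝 0) := by
  rw [Metric.tendsto_atTop]
  intro ε hε
  obtain ⟨η, hη, hηA⟩ : ∃ η, 0 < η ∧ η * R ≤ ε / 2 := by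
    refine ⟨ε / (2 * (|R| + 1)), by positivity, ?_⟩
    rw [div_mul_eq_mul_div, div_le_iff₀ (by positivity)]
    nlinarith [le_abs_self R, abs_nonneg R]
  obtain ⟨G, hG, hdom⟩ := hdom η hη
  have hm : ∀ k, AEStronglyMeasurable (fun x => max (h k x - η * D k x) 0) μ := fun k =>
    ((hi k).1.sub ((hD k).1.const_mul η)).sup aestronglyMeasurable_const
  have hle : ∀ k, ∀ᵐ x ∂μ, ‖max (h k x - η * D k x) 0‖ ≤ |G x| := by
    intro k
    filter_upwards [hdom k] with x hx
    rw [Real.norm_of_nonneg (le_max_right _ _)]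
    exact max_le (by linarith [le_abs_self (G x)]) (abs_nonneg _)
  have ht : Tendsto (fun k => ∫ x, max (h k x - η * D k x) 0 ∂μ) atTop (𝓝 (∫ _, (0 : ℝ) ∂μ)) := by
    refine tendsto_integral_of_dominated_convergence (fun x => |G x|) hm hG.abs hle ?_
    filter_upwards [hlim] with x hx
    refine squeeze_zero (fun k => le_max_right _ _) (fun k => ?_) hx
    exact max_le (by linarith [mul_nonneg hη.le (hD0 k x)]) (h0 k x)
  rw [integral_zero] at ht
  obtain ⟨N, hN⟩ := Metric.tendsto_atTop.1 ht (ε / 2) (by positivity)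
  refine ⟨N, fun k hk => ?_⟩
  have h1 := hN k hk
  rw [Real.dist_eq, sub_zero] at h1 ⊢
  rw [abs_of_nonneg (integral_nonneg (h0 k))]
  have h2 := (le_abs_self _).trans_lt h1
  have im : Integrable (fun x => max (h k x - η * D k x) 0) μ := hG.abs.mono' (hm k) (hle k)
  have h3 : ∫ x, h k x ∂μ ≤ ∫ x, (max (h k x - η * D k x) 0 + η * D k x) ∂μ := by
    refine integral_mono (hi k) (im.add ((hD k).const_mul η)) fun x => ?_
    have := le_max_left (h k x - η * D k x) 0
    simp only
    linarith
  rw [integral_add im ((hD k).const_mul η), integral_const_mul] at h3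
  have := mul_le_mul_of_nonneg_left (hR k) hη.le
  linarith

namespace ControlSystem

variable {n : ℕ} {α : Set.Ioo (0 : ℝ) 1} {T p : ℝ} {S : ControlSystem n T p}

section Limit

variable {u₀ : H n} {R : ℝ} {Z : ℕ → ℝ → H n} {ZV : ℕ → ℝ → V n α} {U : ℕ → ℝ × E n → ℝ}
  {w : ℕ → ℝ → Ell2} {Z' : ℝ → H n} {ZV' : ℝ → V n α} {U' : ℝ × E n → ℝ} {w' : ℝ → Ell2}

theorem tendsto_integral_sub_sq
    (hsol : ∀ k, WeakSol T p u₀ (Z k) (ZV k) (U k) (S.forcing (U k) (w k)))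
    (hb : ∀ k, Bounded T p R (Z k) (ZV k) (U k) (w k)) (hcont : Continuous Z')
    (hU : StronglyMeasurable U') (hs : ∀ s, (fun x => U' (s, x)) =ᵐ[volume] Z' s)
    (hZ : ∀ t ∈ Set.Icc 0 T, Tendsto (fun k => Z k t) atTop (𝓝 (Z' t))) :
    Tendsto (fun k => ∫ y, (U k y - U' y) ^ 2 ∂slab n T) atTop (𝓝 0) := by
  have hR' : ∀ t ∈ Set.Icc 0 T, ‖Z' t‖ ^ 2 ≤ R := fun t ht =>
    le_of_tendsto ((hZ t ht).norm.pow 2) (Eventually.of_forall fun k => (hb k).sup t ht)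
  have hsl : ∀ k s, (fun x => U k (s, x) - U' (s, x)) =ᵐ[volume] (Z k s - Z' s : H n) :=
    fun k s => slice_sub ((hsol k).slice s) (hs s)
  have e : ∀ k, ∫ y, (U k y - U' y) ^ 2 ∂slab n T = ∫ s in Set.Icc 0 T, ‖Z k s - Z' s‖ ^ 2 := by
    intro k
    have hi : Integrable (fun y => (U k y - U' y) ^ 2) (slab n T) :=
      ((hsol k).memLp_two.sub (memLp_two_of_slice hU hcont hs T)).integrable_sq
    rw [integral_prod _ hi]
    refine integral_congr_ae (ae_of_all _ fun s => ?_)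
    exact (integral_slice_sq (U := fun y => U k y - U' y) (hsl k s)).2
  simp only [e]
  rw [show 𝓝 (0 : ℝ) = 𝓝 (∫ _ in Set.Icc 0 T, (0 : ℝ)) by simp]
  refine tendsto_integral_of_dominated_convergence (fun _ => 4 * R)
    (fun k => (((hsol k).cont.sub hcont).norm.pow 2).aestronglyMeasurable) (integrable_const _)
    (fun k => ?_) ?_
  · filter_upwards [ae_restrict_mem measurableSet_Icc] with s hsT
    rw [Real.norm_of_nonneg (sq_nonneg _)]
    exact norm_sub_sq_le_four_mul ((hb k).sup s hsT) (hR' s hsT)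
  · filter_upwards [ae_restrict_mem measurableSet_Icc] with s hsT
    have := ((hZ s hsT).sub_const (Z' s)).norm.pow 2
    simpa using this

/-- A sequence of solutions converges almost everywhere along a subsequence. -/
theorem exists_subseq_tendsto_ae
    (hsol : ∀ k, WeakSol T p u₀ (Z k) (ZV k) (U k) (S.forcing (U k) (w k)))
    (hb : ∀ k, Bounded T p R (Z k) (ZV k) (U k) (w k)) (hcont : Continuous Z')
    (hU : StronglyMeasurable U') (hs : ∀ s, (fun x => U' (s, x)) =ᵐ[volume] Z' s)
    (hZ : ∀ t ∈ Set.Icc 0 T, Tendsto (fun k => Z k t) atTop (𝓝 (Z' t))) :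
    ∃ ns : ℕ → ℕ, StrictMono ns ∧
      ∀ᵐ y ∂slab n T, Tendsto (fun k => U (ns k) y) atTop (𝓝 (U' y)) := by
  have ht := tendsto_integral_sub_sq hsol hb hcont hU hs hZ
  refine TendstoInMeasure.exists_seq_tendsto_ae (tendstoInMeasure_of_tendsto_eLpNorm two_ne_zero
    (fun k => (hsol k).meas.aestronglyMeasurable) hU.aestronglyMeasurable ?_)
  have e : ∀ k, eLpNorm (U k - U') 2 (slab n T)
      = ENNReal.ofReal ((∫ y, (U k y - U' y) ^ 2 ∂slab n T) ^ (2⁻¹ : ℝ)) := by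
    intro k
    rw [((hsol k).memLp_two.sub (memLp_two_of_slice hU hcont hs T)).eLpNorm_eq_integral_rpow_norm
      two_ne_zero (by norm_num)]
    simp
  simp only [e]
  have h1 := ht.rpow_const (p := (2⁻¹ : ℝ)) (Or.inr (by norm_num))
  rw [Real.zero_rpow (by norm_num)] at h1
  simpa using ENNReal.tendsto_ofReal h1

/-- The limit is in `L^p`, by Fatou's lemma. -/
theorem memLp_of_tendsto_ae
    (hsol : ∀ k, WeakSol T p u₀ (Z k) (ZV k) (U k) (S.forcing (U k) (w k)))
    (hb : ∀ k, Bounded T p R (Z k) (ZV k) (U k) (w k)) (hU : StronglyMeasurable U')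
    (hae : ∀ᵐ y ∂slab n T, Tendsto (fun k => U k y) atTop (𝓝 (U' y))) :
    MemLp U' (ENNReal.ofReal p) (slab n T) := by
  have hp := S.two_lt
  refine ⟨hU.aestronglyMeasurable, lt_of_le_of_lt (Lp.eLpNorm_lim_le_liminf_eLpNorm
    (fun k => (hsol k).meas.aestronglyMeasurable) U' hae) (lt_of_le_of_lt
    (liminf_le_of_frequently_le' (Frequently.of_forall fun k => ?_))
    (ENNReal.ofReal_lt_top (r := R ^ p⁻¹)))⟩
  rw [(hsol k).memLp.eLpNorm_eq_integral_rpow_norm (by simpa using by linarith)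
    ENNReal.ofReal_ne_top, ENNReal.toReal_ofReal (by linarith)]
  refine ENNReal.ofReal_le_ofReal (Real.rpow_le_rpow (integral_nonneg fun y => by positivity)
    (hb k).pow (by positivity))

/-- The drift passes to the limit, as `F(U k) f` is dominated, up to a small multiple of the energy
density of `U k`, by a fixed function. -/
theorem tendsto_integral_drift
    (hsol : ∀ k, WeakSol T p u₀ (Z k) (ZV k) (U k) (S.forcing (U k) (w k)))
    (hb : ∀ k, Bounded T p R (Z k) (ZV k) (U k) (w k)) (hU : StronglyMeasurable U')
    (hU2 : MemLp U' 2 (slab n T))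
    (hae : ∀ᵐ y ∂slab n T, Tendsto (fun k => U k y) atTop (𝓝 (U' y)))
    {f : E n → ℝ} (hf2 : MemLp f 2 volume) (hfp : MemLp f (ENNReal.ofReal p) volume)
    {t : ℝ} (ht : t ∈ Set.Icc 0 T) :
    Tendsto (fun k => ∫ y, S.F y (U k y) * f y.2 ∂slab n t) atTop
      (𝓝 (∫ y, S.F y (U' y) * f y.2 ∂slab n t)) := by
  have hT := S.T_pos
  have hp := S.two_lt
  have hUp := memLp_of_tendsto_ae hsol hb hU hae
  have hms := slab_mono (n := n) ht.2
  have ik : ∀ k, Integrable (fun y => S.F y (U k y) * f y.2) (slab n T) := fun k =>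
    (S.memSumLp_drift (hsol k).meas (hsol k).memLp_two (hsol k).memLp).integrable_mul_test
      hp hf2 hfp
  have i' : Integrable (fun y => S.F y (U' y) * f y.2) (slab n T) :=
    (S.memSumLp_drift hU hU2 hUp).integrable_mul_test hp hf2 hfp
  have idiff : ∀ k, Integrable (fun y => |S.F y (U k y) * f y.2 - S.F y (U' y) * f y.2|)
      (slab n T) := fun k => ((ik k).sub i').abs
  have iD : ∀ k, Integrable (fun y => U k y ^ 2 + |U k y| ^ p) (slab n T) := fun k =>
    (hsol k).memLp_two.integrable_sq.add (integrable_abs_rpow (by linarith) (hsol k).memLp)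
  have iD' : Integrable (fun y => U' y ^ 2 + |U' y| ^ p) (slab n T) :=
    hU2.integrable_sq.add (integrable_abs_rpow (by linarith) hUp)
  have if2 : Integrable (fun y : ℝ × E n => f y.2 ^ 2) (slab n T) :=
    (hf2.comp_snd _).integrable_sq
  have ifp : Integrable (fun y : ℝ × E n => |f y.2| ^ p) (slab n T) :=
    integrable_abs_rpow (U := fun y : ℝ × E n => f y.2) (by linarith) (hfp.comp_snd _)
  have iff : Integrable (fun y : ℝ × E n => f y.2 ^ 2 + |f y.2| ^ p) (slab n T) := if2.add ifp
  have main : Tendsto (fun k => ∫ y, |S.F y (U k y) * f y.2 - S.F y (U' y) * f y.2| ∂slab n T)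
      atTop (𝓝 0) := by
    refine tendsto_integral_zero_of_small_add (D := fun k y => U k y ^ 2 + |U k y| ^ p)
      (R := T * R + R) idiff (fun k y => abs_nonneg _) ?_ iD (fun k y => by positivity)
      (fun k => ?_) fun η hη => ?_
    · filter_upwards [hae] with y hy
      have h1 : Tendsto (fun k => S.F y (U k y)) atTop (𝓝 (S.F y (U' y))) :=
        ((S.F_cont.comp (Continuous.prodMk_right y)).tendsto (U' y)).comp hy
      have h2 := ((h1.mul_const (f y.2)).sub_const (S.F y (U' y) * f y.2)).abs
      simpa using h2
    · rw [integral_add (hsol k).memLp_two.integrable_sq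
        (integrable_abs_rpow (by linarith) (hsol k).memLp)]
      exact add_le_add (integral_sq_slab_le hT.le (hsol k).meas (hsol k).cont (hsol k).slice
        (hb k).sup) (hb k).pow
    · obtain ⟨c, hc, hF⟩ := S.drift_mul_le hη
      refine ⟨fun y => η * (U' y ^ 2 + |U' y| ^ p) + 2 * c * (f y.2 ^ 2 + |f y.2| ^ p),
        (iD'.const_mul η).add (iff.const_mul (2 * c)), fun k => ?_⟩
      filter_upwards [hF] with y hy
      have h1 := hy (U k y) (f y.2)
      have h2 := hy (U' y) (f y.2)
      have h3 := abs_sub (S.F y (U k y) * f y.2) (S.F y (U' y) * f y.2)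
      linarith
  rw [tendsto_iff_norm_sub_tendsto_zero]
  refine squeeze_zero (fun k => norm_nonneg _) (fun k => ?_) main
  rw [← integral_sub ((ik k).mono_measure hms) (i'.mono_measure hms)]
  refine (norm_integral_le_integral_norm _).trans ?_
  exact integral_mono_measure hms (ae_of_all _ fun y => abs_nonneg _) (idiff k)

/-- The noise integral as an inner product in `L²(0,T;l²)`, on which weak convergence of the
controls acts. -/
theorem integral_noise_eq (hU : StronglyMeasurable U') (hcont : Continuous Z')
    (hs : ∀ s, (fun x => U' (s, x)) =ᵐ[volume] Z' s) {v : ℝ → Ell2}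
    (hv : MemLp v 2 (volume.restrict (Set.Icc 0 T))) (f : H n) {t : ℝ} (ht : t ∈ Set.Icc 0 T) :
    ∫ y, inner ℝ (S.B y (U' y)) (v y.1) * f y.2 ∂slab n t
      = ∫ s in Set.Icc 0 T, inner ℝ
        ((Set.Icc 0 t).indicator (S.noisePairing U' fun y => f y.2) s) (v s) := by
  have hm : volume.restrict (Set.Icc 0 t) ≤ volume.restrict (Set.Icc 0 T) :=
    Measure.restrict_mono (Set.Icc_subset_Icc_right ht.2) le_rfl
  have hi : Integrable (fun y => inner ℝ (S.B y (U' y)) (v y.1) * f y.2) (slab n T) :=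
    (S.memLp_noise hU hcont hs hv).integrable_mul ((Lp.memLp f).comp_snd _)
  rw [integral_prod _ (hi.mono_measure (slab_mono ht.2))]
  have e : ∀ s, (inner ℝ ((Set.Icc 0 t).indicator (S.noisePairing U' fun y => f y.2) s) (v s) : ℝ)
      = (Set.Icc 0 t).indicator
        (fun s => inner ℝ (S.noisePairing U' (fun y => f y.2) s) (v s)) s := by
    intro s
    by_cases hs : s ∈ Set.Icc 0 t <;> simp [hs]
  simp only [e]
  rw [setIntegral_indicator measurableSet_Icc,
    Set.inter_eq_right.2 (Set.Icc_subset_Icc_right ht.2)]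
  refine integral_congr_ae ?_
  filter_upwards [ae_mono hm (S.ae_noisePairing hU hs (z := fun y => f y.2) (ζ := fun _ => f)
    fun s => ae_eq_refl _)] with s hP
  exact (hP.1 (v s)).2

theorem memLp_noisePairing_indicator (hU : StronglyMeasurable U')
    (hs : ∀ s, (fun x => U' (s, x)) =ᵐ[volume] Z' s)
    (hR : ∀ t ∈ Set.Icc 0 T, ‖Z' t‖ ^ 2 ≤ R) (f : H n) (t : ℝ) :
    MemLp ((Set.Icc 0 t).indicator (S.noisePairing U' fun y => f y.2)) 2
      (volume.restrict (Set.Icc 0 T)) := by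
  have hC := S.C_nonneg
  refine MemLp.indicator measurableSet_Icc (MemLp.of_bound
    (S.aestronglyMeasurable_noisePairing hU (Lp.aestronglyMeasurable f).comp_snd)
    (‖f‖ ^ 2 + (2 * S.C + 2 * S.C ^ 2 * R)) ?_)
  filter_upwards [S.ae_noisePairing hU hs (z := fun y => f y.2) (ζ := fun _ => f)
    fun s => ae_eq_refl _, ae_restrict_mem measurableSet_Icc] with s hP hsT
  have := mul_le_mul_of_nonneg_left (hR s hsT) (show 0 ≤ 2 * S.C ^ 2 by positivity)
  linarith [hP.2]

/-- In the noise term the coefficient converges strongly and the control weakly. -/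
theorem tendsto_integral_noise
    (hsol : ∀ k, WeakSol T p u₀ (Z k) (ZV k) (U k) (S.forcing (U k) (w k)))
    (hb : ∀ k, Bounded T p R (Z k) (ZV k) (U k) (w k)) (hcont : Continuous Z')
    (hU : StronglyMeasurable U') (hs : ∀ s, (fun x => U' (s, x)) =ᵐ[volume] Z' s)
    (hZ : ∀ t ∈ Set.Icc 0 T, Tendsto (fun k => Z k t) atTop (𝓝 (Z' t)))
    (hw' : MemLp w' 2 (volume.restrict (Set.Icc 0 T)))
    (hw : ∀ P : ℝ → Ell2, MemLp P 2 (volume.restrict (Set.Icc 0 T)) →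
      Tendsto (fun k => ∫ s in Set.Icc 0 T, (inner ℝ (P s) (w k s) : ℝ)) atTop
        (𝓝 (∫ s in Set.Icc 0 T, inner ℝ (P s) (w' s))))
    (f : H n) {t : ℝ} (ht : t ∈ Set.Icc 0 T) :
    Tendsto (fun k => ∫ y, inner ℝ (S.B y (U k y)) (w k y.1) * f y.2 ∂slab n t) atTop
      (𝓝 (∫ y, inner ℝ (S.B y (U' y)) (w' y.1) * f y.2 ∂slab n t)) := by
  have hC := S.C_nonneg
  have hms := slab_mono (n := n) ht.2
  have hR' : ∀ t ∈ Set.Icc 0 T, ‖Z' t‖ ^ 2 ≤ R := fun t ht =>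
    le_of_tendsto ((hZ t ht).norm.pow 2) (Eventually.of_forall fun k => (hb k).sup t ht)
  have hU2 := memLp_two_of_slice hU hcont hs T
  have hf : MemLp (fun y : ℝ × E n => f y.2) 2 (slab n T) := (Lp.memLp f).comp_snd _
  have i1 : ∀ k, Integrable (fun y => inner ℝ (S.B y (U k y)) (w k y.1) * f y.2) (slab n T) :=
    fun k => (S.memLp_noise (hsol k).meas (hsol k).cont (hsol k).slice
      (hb k).memLp_w).integrable_mul hf
  have i2 : ∀ k, Integrable (fun y => inner ℝ (S.B y (U' y)) (w k y.1) * f y.2) (slab n T) :=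
    fun k => (S.memLp_noise hU hcont hs (hb k).memLp_w).integrable_mul hf
  have lim1 : Tendsto (fun k => ∫ y, inner ℝ (S.B y (U' y)) (w k y.1) * f y.2 ∂slab n t) atTop
      (𝓝 (∫ y, inner ℝ (S.B y (U' y)) (w' y.1) * f y.2 ∂slab n t)) := by
    rw [integral_noise_eq hU hcont hs hw' f ht]
    exact (hw _ (memLp_noisePairing_indicator hU hs hR' f t)).congr fun k =>
      (integral_noise_eq hU hcont hs (hb k).memLp_w f ht).symm
  have idiff : ∀ k, Integrable (fun y => |inner ℝ (S.B y (U k y)) (w k y.1) * f y.2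
      - inner ℝ (S.B y (U' y)) (w k y.1) * f y.2|) (slab n T) := fun k => ((i1 k).sub (i2 k)).abs
  have main : Tendsto (fun k => ∫ y, |inner ℝ (S.B y (U k y)) (w k y.1) * f y.2
      - inner ℝ (S.B y (U' y)) (w k y.1) * f y.2| ∂slab n T) atTop (𝓝 0) := by
    refine tendsto_zero_of_le_mul_add (A := R * ‖f‖ ^ 2)
      (b := fun k => S.C ^ 2 * ∫ y, (U k y - U' y) ^ 2 ∂slab n T)
      (fun k => integral_nonneg fun y => abs_nonneg _) ?_ fun η hη k => ?_
    · simpa using (tendsto_integral_sub_sq hsol hb hcont hU hs hZ).const_mul (S.C ^ 2)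
    · have iw : Integrable (fun s => ‖w k s‖ ^ 2) (volume.restrict (Set.Icc 0 T)) :=
        (memLp_two_iff_integrable_sq_norm (hb k).memLp_w.1).1 (hb k).memLp_w
      have iwf : Integrable (fun y : ℝ × E n => ‖w k y.1‖ ^ 2 * f y.2 ^ 2) (slab n T) :=
        iw.mul_prod (Lp.memLp f).integrable_sq
      have iU : Integrable (fun y => (U k y - U' y) ^ 2) (slab n T) :=
        ((hsol k).memLp_two.sub hU2).integrable_sq
      have e : ∫ y : ℝ × E n, ‖w k y.1‖ ^ 2 * f y.2 ^ 2 ∂slab n T ≤ R * ‖f‖ ^ 2 := by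
        rw [integral_prod_mul (fun s => ‖w k s‖ ^ 2) (fun x => f x ^ 2)]
        have : ∫ x, f x ^ 2 = ‖f‖ ^ 2 := (integral_slice_sq (U := fun y => f y.2) (s := 0)
          (ae_eq_refl _)).2
        rw [this]
        exact mul_le_mul_of_nonneg_right (hb k).control (sq_nonneg _)
      calc ∫ y, |inner ℝ (S.B y (U k y)) (w k y.1) * f y.2
              - inner ℝ (S.B y (U' y)) (w k y.1) * f y.2| ∂slab n T
          ≤ ∫ y, (η * (‖w k y.1‖ ^ 2 * f y.2 ^ 2)
              + η⁻¹ * S.C ^ 2 * (U k y - U' y) ^ 2) ∂slab n T := by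
            refine integral_mono (idiff k) ((iwf.const_mul _).add (iU.const_mul _)) fun y => ?_
            simp only
            rw [← sub_mul, ← inner_sub_left, abs_mul]
            have h1 : |inner ℝ (S.B y (U k y) - S.B y (U' y)) (w k y.1)|
                ≤ S.C * |U k y - U' y| * ‖w k y.1‖ := (abs_real_inner_le_norm _ _).trans
              (mul_le_mul_of_nonneg_right (S.B_lip _ _ _) (norm_nonneg _))
            have h2 := mul_le_mul_of_nonneg_right h1 (abs_nonneg (f y.2))
            have h3 := mul_le_young (a := ‖w k y.1‖ * |f y.2|) (b := S.C * |U k y - U' y|) hη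
            rw [mul_pow, mul_pow, sq_abs, sq_abs] at h3
            linarith
        _ = η * (∫ y, ‖w k y.1‖ ^ 2 * f y.2 ^ 2 ∂slab n T)
              + η⁻¹ * (S.C ^ 2 * ∫ y, (U k y - U' y) ^ 2 ∂slab n T) := by
            rw [integral_add (iwf.const_mul _) (iU.const_mul _), integral_const_mul,
              integral_const_mul, mul_assoc]
        _ ≤ _ := by
            have := mul_le_mul_of_nonneg_left e hη.le
            linarith
  have lim2 : Tendsto (fun k => (∫ y, inner ℝ (S.B y (U k y)) (w k y.1) * f y.2 ∂slab n t)
      - ∫ y, inner ℝ (S.B y (U' y)) (w k y.1) * f y.2 ∂slab n t) atTop (𝓝 0) := by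
    refine squeeze_zero_norm (fun k => ?_) main
    rw [← integral_sub ((i1 k).mono_measure hms) ((i2 k).mono_measure hms)]
    refine (norm_integral_le_integral_norm _).trans ?_
    exact integral_mono_measure hms (ae_of_all _ fun y => abs_nonneg _) (idiff k)
  simpa using lim2.add lim1

theorem tendsto_integral_form
    (hZVk : ∀ k, MemLp (ZV k) 2 (volume.restrict (Set.Icc 0 T)))
    (hZV' : MemLp ZV' 2 (volume.restrict (Set.Icc 0 T)))
    (hZV : Tendsto (fun k => ∫ s in Set.Icc 0 T, ‖ZV k s - ZV' s‖ ^ 2) atTop (𝓝 0))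
    (hT : 0 ≤ T) (ξ : V n α) {t : ℝ} (ht : t ∈ Set.Icc 0 T) :
    Tendsto (fun k => ∫ s in Set.Icc 0 t, fracForm n α (V.toH (ZV k s)) (V.toH ξ)) atTop
      (𝓝 (∫ s in Set.Icc 0 t, fracForm n α (V.toH (ZV' s)) (V.toH ξ))) := by
  have hm : volume.restrict (Set.Icc 0 t) ≤ volume.restrict (Set.Icc 0 T) :=
    Measure.restrict_mono (Set.Icc_subset_Icc_right ht.2) le_rfl
  have hint : ∀ {W : ℝ → V n α}, MemLp W 2 (volume.restrict (Set.Icc 0 T)) →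
      Integrable (fun s => fracForm n α (V.toH (W s)) (V.toH ξ))
        (volume.restrict (Set.Icc 0 T)) := fun hW => integrable_fracForm hW (memLp_const ξ)
  have hd : ∀ k, MemLp (fun s => ZV k s - ZV' s) 2 (volume.restrict (Set.Icc 0 T)) :=
    fun k => (hZVk k).sub hZV'
  have main : Tendsto (fun k => ∫ s in Set.Icc 0 T,
      |fracForm n α (V.toH (ZV k s - ZV' s)) (V.toH ξ)|) atTop (𝓝 0) := by
    refine tendsto_zero_of_le_mul_add (A := T * (2 * ‖ξ‖) ^ 2)
      (fun k => integral_nonneg fun s => abs_nonneg _) hZV fun η hη k => ?_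
    have iV : Integrable (fun s => ‖ZV k s - ZV' s‖ ^ 2) (volume.restrict (Set.Icc 0 T)) :=
      (memLp_two_iff_integrable_sq_norm (hd k).1).1 (hd k)
    have : ∫ s in Set.Icc 0 T, |fracForm n α (V.toH (ZV k s - ZV' s)) (V.toH ξ)|
        ≤ ∫ s in Set.Icc 0 T, (η * (2 * ‖ξ‖) ^ 2 + η⁻¹ * ‖ZV k s - ZV' s‖ ^ 2) := by
      refine integral_mono (hint (hd k)).abs ((integrable_const _).add (iV.const_mul _))
        fun s => ?_
      have h1 := V.abs_fracForm_le (ZV k s - ZV' s) ξ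
      have h2 := mul_le_young (a := 2 * ‖ξ‖) (b := ‖ZV k s - ZV' s‖) hη
      simp only
      linarith
    rw [integral_add (integrable_const _) (iV.const_mul _),
      integral_const_mul η⁻¹] at this
    simp only [integral_const, measureReal_restrict_apply_univ, Real.volume_real_Icc, sub_zero,
      smul_eq_mul, max_eq_left hT] at this
    linarith
  rw [tendsto_iff_norm_sub_tendsto_zero]
  refine squeeze_zero (fun k => norm_nonneg _) (fun k => ?_) main
  rw [← integral_sub ((hint (hZVk k)).mono_measure hm) ((hint hZV').mono_measure hm)]
  refine (norm_integral_le_integral_norm _).trans (le_trans (le_of_eq ?_)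
    (integral_mono_measure hm (ae_of_all _ fun s => abs_nonneg _) (hint (hd k)).abs))
  refine integral_congr_ae (ae_of_all _ fun s => ?_)
  beta_reduce
  rw [Real.norm_eq_abs, ← fracBilin_apply, ← fracBilin_apply, ← fracBilin_apply, map_sub]
  rfl

theorem setIntegral_forcing_mul {W : ℝ × E n → ℝ} {ζ : ℝ → H n} {v : ℝ → Ell2}
    (hW : StronglyMeasurable W) (hζ : Continuous ζ)
    (hWs : ∀ s, (fun x => W (s, x)) =ᵐ[volume] ζ s) (hWp : MemLp W (ENNReal.ofReal p) (slab n T))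
    (hv : MemLp v 2 (volume.restrict (Set.Icc 0 T))) {f : H n}
    (hf : MemLp f (ENNReal.ofReal p) volume) {t : ℝ} (ht : t ∈ Set.Icc 0 T) :
    ∫ s in Set.Icc 0 t, ∫ x, S.forcing W v (s, x) * f x
      = (∫ y, S.g y * f y.2 ∂slab n t) - (∫ y, S.F y (W y) * f y.2 ∂slab n t)
        + ∫ y, inner ℝ (S.B y (W y)) (v y.1) * f y.2 ∂slab n t := by
  have hp := S.two_lt
  have hms := slab_mono (n := n) ht.2
  have hf2 := Lp.memLp f
  have j1 : Integrable (fun y => S.g y * f y.2) (slab n t) :=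
    (S.g_mem.integrable_mul (hf2.comp_snd _)).mono_measure hms
  have j2 : Integrable (fun y => S.F y (W y) * f y.2) (slab n t) :=
    ((S.memSumLp_drift hW (memLp_two_of_slice hW hζ hWs T) hWp).integrable_mul_test
      hp hf2 hf).mono_measure hms
  have j3 : Integrable (fun y => inner ℝ (S.B y (W y)) (v y.1) * f y.2) (slab n t) :=
    ((S.memLp_noise hW hζ hWs hv).integrable_mul (hf2.comp_snd _)).mono_measure hms
  have j12 : Integrable (fun y => S.g y * f y.2 - S.F y (W y) * f y.2) (slab n t) := j1.sub j2
  rw [← integral_sub j1 j2, ← integral_add j12 j3, ← integral_prod (fun y =>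
    S.forcing W v y * f y.2) (((S.memSumLp_forcing hW hζ hWs hWp hv).integrable_mul_test
      hp hf2 hf).mono_measure hms)]
  refine integral_congr_ae (ae_of_all _ fun y => ?_)
  simp only [forcing]
  ring

/-- Strong limits of solutions, along weakly convergent controls, are solutions. -/
theorem weakSol_of_tendsto
    (hsol : ∀ k, WeakSol T p u₀ (Z k) (ZV k) (U k) (S.forcing (U k) (w k)))
    (hb : ∀ k, Bounded T p R (Z k) (ZV k) (U k) (w k)) (hcont : Continuous Z')
    (hleft : ∀ t ≤ 0, Z' t = Z' 0) (hZV' : MemLp ZV' 2 (volume.restrict (Set.Icc 0 T)))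
    (hae : ∀ᵐ s ∂volume.restrict (Set.Icc 0 T), Z' s = V.toH (ZV' s))
    (hU : StronglyMeasurable U') (hs : ∀ s, (fun x => U' (s, x)) =ᵐ[volume] Z' s)
    (hZ : ∀ t ∈ Set.Icc 0 T, Tendsto (fun k => Z k t) atTop (𝓝 (Z' t)))
    (hZV : Tendsto (fun k => ∫ s in Set.Icc 0 T, ‖ZV k s - ZV' s‖ ^ 2) atTop (𝓝 0))
    (hw' : MemLp w' 2 (volume.restrict (Set.Icc 0 T)))
    (hw : ∀ P : ℝ → Ell2, MemLp P 2 (volume.restrict (Set.Icc 0 T)) →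
      Tendsto (fun k => ∫ s in Set.Icc 0 T, (inner ℝ (P s) (w k s) : ℝ)) atTop
        (𝓝 (∫ s in Set.Icc 0 T, inner ℝ (P s) (w' s)))) :
    WeakSol T p u₀ Z' ZV' U' (S.forcing U' w') := by
  have hT := S.T_pos
  have hp := S.two_lt
  obtain ⟨ns, hns, hns_ae⟩ := exists_subseq_tendsto_ae hsol hb hcont hU hs hZ
  have hsol' := fun k => hsol (ns k)
  have hb' := fun k => hb (ns k)
  have hUp := memLp_of_tendsto_ae hsol' hb' hU hns_ae
  have hU2 := memLp_two_of_slice hU hcont hs T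
  have htop := hns.tendsto_atTop
  have hforce := S.memSumLp_forcing hU hcont hs hUp hw'
  refine ⟨hcont, hleft, hZV', hae, hU, hs, hUp, hforce, fun t ht ξ hξ => ?_⟩
  rw [setIntegral_forcing_mul hU hcont hs hUp hw' hξ ht]
  have l1 : Tendsto (fun k => (inner ℝ (Z (ns k) t) (V.toH ξ) : ℝ)) atTop
      (𝓝 (inner ℝ (Z' t) (V.toH ξ))) := ((hZ t ht).comp htop).inner tendsto_const_nhds
  have l2 := (tendsto_integral_form (fun k => (hsol k).memV) hZV' hZV hT.le ξ ht).comp htop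
  have l3 := tendsto_integral_drift hsol' hb' hU hU2 hns_ae (Lp.memLp (V.toH ξ)) hξ ht
  have l4 := (tendsto_integral_noise hsol hb hcont hU hs hZ hw' hw (V.toH ξ) ht).comp htop
  refine tendsto_nhds_unique (l1.add l2) (Tendsto.congr (fun k => ?_)
    (((l3.const_sub (∫ y, S.g y * V.toH ξ y.2 ∂slab n t)).add l4).const_add
      (inner ℝ u₀ (V.toH ξ))))
  have := (hsol' k).weak t ht ξ hξ
  rw [setIntegral_forcing_mul (hsol' k).meas (hsol' k).cont (hsol' k).slice (hsol' k).memLp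
    (hb' k).memLp_w hξ ht] at this
  exact this.symm

end Limit

end ControlSystem

/-! ### The coefficients in jointly measurable form -/

/-- Composition with a Carathéodory function whose exceptional null sets may depend on the second
argument. -/
theorem aemeasurable_caratheodory {Y : Type*} [MeasurableSpace Y] {μ : Measure Y}
    {f : Y → ℝ → ℝ} (hm : ∀ r, AEMeasurable (fun y => f y r) μ) (hc : ∀ y, Continuous (f y))
    {U : Y → ℝ} (hU : Measurable U) : AEMeasurable (fun y => f y (U y)) μ := by
  have hq : Tendsto (fun m : ℕ => 1 / ((m : ℝ) + 1)) atTop (𝓝 0) :=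
    tendsto_one_div_add_atTop_nhds_zero_nat
  refine aemeasurable_of_tendsto_metrizable_ae'
    (f := fun (m : ℕ) y => f y (⌊((m : ℝ) + 1) * U y⌋ / ((m : ℝ) + 1))) (fun m => ?_)
    (ae_of_all _ fun y => ((hc y).tendsto (U y)).comp ?_)
  · -- countably many null sets suffice, as the argument takes countably many values
    choose G hG hfG using fun z : ℤ => hm ((z : ℝ) / ((m : ℝ) + 1))
    have hGm : Measurable fun y : Y × ℤ => G y.2 y.1 :=
      measurable_from_prod_countable_left fun z => hG z
    have hfl : Measurable fun y => ⌊((m : ℝ) + 1) * U y⌋ :=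
      Int.measurable_floor.comp (hU.const_mul _)
    refine ⟨fun y => G ⌊((m : ℝ) + 1) * U y⌋ y, hGm.comp (measurable_id.prodMk hfl), ?_⟩
    filter_upwards [ae_all_iff.2 hfG] with y hy using hy _
  · have h1 : Tendsto (fun m : ℕ => U y - 1 / ((m : ℝ) + 1)) atTop (𝓝 (U y)) := by
      simpa using hq.const_sub (U y)
    refine tendsto_of_tendsto_of_tendsto_of_le_of_le h1 tendsto_const_nhds (fun m => ?_)
      fun m => ?_
    · have h2 : (0 : ℝ) < (m : ℝ) + 1 := by positivity
      simp only
      rw [le_div_iff₀ h2, sub_mul, one_div_mul_cancel h2.ne']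
      have := Int.sub_one_lt_floor (((m : ℝ) + 1) * U y)
      linarith
    · have h2 : (0 : ℝ) < (m : ℝ) + 1 := by positivity
      simp only
      rw [div_le_iff₀ h2, mul_comm]
      exact Int.floor_le _

theorem exists_ae_bound {X : Type*} [MeasurableSpace X] {μ : Measure X} {f : X → ℝ}
    (hf : MemLp f ∞ μ) : ∃ M, 0 ≤ M ∧ ∀ᵐ x ∂μ, |f x| ≤ M := by
  refine ⟨(eLpNormEssSup f μ).toReal, ENNReal.toReal_nonneg, ?_⟩
  have h : eLpNormEssSup f μ ≠ ∞ := by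
    have := hf.2.ne
    rwa [eLpNorm_exponent_top] at this
  filter_upwards [ae_le_eLpNormEssSup (f := f) (μ := μ)] with x hx
  rw [← Real.norm_eq_abs, ← toReal_enorm]
  exact ENNReal.toReal_mono h hx

section Coefficients

variable {n : ℕ} {T p : ℝ}

/-- The local Lipschitz condition at `0`, with the essential bound of `ψ₂` on the slab. -/
theorem DriftAssumptions.growth {F : ℝ → E n → ℝ → ℝ} {lam₁ lam₂ : ℝ} {ψ₁ ψ₂ ψ₃ : ℝ → E n → ℝ}
    (hF : DriftAssumptions n p F lam₁ lam₂ ψ₁ ψ₂ ψ₃) (hp : 2 < p) (T : ℝ) :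
    ∃ C, 0 ≤ C ∧ ∀ᵐ y ∂slab n T, ∀ r, |F y.1 y.2 r| ≤ C * (|r| + |r| ^ (p - 1)) := by
  obtain ⟨M, hM0, hM⟩ := exists_ae_bound (hF.memLp_ψ₂.1 0 T)
  have hl := hF.lam₂_pos
  refine ⟨lam₂ * (M + 1), by positivity, ?_⟩
  filter_upwards [hM] with y hy r
  have h1 := hF.locLipschitz y.1 y.2 r 0
  rw [hF.at_zero, sub_zero, sub_zero, abs_zero, Real.zero_rpow (by linarith), add_zero] at h1
  have h2 : |r| ^ (p - 2) * |r| = |r| ^ (p - 1) := by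
    rcases (abs_nonneg r).eq_or_lt with h | h
    · rw [← h, mul_zero, Real.zero_rpow (by linarith)]
    · rw [← Real.rpow_add_one h.ne']
      congr 1
      ring
  have h3 : ψ₂ y.1 y.2 * |r| ≤ M * |r| :=
    mul_le_mul_of_nonneg_right ((le_abs_self _).trans hy) (abs_nonneg r)
  have h4 : 0 ≤ |r| ^ (p - 1) := by positivity
  calc |F y.1 y.2 r| ≤ lam₂ * (ψ₂ y.1 y.2 * |r| + |r| ^ (p - 1)) := by rw [← h2]; linarith
    _ ≤ lam₂ * ((M + 1) * (|r| + |r| ^ (p - 1))) := by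
        refine mul_le_mul_of_nonneg_left ?_ hl.le
        nlinarith [abs_nonneg r, mul_nonneg hM0 h4]
    _ = _ := by ring

/-- The lower bound `-ψ₃` of `∂F/∂u` makes `F(r) + M r` monotone, for the essential bound `M` of
`ψ₃`. -/
theorem DriftAssumptions.oneSided {F : ℝ → E n → ℝ → ℝ} {lam₁ lam₂ : ℝ}
    {ψ₁ ψ₂ ψ₃ : ℝ → E n → ℝ} (hF : DriftAssumptions n p F lam₁ lam₂ ψ₁ ψ₂ ψ₃) (T : ℝ) :
    ∃ C, 0 ≤ C ∧ ∀ᵐ y ∂slab n T, ∀ r r',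
      -(C * (r - r') ^ 2) ≤ (F y.1 y.2 r - F y.1 y.2 r') * (r - r') := by
  obtain ⟨M, hM0, hM⟩ := exists_ae_bound (hF.memLp_ψ₃.1 0 T)
  refine ⟨M, hM0, ?_⟩
  filter_upwards [hM] with y hy r r'
  have hd := hF.differentiable y.1 y.2
  have hmono : Monotone fun r => F y.1 y.2 r + M * r := by
    refine monotone_of_deriv_nonneg (hd.add (by fun_prop)) fun r => ?_
    have : deriv (fun r => F y.1 y.2 r + M * r) r = deriv (F y.1 y.2) r + M * 1 :=
      ((hd r).hasDerivAt.add ((hasDerivAt_id r).const_mul M)).deriv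
    rw [this]
    have h1 := hF.deriv_ge y.1 y.2 r
    have h2 := (le_abs_self _).trans hy
    linarith
  rcases le_total r r' with h | h
  · have := hmono h
    simp only at this
    nlinarith
  · have := hmono h
    simp only at this
    nlinarith

theorem exists_joint_memLp {g : ℝ → H n}
    (hg : MemLp g 2 (volume.restrict (Set.Icc 0 T))) :
    ∃ G : ℝ × E n → ℝ, MemLp G 2 (slab n T) ∧
      ∀ᵐ s ∂volume.restrict (Set.Icc 0 T), (fun x => G (s, x)) =ᵐ[volume] g s := by
  obtain ⟨G, hG, hGs⟩ := exists_joint_representative hg.1.stronglyMeasurable_mk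
  have hmk := hg.1.ae_eq_mk
  have hae : ∀ᵐ s ∂volume.restrict (Set.Icc 0 T), (fun x => G (s, x)) =ᵐ[volume] g s := by
    filter_upwards [hmk] with s hs
    rw [hs]
    exact hGs s
  refine ⟨G, ?_, hae⟩
  rw [memLp_two_iff_integrable_sq hG.aestronglyMeasurable]
  refine (integrable_prod_iff (hG.pow 2).aestronglyMeasurable).2 ⟨?_, ?_⟩
  · filter_upwards [hae] with s hs using (ControlSystem.integral_slice_sq hs).1
  · refine ((memLp_two_iff_integrable_sq_norm hg.1).1 hg).congr ?_
    filter_upwards [hae] with s hs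
    rw [← (ControlSystem.integral_slice_sq hs).2]
    refine integral_congr_ae (ae_of_all _ fun x => ?_)
    simp

/-- The noise coefficient as an `l²`-valued function, measurable along measurable functions of time
and space. A bounded version of `κ` makes the bounds hold everywhere, while the formula for the
coefficient holds for almost every `x`. -/
theorem DiffusionAssumptions.exists_coefficient {σ₁ : ℝ → Lp Ell2 2 (volume : Measure (E n))}
    {κ : E n → ℝ} {σ₂ : ℕ → ℝ → E n → ℝ → ℝ} {a b c : ℕ → ℝ}
    (hσ : DiffusionAssumptions n σ₁ κ σ₂ a b c) (T : ℝ) :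
    ∃ (B : ℝ × E n → ℝ → Ell2) (φ : ℝ × E n → ℝ) (C : ℝ), 0 ≤ C ∧
      (∀ U : ℝ × E n → ℝ, StronglyMeasurable U →
        AEStronglyMeasurable (fun y => B y (U y)) (slab n T)) ∧
      (∀ y r r', ‖B y r - B y r'‖ ≤ C * |r - r'|) ∧ (∀ y r, ‖B y r‖ ≤ φ y + C * |r|) ∧
      StronglyMeasurable φ ∧
      (∀ s ∈ Set.Icc 0 T, Integrable (fun x => φ (s, x) ^ 2) ∧ ∫ x, φ (s, x) ^ 2 ≤ C) ∧
      ∀ s, ∀ᵐ x, ∀ (r : ℝ) (e : Ell2), inner ℝ (B (s, x) r) e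
        = ∑' k, ((σ₁ s x : Ell2) k + κ x * σ₂ k s x r) * e k := by
  obtain ⟨Q, hQ⟩ : ∃ Q, Q = ∑' k, (a k ^ 2 + b k ^ 2 + c k ^ 2) := ⟨_, rfl⟩
  have hQ0 : 0 ≤ Q := by rw [hQ]; exact tsum_nonneg fun k => by positivity
  obtain ⟨A, hA⟩ : ∃ A, A = Real.sqrt Q := ⟨_, rfl⟩
  have hA0 : 0 ≤ A := hA ▸ Real.sqrt_nonneg _
  have hAQ : A ^ 2 = Q := by rw [hA, Real.sq_sqrt hQ0]
  -- the bounds of the coefficients are square summable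
  have hsq : ∀ {f : ℕ → ℝ} {q : ℝ}, 0 ≤ q →
      (∀ k, f k ^ 2 ≤ (a k ^ 2 + b k ^ 2 + c k ^ 2) * q ^ 2) →
      Summable (fun k => f k ^ 2) ∧ ∑' k, f k ^ 2 ≤ (A * q) ^ 2 := by
    intro f q hq hf
    have hs := hσ.summable.mul_right (q ^ 2)
    have h1 : Summable fun k => f k ^ 2 :=
      Summable.of_nonneg_of_le (fun k => sq_nonneg _) hf hs
    refine ⟨h1, (h1.tsum_le_tsum hf hs).trans (le_of_eq ?_)⟩
    rw [tsum_mul_right, ← hQ, mul_pow, hAQ]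
  have hgr : ∀ k t x r, σ₂ k t x r ^ 2 ≤ (a k ^ 2 + b k ^ 2 + c k ^ 2) * (1 + |r|) ^ 2 := by
    intro k t x r
    obtain ⟨ha, hb, hc⟩ := hσ.pos k
    have h1 := pow_le_pow_left₀ (abs_nonneg _) (hσ.growth k t x r) 2
    rw [sq_abs] at h1
    refine h1.trans ?_
    have hr := abs_nonneg r
    nlinarith [sq_nonneg (b k - c k), mul_nonneg (sq_nonneg (b k - c k)) hr,
      mul_nonneg (sq_nonneg (a k)) (sq_nonneg (1 + |r|)), mul_nonneg (sq_nonneg (c k)) hr,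
      mul_nonneg (sq_nonneg (b k)) hr, mul_nonneg (sq_nonneg (b k)) (sq_nonneg |r|),
      sq_nonneg (c k)]
  have hmem : ∀ (y : ℝ × E n) r, Memℓp (fun k => σ₂ k y.1 y.2 r) 2 := by
    intro y r
    refine memℓp_gen ?_
    simpa using (hsq (by positivity) fun k => hgr k y.1 y.2 r).1
  let b₂ : ℝ × E n → ℝ → Ell2 := fun y r => ⟨fun k => σ₂ k y.1 y.2 r, hmem y r⟩
  have hb₂ : ∀ y r k, b₂ y r k = σ₂ k y.1 y.2 r := fun _ _ _ => rfl
  have hb₂norm : ∀ y r, ‖b₂ y r‖ ≤ A * (1 + |r|) := by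
    intro y r
    refine le_of_sq_le_sq ?_ (by positivity)
    rw [← (norm_sq_ell2 (b₂ y r)).tsum_eq]
    exact (hsq (by positivity) fun k => hgr k y.1 y.2 r).2
  have hb₂lip : ∀ y r r', ‖b₂ y r - b₂ y r'‖ ≤ A * |r - r'| := by
    intro y r r'
    refine le_of_sq_le_sq ?_ (by positivity)
    rw [← (norm_sq_ell2 (b₂ y r - b₂ y r')).tsum_eq]
    refine (hsq (abs_nonneg _) fun k => ?_).2
    have h1 := pow_le_pow_left₀ (abs_nonneg _) (hσ.lipschitz k y.1 y.2 r r') 2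
    rw [sq_abs, mul_pow] at h1
    refine h1.trans (mul_le_mul_of_nonneg_right ?_ (sq_nonneg _))
    nlinarith [sq_nonneg (b k), sq_nonneg (c k)]
  -- a bounded version of `κ`
  obtain ⟨M, hM0, hM⟩ := exists_ae_bound hσ.memLp_κ.2
  have hκm := hσ.memLp_κ.1.1
  obtain ⟨κ', hκ'⟩ : ∃ κ' : E n → ℝ, κ' = {x | |hκm.mk κ x| ≤ M}.indicator (hκm.mk κ) := ⟨_, rfl⟩
  have hκ'm : StronglyMeasurable κ' := by
    rw [hκ']
    exact hκm.stronglyMeasurable_mk.indicator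
      (measurableSet_le hκm.stronglyMeasurable_mk.norm.measurable measurable_const)
  have hκ'M : ∀ x, |κ' x| ≤ M := by
    intro x
    rw [hκ']
    by_cases hx : |hκm.mk κ x| ≤ M
    · rwa [Set.indicator_of_mem (by exact hx)]
    · rw [Set.indicator_of_notMem (by exact hx), abs_zero]
      exact hM0
  have hκ'ae : κ' =ᵐ[volume] κ := by
    filter_upwards [hM, hκm.ae_eq_mk] with x h1 h2
    rw [hκ', Set.indicator_of_mem (by rw [Set.mem_ofPred_eq, ← h2]; exact h1), ← h2]
  have hκ'2 : MemLp κ' 2 volume := (memLp_congr_ae hκ'ae).2 hσ.memLp_κ.1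
  obtain ⟨S₁, hS₁, hS₁s⟩ := exists_joint_representative hσ.continuous_σ₁.stronglyMeasurable
  obtain ⟨M₁, hM₁⟩ := isCompact_Icc.exists_bound_of_continuousOn
    (s := Set.Icc 0 T) (hσ.continuous_σ₁.norm.pow 2).continuousOn
  have hS₁int : ∀ s, Integrable (fun x => ‖S₁ (s, x)‖ ^ 2) ∧
      ∫ x, ‖S₁ (s, x)‖ ^ 2 = ‖σ₁ s‖ ^ 2 := by
    intro s
    have h1 : MemLp (fun x => S₁ (s, x)) 2 volume :=
      (memLp_congr_ae (hS₁s s)).2 (Lp.memLp (σ₁ s))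
    refine ⟨(memLp_two_iff_integrable_sq_norm h1.1).1 h1, ?_⟩
    rw [← real_inner_self_eq_norm_sq, L2.inner_def]
    refine integral_congr_ae ?_
    filter_upwards [hS₁s s] with x hx
    rw [real_inner_self_eq_norm_sq, hx]
  obtain ⟨C, hC⟩ : ∃ C, C = M * A + (2 * |M₁| + 2 * A ^ 2 * ∫ x, κ' x ^ 2) := ⟨_, rfl⟩
  have hκint0 : 0 ≤ ∫ x, κ' x ^ 2 := integral_nonneg fun x => sq_nonneg _
  have hMA : M * A ≤ C := by rw [hC]; linarith [show
    0 ≤ 2 * |M₁| + 2 * A ^ 2 * ∫ x, κ' x ^ 2 by positivity]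
  have hC2 : 2 * |M₁| + 2 * A ^ 2 * ∫ x, κ' x ^ 2 ≤ C := by
    rw [hC]
    linarith [mul_nonneg hM0 hA0]
  refine ⟨fun y r => S₁ y + κ' y.2 • b₂ y r, fun y => ‖S₁ y‖ + A * |κ' y.2|, C,
    (mul_nonneg hM0 hA0).trans hMA, fun U hU => ?_, fun y r r' => ?_, fun y r => ?_,
    ?_, fun s hs => ?_, fun s => ?_⟩
  · have hle : slab n T ≤ volume := by
      rw [slab_eq_restrict]
      exact Measure.restrict_le_self
    have hκy : AEStronglyMeasurable (fun y : ℝ × E n => κ' y.2) (slab n T) :=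
      (hκ'm.comp_measurable measurable_snd).aestronglyMeasurable
    refine hS₁.aestronglyMeasurable.add (hκy.smul (aestronglyMeasurable_ell2 fun k => ?_))
    simp only [hb₂]
    refine aemeasurable_caratheodory (f := fun y r => σ₂ k y.1 y.2 r)
      (fun r => (hσ.measurable_σ₂ k r).mono_measure hle) (fun y => ?_) hU.measurable
    refine LipschitzWith.continuous (K := ⟨a k, (hσ.pos k).1.le⟩)
      (LipschitzWith.of_dist_le_mul fun r r' => ?_)
    rw [Real.dist_eq, Real.dist_eq]
    exact hσ.lipschitz k y.1 y.2 r r'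
  · rw [add_sub_add_left_eq_sub, ← smul_sub, norm_smul, Real.norm_eq_abs]
    calc |κ' y.2| * ‖b₂ y r - b₂ y r'‖ ≤ M * (A * |r - r'|) :=
          mul_le_mul (hκ'M _) (hb₂lip y r r') (norm_nonneg _) hM0
      _ = M * A * |r - r'| := by ring
      _ ≤ C * |r - r'| := mul_le_mul_of_nonneg_right hMA (abs_nonneg _)
  · refine (norm_add_le _ _).trans ?_
    rw [norm_smul, Real.norm_eq_abs]
    have h1 := mul_le_mul_of_nonneg_left (hb₂norm y r) (abs_nonneg (κ' y.2))
    have h2 := mul_le_mul_of_nonneg_right (hκ'M y.2) (mul_nonneg hA0 (abs_nonneg r))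
    have h3 := mul_le_mul_of_nonneg_right hMA (abs_nonneg r)
    linarith
  · exact hS₁.norm.add ((hκ'm.comp_measurable measurable_snd).norm.const_mul A)
  · have i1 : Integrable (fun x => 2 * ‖S₁ (s, x)‖ ^ 2 + 2 * A ^ 2 * κ' x ^ 2) :=
      ((hS₁int s).1.const_mul 2).add (hκ'2.integrable_sq.const_mul _)
    have hle : ∀ x, (‖S₁ (s, x)‖ + A * |κ' x|) ^ 2
        ≤ 2 * ‖S₁ (s, x)‖ ^ 2 + 2 * A ^ 2 * κ' x ^ 2 := by
      intro x
      rw [← sq_abs (κ' x)]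
      nlinarith [sq_nonneg (‖S₁ (s, x)‖ - A * |κ' x|)]
    have i2 : Integrable (fun x => (‖S₁ (s, x)‖ + A * |κ' x|) ^ 2) := by
      refine i1.mono' ?_ (ae_of_all _ fun x => ?_)
      · exact (((hS₁.comp_measurable measurable_prodMk_left).norm.add
          (hκ'm.norm.const_mul A)).pow 2).aestronglyMeasurable
      · rw [Real.norm_of_nonneg (sq_nonneg _)]
        exact hle x
    refine ⟨i2, (integral_mono i2 i1 hle).trans (le_trans ?_ hC2)⟩
    rw [integral_add ((hS₁int s).1.const_mul 2) (hκ'2.integrable_sq.const_mul _),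
      integral_const_mul, integral_const_mul, (hS₁int s).2]
    have : ‖σ₁ s‖ ^ 2 ≤ |M₁| := (le_abs_self _).trans ((hM₁ s hs).trans (le_abs_self M₁))
    linarith
  · filter_upwards [hS₁s s, hκ'ae] with x h1 h2 r e
    rw [lp.inner_eq_tsum]
    refine tsum_congr fun k => ?_
    have : (S₁ (s, x) + κ' x • b₂ (s, x) r : Ell2) k = (σ₁ s x : Ell2) k + κ x * σ₂ k s x r := by
      rw [lp.coeFn_add, Pi.add_apply, lp.coeFn_smul, Pi.smul_apply, hb₂, smul_eq_mul, h2, ← h1]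
    rw [this]
    simp [mul_comm]

/-- The coefficients of the equation, put in jointly measurable form. -/
theorem exists_controlSystem (hT : 0 < T) (hp : 2 < p) {F : ℝ → E n → ℝ → ℝ} {lam₁ lam₂ : ℝ}
    {ψ₁ ψ₂ ψ₃ : ℝ → E n → ℝ} (hF : DriftAssumptions n p F lam₁ lam₂ ψ₁ ψ₂ ψ₃)
    {σ₁ : ℝ → Lp Ell2 2 (volume : Measure (E n))} {κ : E n → ℝ} {σ₂ : ℕ → ℝ → E n → ℝ → ℝ}
    {a b c : ℕ → ℝ} (hσ : DiffusionAssumptions n σ₁ κ σ₂ a b c) {g : ℝ → H n}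
    (hg : MemLocL2 n g) :
    ∃ S : ControlSystem n T p, (∀ s x r, S.F (s, x) r = F s x r) ∧
      (∀ᵐ s ∂volume.restrict (Set.Icc 0 T), (fun x => S.g (s, x)) =ᵐ[volume] g s) ∧
      ∀ s, ∀ᵐ x, ∀ (r : ℝ) (e : Ell2), inner ℝ (S.B (s, x) r) e
        = ∑' k, ((σ₁ s x : Ell2) k + κ x * σ₂ k s x r) * e k := by
  obtain ⟨C₁, hC₁, h1⟩ := hF.growth hp T
  obtain ⟨C₂, hC₂, h2⟩ := hF.oneSided T
  obtain ⟨G, hG, hGs⟩ := exists_joint_memLp (hg 0 T)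
  obtain ⟨B, φ, C₃, hC₃, hBm, hBl, hBg, hφm, hφi, hB⟩ := hσ.exists_coefficient T
  have hle1 : C₁ ≤ C₁ + C₂ + C₃ := by linarith
  have hle2 : C₂ ≤ C₁ + C₂ + C₃ := by linarith
  have hle3 : C₃ ≤ C₁ + C₂ + C₃ := by linarith
  refine ⟨{
    F := fun y => F y.1 y.2
    g := G
    B := B
    φ := φ
    ψ := fun y => ψ₁ y.1 y.2
    lam := lam₁
    C := C₁ + C₂ + C₃
    T_pos := hT
    two_lt := hp
    C_nonneg := by positivity
    lam_pos := hF.lam₁_pos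
    F_cont := hF.continuous.comp (f := fun z : (ℝ × E n) × ℝ => (z.1.1, z.1.2, z.2))
      (by fun_prop)
    F_growth := h1.mono fun y hy r =>
      (hy r).trans (mul_le_mul_of_nonneg_right hle1 (by positivity))
    F_mono := h2.mono fun y hy r r' =>
      (neg_le_neg (mul_le_mul_of_nonneg_right hle2 (sq_nonneg _))).trans (hy r r')
    F_coercive := ae_of_all _ fun y r => hF.coercive y.1 y.2 r
    ψ_int := memLp_one_iff_integrable.1 (hF.memLp_ψ₁ 0 T)
    g_mem := hG
    B_meas := hBm
    B_lip := fun y r r' => (hBl y r r').trans (mul_le_mul_of_nonneg_right hle3 (abs_nonneg _))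
    B_growth := fun y r => (hBg y r).trans
      (add_le_add_right (mul_le_mul_of_nonneg_right hle3 (abs_nonneg _)) _)
    φ_meas := hφm
    φ_int := fun s hs => ⟨(hφi s hs).1, (hφi s hs).2.trans hle3⟩ }, fun _ _ _ => rfl, hGs, hB⟩

end Coefficients

/-! ### Paths and weak solutions -/

section Paths

variable {n : ℕ} {α : Set.Ioo (0 : ℝ) 1} {T : ℝ}

/-- A path in `C([0,T],H)`, extended to `ℝ` by its end values. -/
noncomputable def pathH (hT : 0 ≤ T) (u : pathSpace n α T) (s : ℝ) : H n :=
  u.1.1 (Set.projIcc 0 T hT s)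

/-- A path in `L²(0,T;V)`, extended to `ℝ` by the values of a representative at the end points. -/
noncomputable def pathV (hT : 0 ≤ T) (u : pathSpace n α T) (s : ℝ) : V n α :=
  u.1.2 (Set.projIcc 0 T hT s)

/-- A control, extended to `ℝ` by the values of a representative at the end points. -/
noncomputable def controlPath (hT : 0 ≤ T) (v : Controls T) (s : ℝ) : Ell2 :=
  v (Set.projIcc 0 T hT s)

variable (hT : 0 ≤ T)

theorem continuous_pathH (u : pathSpace n α T) : Continuous (pathH hT u) :=
  u.1.1.continuous.comp continuous_projIcc

theorem pathH_of_nonpos (u : pathSpace n α T) : ∀ t ≤ 0, pathH hT u t = pathH hT u 0 := by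
  intro t ht
  simp only [pathH, Set.projIcc_of_le_left hT ht, Set.projIcc_left]

theorem pathH_val (u : pathSpace n α T) (t : Set.Icc (0 : ℝ) T) : pathH hT u t = u.1.1 t := by
  simp only [pathH, Set.projIcc_val]

theorem memLp_pathV (u : pathSpace n α T) :
    MemLp (pathV hT u) 2 (volume.restrict (Set.Icc 0 T)) :=
  (Lp.memLp u.1.2).comp_measurePreserving (measurePreserving_projIcc hT)

theorem memLp_controlPath (v : Controls T) :
    MemLp (controlPath hT v) 2 (volume.restrict (Set.Icc 0 T)) :=
  (Lp.memLp v).comp_measurePreserving (measurePreserving_projIcc hT)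

theorem ae_pathH_eq (u : pathSpace n α T) :
    ∀ᵐ s ∂volume.restrict (Set.Icc 0 T), pathH hT u s = V.toH (pathV hT u s) :=
  (measurePreserving_projIcc hT).quasiMeasurePreserving.ae u.2

theorem integral_projIcc {F : Type*} [NormedAddCommGroup F] [NormedSpace ℝ F]
    (f : Set.Icc (0 : ℝ) T → F) :
    ∫ s in Set.Icc 0 T, f (Set.projIcc 0 T hT s) = ∫ t, f t ∂timeMeasure T := by
  have h := setIntegral_time hT (⟨T, hT, le_rfl⟩ : Set.Icc (0 : ℝ) T) f
  rw [show Set.Iic (⟨T, hT, le_rfl⟩ : Set.Icc (0 : ℝ) T) = Set.univ from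
    Set.eq_univ_of_forall fun t => t.2.2, Measure.restrict_univ] at h
  exact h.symm

theorem integral_controlPath_sq (v : Controls T) :
    ∫ s in Set.Icc 0 T, ‖controlPath hT v s‖ ^ 2 = ∫ t, ‖v t‖ ^ 2 ∂timeMeasure T :=
  integral_projIcc hT fun t => ‖v t‖ ^ 2

theorem norm_sq_controls (v : Controls T) : ‖v‖ ^ 2 = ∫ t, ‖v t‖ ^ 2 ∂timeMeasure T := by
  rw [← real_inner_self_eq_norm_sq, L2.inner_def]
  simp only [real_inner_self_eq_norm_sq]

theorem norm_sq_L2V (z : Lp (V n α) 2 (timeMeasure T)) :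
    ‖z‖ ^ 2 = ∫ t, ‖z t‖ ^ 2 ∂timeMeasure T := by
  rw [← real_inner_self_eq_norm_sq, L2.inner_def]
  simp only [real_inner_self_eq_norm_sq]

theorem exists_joint_path (u : pathSpace n α T) :
    ∃ U : ℝ × E n → ℝ, StronglyMeasurable U ∧ ∀ s, (fun x => U (s, x)) =ᵐ[volume] pathH hT u s :=
  exists_joint_representative (continuous_pathH hT u).stronglyMeasurable

/-- The condition `u ∈ L^p(0,T;L^p(ℝⁿ))`, for a jointly measurable version of `u`. -/
theorem memLp_joint_iff {p : ℝ} (hp : 2 < p) (u : pathSpace n α T) {U : ℝ × E n → ℝ}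
    (hU : StronglyMeasurable U) (hs : ∀ s, (fun x => U (s, x)) =ᵐ[volume] pathH hT u s) :
    MemLp U (ENNReal.ofReal p) (slab n T)
      ↔ ∫⁻ t, (∫⁻ x, ‖u.1.1 t x‖ₑ ^ p) ∂timeMeasure T < ∞ := by
  have e : ∫⁻ t, (∫⁻ x, ‖u.1.1 t x‖ₑ ^ p) ∂timeMeasure T
      = ∫⁻ y, ‖U y‖ₑ ^ p ∂slab n T := by
    rw [lintegral_prod _ (hU.enorm.pow_const p).aemeasurable,
      ← (measurePreserving_val_time T).lintegral_comp_emb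
        (MeasurableEmbedding.subtype_coe measurableSet_Icc)]
    refine lintegral_congr fun t => lintegral_congr_ae ?_
    filter_upwards [hs t] with x hx
    rw [hx, pathH_val]
  rw [e, MemLp, and_iff_right hU.aestronglyMeasurable,
    eLpNorm_lt_top_iff_lintegral_rpow_enorm_lt_top (by simpa using by linarith)
      ENNReal.ofReal_ne_top, ENNReal.toReal_ofReal (by linarith)]

end Paths

section Equivalence

variable {n : ℕ} {α : Set.Ioo (0 : ℝ) 1} {T p : ℝ}

/-- The solutions of the controlled equation are the weak solutions of the linear equation with the
corresponding forcing. The forcing uses the coefficients of `S`, which agree with the given ones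
almost everywhere in space. -/
theorem isSolution_iff_weakSol {F : ℝ → E n → ℝ → ℝ}
    {σ₁ : ℝ → Lp Ell2 2 (volume : Measure (E n))} {κ : E n → ℝ} {σ₂ : ℕ → ℝ → E n → ℝ → ℝ}
    {g : ℝ → H n} {S : ControlSystem n T p} (hSF : ∀ s x r, S.F (s, x) r = F s x r)
    (hSg : ∀ᵐ s ∂volume.restrict (Set.Icc 0 T), (fun x => S.g (s, x)) =ᵐ[volume] g s)
    (hSB : ∀ s, ∀ᵐ x, ∀ (r : ℝ) (e : Ell2), inner ℝ (S.B (s, x) r) e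
        = ∑' k, ((σ₁ s x : Ell2) k + κ x * σ₂ k s x r) * e k)
    (u₀ : H n) (v : Controls T) (u : pathSpace n α T) {U : ℝ × E n → ℝ}
    (hU : StronglyMeasurable U)
    (hs : ∀ s, (fun x => U (s, x)) =ᵐ[volume] pathH S.T_pos.le u s) :
    IsSolution p F g σ₁ κ σ₂ u₀ v u ↔
      WeakSol T p u₀ (pathH S.T_pos.le u) (pathV S.T_pos.le u) U
        (S.forcing U (controlPath S.T_pos.le v)) := by
  have hT := S.T_pos.le
  have hp := S.two_lt
  have hcont := continuous_pathH hT u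
  have hv := memLp_controlPath hT v
  have hmem := memLp_joint_iff hT hp u hU hs
  have key : MemLp U (ENNReal.ofReal p) (slab n T) → ∀ (t : Set.Icc (0 : ℝ) T) (ξ : V n α),
      MemLp ξ.toH (ENNReal.ofReal p) volume →
      ∫ s in Set.Icc 0 (t : ℝ), ∫ x, S.forcing U (controlPath hT v) (s, x) * V.toH ξ x
        = (∫ s in Set.Iic t, inner ℝ (g s) ξ.toH ∂timeMeasure T)
          - (∫ s in Set.Iic t, (∫ x, F s x (u.1.1 s x) * ξ.toH x) ∂timeMeasure T)
          + ∫ s in Set.Iic t,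
            (∫ x, sigmaApply σ₁ κ σ₂ s (u.1.1 s) (v s) x * ξ.toH x) ∂timeMeasure T := by
    intro hUp t ξ hξ
    have hms := slab_mono (n := n) t.2.2
    have hm : volume.restrict (Set.Icc 0 (t : ℝ)) ≤ volume.restrict (Set.Icc 0 T) :=
      Measure.restrict_mono (Set.Icc_subset_Icc_right t.2.2) le_rfl
    have hproj : ∀ s ∈ Set.Icc 0 (t : ℝ), (Set.projIcc 0 T hT s : ℝ) = s := fun s hs =>
      congrArg Subtype.val (Set.projIcc_of_mem hT (Set.mem_Icc.2 ⟨hs.1, hs.2.trans t.2.2⟩))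
    have hξ2 := Lp.memLp (V.toH ξ)
    have j1 : Integrable (fun y => S.g y * V.toH ξ y.2) (slab n t) :=
      (S.g_mem.integrable_mul (hξ2.comp_snd _)).mono_measure hms
    have j2 : Integrable (fun y => S.F y (U y) * V.toH ξ y.2) (slab n t) :=
      ((S.memSumLp_drift hU (memLp_two_of_slice hU hcont hs T) hUp).integrable_mul_test
        hp hξ2 hξ).mono_measure hms
    have j3 : Integrable (fun y => inner ℝ (S.B y (U y)) (controlPath hT v y.1) * V.toH ξ y.2)
        (slab n t) :=
      ((S.memLp_noise hU hcont hs hv).integrable_mul (hξ2.comp_snd _)).mono_measure hms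
    rw [ControlSystem.setIntegral_forcing_mul hU hcont hs hUp hv hξ t.2, integral_prod _ j1,
      integral_prod _ j2, integral_prod _ j3, setIntegral_time hT, setIntegral_time hT,
      setIntegral_time hT]
    congr 1
    · congr 1
      · refine integral_congr_ae ?_
        filter_upwards [ae_mono hm hSg, ae_restrict_mem measurableSet_Icc] with s h1 h2
        rw [hproj s h2, L2.inner_def]
        refine integral_congr_ae ?_
        filter_upwards [h1] with x hx
        rw [hx, RCLike.inner_apply, conj_trivial, mul_comm]
      · refine integral_congr_ae ?_
        filter_upwards [ae_restrict_mem measurableSet_Icc] with s h2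
        refine integral_congr_ae ?_
        filter_upwards [hs s] with x hx
        rw [hx, hSF, hproj s h2]
        rfl
    · refine integral_congr_ae ?_
      filter_upwards [ae_restrict_mem measurableSet_Icc] with s h2
      refine integral_congr_ae ?_
      filter_upwards [hs s, hSB s] with x hx h3
      rw [hx, h3, hproj s h2]
      rfl
  have hform : ∀ (t : Set.Icc (0 : ℝ) T) (ξ : V n α),
      ∫ s in Set.Iic t, fracForm n α (V.toH (u.1.2 s)) ξ.toH ∂timeMeasure T
        = ∫ s in Set.Icc 0 (t : ℝ), fracForm n α (V.toH (pathV hT u s)) (V.toH ξ) := fun t ξ =>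
    setIntegral_time hT t _
  constructor
  · intro h
    have hUp := hmem.2 h.memLp
    refine ⟨hcont, pathH_of_nonpos hT u, memLp_pathV hT u, ae_pathH_eq hT u, hU, hs, hUp,
      S.memSumLp_forcing hU hcont hs hUp hv, fun t ht ξ hξ => ?_⟩
    have h1 := h.weak_eq ⟨t, ht⟩ ξ hξ
    have h2 := key hUp ⟨t, ht⟩ ξ hξ
    rw [hform, ← pathH_val hT] at h1
    simp only at h1 h2
    rw [h2]
    linarith
  · intro h
    refine ⟨hmem.1 h.memLp, fun t ξ hξ => ?_⟩
    have h1 := h.weak t t.2 ξ hξ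
    have h2 := key h.memLp t ξ hξ
    rw [h2, pathH_val, ← hform] at h1
    linarith

end Equivalence

/-! ### Weakly convergent controls -/

section WeakLimits

variable {𝓗 : Type*} [NormedAddCommGroup 𝓗] [InnerProductSpace ℝ 𝓗]

theorem tendsto_inner_of_tendsto_weakSpace {ι : Type*} {l : Filter ι} {v : ι → 𝓗} {x : 𝓗}
    (h : Tendsto (fun i => toWeakSpace ℝ 𝓗 (v i)) l (𝓝 (toWeakSpace ℝ 𝓗 x))) (φ : 𝓗) :
    Tendsto (fun i => (inner ℝ φ (v i) : ℝ)) l (𝓝 (inner ℝ φ x)) :=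
  ((WeakBilin.eval_continuous (topDualPairing ℝ 𝓗).flip (innerSL ℝ φ)).tendsto _).comp h

/-- Weakly convergent sequences are bounded. -/
theorem exists_norm_le_of_tendsto_inner [CompleteSpace 𝓗] {v : ℕ → 𝓗} {x : 𝓗}
    (h : ∀ φ : 𝓗, Tendsto (fun k => (inner ℝ φ (v k) : ℝ)) atTop (𝓝 (inner ℝ φ x))) :
    ∃ M, ∀ k, ‖v k‖ ≤ M := by
  obtain ⟨M, hM⟩ := banach_steinhaus (g := fun k => innerSL ℝ (v k)) fun φ => by
    obtain ⟨C, hC⟩ := (h φ).norm.bddAbove_range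
    refine ⟨C, fun k => ?_⟩
    rw [innerSL_apply_apply, real_inner_comm]
    exact hC ⟨k, rfl⟩
  exact ⟨M, fun k => by simpa using hM k⟩

/-- Balls of a separable Hilbert space are weakly sequentially compact. -/
theorem exists_subseq_tendsto_inner [CompleteSpace 𝓗] [SecondCountableTopology 𝓗] {v : ℕ → 𝓗}
    {M : ℝ} (hM : ∀ k, ‖v k‖ ≤ M) :
    ∃ ns : ℕ → ℕ, StrictMono ns ∧ ∃ x : 𝓗, ‖x‖ ≤ M ∧
      ∀ φ : 𝓗, Tendsto (fun k => (inner ℝ φ (v (ns k)) : ℝ)) atTop (𝓝 (inner ℝ φ x)) := by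
  have hM0 : 0 ≤ M := (norm_nonneg _).trans (hM 0)
  obtain ⟨D, hDc, hD⟩ := TopologicalSpace.exists_countable_dense 𝓗
  have : Countable D := hDc
  obtain ⟨ns, hns, hC⟩ := exists_subseq_cauchySeq_inner (ι := D)
    (a := fun k i => inner ℝ (i : 𝓗) (v k)) (b := fun i => ‖(i : 𝓗)‖ * M) fun k i =>
      (abs_real_inner_le_norm _ _).trans (mul_le_mul_of_nonneg_left (hM k) (norm_nonneg _))
  have hall : ∀ φ : 𝓗, CauchySeq fun k => (inner ℝ φ (v (ns k)) : ℝ) := fun φ =>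
    cauchySeq_inner_of_mem_closure_span (fun k => hM (ns k)) (fun ξ hξ => hC ⟨ξ, hξ⟩)
      (closure_mono Submodule.subset_span (hD φ))
  choose L hL using fun φ => cauchySeq_tendsto_of_complete (hall φ)
  have hLle : ∀ φ, ‖L φ‖ ≤ M * ‖φ‖ := fun φ =>
    le_of_tendsto (hL φ).norm (Eventually.of_forall fun k => by
      rw [mul_comm]
      exact (abs_real_inner_le_norm _ _).trans
        (mul_le_mul_of_nonneg_left (hM _) (norm_nonneg _)))
  let Lc : StrongDual ℝ 𝓗 := LinearMap.mkContinuous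
    { toFun := L
      map_add' := fun x y => tendsto_nhds_unique (hL (x + y)) (by
        simp only [inner_add_left]
        exact (hL x).add (hL y))
      map_smul' := fun c x => tendsto_nhds_unique (hL (c • x)) (by
        simp only [real_inner_smul_left]
        exact (hL x).const_mul c) } M hLle
  refine ⟨ns, hns, (InnerProductSpace.toDual ℝ 𝓗).symm Lc, ?_, fun φ => ?_⟩
  · rw [LinearIsometryEquiv.norm_map]
    exact LinearMap.mkContinuous_norm_le _ hM0 _
  · rw [real_inner_comm, InnerProductSpace.toDual_symm_apply]
    exact hL φ

end WeakLimits

section Convergence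

variable {n : ℕ} {α : Set.Ioo (0 : ℝ) 1} {T p : ℝ} {F : ℝ → E n → ℝ → ℝ}
  {σ₁ : ℝ → Lp Ell2 2 (volume : Measure (E n))} {κ : E n → ℝ} {σ₂ : ℕ → ℝ → E n → ℝ → ℝ}
  {g : ℝ → H n} {S : ControlSystem n T p} {u₀ : H n}

/-- The `V`-valued component of an element of the path space is determined by the `H`-valued one. -/
theorem eq_of_eqOn_pathH (hT : 0 ≤ T) {u u' : pathSpace n α T}
    (h : ∀ t ∈ Set.Icc 0 T, pathH hT u t = pathH hT u' t) : u = u' := by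
  have h1 : u.1.1 = u'.1.1 := by
    ext1 t
    rw [← pathH_val hT, ← pathH_val hT, h t t.2]
  refine Subtype.ext (Prod.ext h1 (Lp.ext ?_))
  have e1 : ∀ᵐ t ∂timeMeasure T, u.1.1 t = V.toH (u.1.2 t) := u.2
  have e2 : ∀ᵐ t ∂timeMeasure T, u'.1.1 t = V.toH (u'.1.2 t) := u'.2
  filter_upwards [e1, e2] with t h2 h3
  exact V.toH_injective (by rw [← h2, ← h3, h1])

theorem integral_pathV_sub_sq (hT : 0 ≤ T) (u u' : pathSpace n α T) :
    ∫ s in Set.Icc 0 T, ‖pathV hT u s - pathV hT u' s‖ ^ 2 = ‖u.1.2 - u'.1.2‖ ^ 2 := by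
  rw [norm_sq_L2V, ← integral_congr_ae (f := fun t => ‖u.1.2 t - u'.1.2 t‖ ^ 2)]
  · exact integral_projIcc hT fun t => ‖u.1.2 t - u'.1.2 t‖ ^ 2
  · filter_upwards [Lp.coeFn_sub u.1.2 u'.1.2] with t ht
    rw [ht, Pi.sub_apply]

theorem dist_pathSpace_le (hT : 0 ≤ T) {u u' : pathSpace n α T} {δ : ℝ} (hδ : 0 ≤ δ)
    (h : ∀ t ∈ Set.Icc 0 T, ‖pathH hT u t - pathH hT u' t‖ ^ 2 ≤ δ ^ 2)
    (h' : ∫ s in Set.Icc 0 T, ‖pathV hT u s - pathV hT u' s‖ ^ 2 ≤ δ ^ 2) : dist u u' ≤ δ := by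
  change dist u.1 u'.1 ≤ δ
  rw [Prod.dist_eq, max_le_iff]
  constructor
  · refine (ContinuousMap.dist_le hδ).2 fun t => ?_
    rw [dist_eq_norm, ← pathH_val hT, ← pathH_val hT]
    exact le_of_sq_le_sq (h t t.2) hδ
  · rw [dist_eq_norm]
    rw [integral_pathV_sub_sq] at h'
    exact le_of_sq_le_sq h' hδ

/-- Pairings with a square integrable `l²`-valued function are continuous functionals of the
control. -/
theorem integral_inner_controlPath (hT : 0 ≤ T) {P : ℝ → Ell2}
    (hP : MemLp P 2 (volume.restrict (Set.Icc 0 T))) :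
    ∃ φ : Controls T, ∀ v : Controls T,
      ∫ s in Set.Icc 0 T, (inner ℝ (P s) (controlPath hT v s) : ℝ) = inner ℝ φ v := by
  have hP' := hP.comp_measurePreserving (measurePreserving_val_time T)
  refine ⟨hP'.toLp, fun v => ?_⟩
  rw [L2.inner_def, ← integral_projIcc hT]
  refine integral_congr_ae ?_
  filter_upwards [(measurePreserving_projIcc hT).quasiMeasurePreserving.ae hP'.coeFn_toLp,
    ae_restrict_mem measurableSet_Icc] with s h1 h2
  have h3 : (Set.projIcc 0 T hT s : ℝ) = s := congrArg Subtype.val (Set.projIcc_of_mem hT h2)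
  rw [h1, Function.comp_apply, h3, controlPath]

/-- Solutions whose controls converge weakly converge along a subsequence, and the limit is a
solution for the limit control. -/
theorem exists_subseq_tendsto_solution (hSF : ∀ s x r, S.F (s, x) r = F s x r)
    (hSg : ∀ᵐ s ∂volume.restrict (Set.Icc 0 T), (fun x => S.g (s, x)) =ᵐ[volume] g s)
    (hSB : ∀ s, ∀ᵐ x, ∀ (r : ℝ) (e : Ell2), inner ℝ (S.B (s, x) r) e
        = ∑' k, ((σ₁ s x : Ell2) k + κ x * σ₂ k s x r) * e k)
    {vs : ℕ → Controls T} {us : ℕ → pathSpace n α T}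
    (hsol : ∀ k, IsSolution p F g σ₁ κ σ₂ u₀ (vs k) (us k)) {M : ℝ} (hM : ∀ k, ‖vs k‖ ≤ M)
    {v : Controls T}
    (hv : ∀ φ, Tendsto (fun k => (inner ℝ φ (vs k) : ℝ)) atTop (𝓝 (inner ℝ φ v))) :
    ∃ ns : ℕ → ℕ, StrictMono ns ∧ ∃ u : pathSpace n α T,
      Tendsto (fun k => us (ns k)) atTop (𝓝 u) ∧ IsSolution p F g σ₁ κ σ₂ u₀ v u := by
  have hT := S.T_pos
  have hp := S.two_lt
  choose U hU hUs using fun k => exists_joint_path hT.le (us k)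
  have hweak : ∀ k, WeakSol T p u₀ (pathH hT.le (us k)) (pathV hT.le (us k)) (U k)
      (S.forcing (U k) (controlPath hT.le (vs k))) := fun k =>
    (isSolution_iff_weakSol hSF hSg hSB u₀ (vs k) (us k) (hU k) (hUs k)).1 (hsol k)
  have hcontrol : ∀ k, ∫ s in Set.Icc 0 T, ‖controlPath hT.le (vs k) s‖ ^ 2 ≤ M ^ 2 := by
    intro k
    rw [integral_controlPath_sq, ← norm_sq_controls]
    exact pow_le_pow_left₀ (norm_nonneg _) (hM k) 2
  obtain ⟨R₀, hR₀, hbound⟩ := S.exists_bound α u₀ (M ^ 2)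
  have hb : ∀ k, ControlSystem.Bounded T p (max R₀ (M ^ 2)) (pathH hT.le (us k))
      (pathV hT.le (us k)) (U k) (controlPath hT.le (vs k)) := by
    intro k
    obtain ⟨h1, h2, h3⟩ := hbound _ _ _ _ (memLp_controlPath hT.le (vs k)) (hcontrol k) (hweak k)
    exact ⟨memLp_controlPath hT.le (vs k), (hcontrol k).trans (le_max_right _ _),
      fun t ht => (h1 t ht).trans (le_max_left _ _), h2.trans (le_max_left _ _),
      h3.trans (le_max_left _ _)⟩
  obtain ⟨ns, hns, hcauchy⟩ := exists_subseq_weakly_cauchy hT.le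
    (Z := fun k => pathH hT.le (us k)) (M := Real.sqrt (max R₀ (M ^ 2)))
    (D := {φ | ∃ ξ : V n α, V.toH ξ = φ ∧ MemLp φ (ENNReal.ofReal p) volume})
    (fun k t ht => Real.le_sqrt_of_sq_le ((hb k).sup t ht))
    (by
      rintro _ ⟨ξ, rfl, hξ⟩ η hη
      obtain ⟨c, hc, h⟩ := ControlSystem.exists_modulus S u₀ (max R₀ (M ^ 2)) hξ hη
      exact ⟨c, hc, fun k => h _ _ _ _ (hweak k) (hb k)⟩)
    (fun k => by
      filter_upwards [(hweak k).ae_eq, ae_memLp_slice (by linarith) (hweak k).memLp] with s h1 h2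
      exact ⟨_, h1.symm, (memLp_congr_ae (hUs k s)).1 h2⟩)
  have hCS : CauchySeq fun k => us (ns k) := by
    refine Metric.cauchySeq_iff.2 fun ε hε => ?_
    obtain ⟨N, hN⟩ := ControlSystem.cauchy_of_weakly_cauchy (fun k => hweak (ns k))
      (fun k => hb (ns k)) hcauchy (show 0 < (ε / 2) ^ 2 by positivity)
    refine ⟨N, fun k hk m hm => lt_of_le_of_lt (dist_pathSpace_le hT.le (δ := ε / 2)
      (by positivity) (hN k hk m hm).1 (hN k hk m hm).2) (by linarith)⟩
  obtain ⟨u, hu⟩ := cauchySeq_tendsto_of_complete hCS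
  have hu1 : Tendsto (fun k => (us (ns k)).1.1) atTop (𝓝 u.1.1) :=
    ((continuous_fst.comp continuous_subtype_val).tendsto _).comp hu
  have hu2 : Tendsto (fun k => (us (ns k)).1.2) atTop (𝓝 u.1.2) :=
    ((continuous_snd.comp continuous_subtype_val).tendsto _).comp hu
  obtain ⟨U', hU', hUs'⟩ := exists_joint_path hT.le u
  refine ⟨ns, hns, u, hu, (isSolution_iff_weakSol hSF hSg hSB u₀ v u hU' hUs').2
    (ControlSystem.weakSol_of_tendsto (fun k => hweak (ns k)) (fun k => hb (ns k))
      (continuous_pathH hT.le u) (pathH_of_nonpos hT.le u) (memLp_pathV hT.le u)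
      (ae_pathH_eq hT.le u) hU' hUs' (fun t _ => ?_) ?_ (memLp_controlPath hT.le v)
      fun P hP => ?_)⟩
  · exact ((ContinuousEvalConst.continuous_eval_const (Set.projIcc 0 T hT.le t)).tendsto _).comp
      hu1
  · simp only [integral_pathV_sub_sq]
    simpa using ((tendsto_iff_norm_sub_tendsto_zero.1 hu2).pow 2)
  · obtain ⟨φ, hφ⟩ := integral_inner_controlPath hT.le hP
    simp only [hφ]
    exact (hv φ).comp hns.tendsto_atTop

/-- The solution for a given control is unique. -/
theorem isSolution_unique (hSF : ∀ s x r, S.F (s, x) r = F s x r)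
    (hSg : ∀ᵐ s ∂volume.restrict (Set.Icc 0 T), (fun x => S.g (s, x)) =ᵐ[volume] g s)
    (hSB : ∀ s, ∀ᵐ x, ∀ (r : ℝ) (e : Ell2), inner ℝ (S.B (s, x) r) e
        = ∑' k, ((σ₁ s x : Ell2) k + κ x * σ₂ k s x r) * e k)
    {v : Controls T} {u u' : pathSpace n α T} (hu : IsSolution p F g σ₁ κ σ₂ u₀ v u)
    (hu' : IsSolution p F g σ₁ κ σ₂ u₀ v u') : u = u' := by
  have hT := S.T_pos
  obtain ⟨U, hU, hUs⟩ := exists_joint_path hT.le u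
  obtain ⟨U', hU', hUs'⟩ := exists_joint_path hT.le u'
  exact eq_of_eqOn_pathH hT.le (ControlSystem.eq_of_same_control (memLp_controlPath hT.le v)
    ((isSolution_iff_weakSol hSF hSg hSB u₀ v u hU hUs).1 hu)
    ((isSolution_iff_weakSol hSF hSg hSB u₀ v u' hU' hUs').1 hu'))

end Convergence

end FracControl

theorem mainTheorem4 (n : ℕ) (hn : 1 ≤ n) (α : Set.Ioo (0 : ℝ) 1) (T : ℝ) (hT : 0 < T)
    (p : ℝ) (hp : 2 < p)
    (F : ℝ → E n → ℝ → ℝ) (lam₁ lam₂ : ℝ) (ψ₁ ψ₂ ψ₃ : ℝ → E n → ℝ)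
    (hF : DriftAssumptions n p F lam₁ lam₂ ψ₁ ψ₂ ψ₃)
    (σ₁ : ℝ → Lp Ell2 2 (volume : Measure (E n))) (κ : E n → ℝ) (σ₂ : ℕ → ℝ → E n → ℝ → ℝ)
    (a b c : ℕ → ℝ) (hσ : DiffusionAssumptions n σ₁ κ σ₂ a b c)
    (g : ℝ → H n) (hg : MemLocL2 n g) (u₀ : H n) :
    (∀ (v : Controls T) (vs : ℕ → Controls T) (u : pathSpace n α T) (us : ℕ → pathSpace n α T),
      IsSolution p F g σ₁ κ σ₂ u₀ v u →
      (∀ k, IsSolution p F g σ₁ κ σ₂ u₀ (vs k) (us k)) →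
      Tendsto (fun k => toWeakSpace ℝ (Controls T) (vs k)) atTop
        (𝓝 (toWeakSpace ℝ (Controls T) v)) →
      Tendsto us atTop (𝓝 u)) ∧
    (∀ N : ℝ, 0 < N → IsCompact (levelSet p F g σ₁ κ σ₂ u₀ N : Set (pathSpace n α T))) := by
  obtain ⟨S, hSF, hSg, hSB⟩ := exists_controlSystem hT hp hF hσ hg
  refine ⟨fun v vs u us hu hus hv => ?_, fun N hN => ?_⟩
  · have hinner := tendsto_inner_of_tendsto_weakSpace hv
    obtain ⟨M, hM⟩ := exists_norm_le_of_tendsto_inner hinner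
    refine tendsto_of_subseq_tendsto fun ns hns => ?_
    obtain ⟨ms, -, u', hu', hsol⟩ := exists_subseq_tendsto_solution hSF hSg hSB
      (fun k => hus (ns k)) (fun k => hM (ns k)) fun φ => (hinner φ).comp hns
    -- the limit solves the equation with the control `v`, so it is `u`
    rw [isSolution_unique hSF hSg hSB hu hsol]
    exact ⟨ms, hu'⟩
  · refine IsSeqCompact.isCompact fun us hus => ?_
    choose vs hvs hsol using hus
    have hM : ∀ k, ‖vs k‖ ≤ Real.sqrt N := fun k =>
      Real.le_sqrt_of_sq_le (by rw [norm_sq_controls]; exact hvs k)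
    obtain ⟨ns, hns, v, hv, hinner⟩ := exists_subseq_tendsto_inner hM
    obtain ⟨ms, hms, u, hu, hsolu⟩ := exists_subseq_tendsto_solution hSF hSg hSB
      (fun k => hsol (ns k)) (fun k => hM (ns k)) hinner
    refine ⟨u, ⟨v, ?_, hsolu⟩, fun k => ns (ms k), hns.comp hms, hu⟩
    change ∫ t, ‖v t‖ ^ 2 ∂timeMeasure T ≤ N
    rw [← norm_sq_controls]
    calc ‖v‖ ^ 2 ≤ Real.sqrt N ^ 2 := pow_le_pow_left₀ (norm_nonneg _) hv 2
      _ = N := Real.sq_sqrt hN.le
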